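/- Let $(M,g)$ be a smooth Riemannian manifold (Hausdorff, finite-dimensional, without boundary) and $B\subset M$ a compact embedded submanifold, with induced metric $g^B$, normal bundle $\nu B$, and unit normal bundle $\pi:S(\nu B)\to B$. The normal connection $\nabla^\nu$ (the normal projection of the Levi-Civita connection $\nabla$) splits $T_WS(\nu B)=T_{\pi(W)}B\oplus V_W$, a tangent vector $W'$ having horizontal part $d\pi(W')$ and vertical part $\nabla^{\nu}_{d\pi (W')}W\in\nu_{\pi(W)} B$. Let $g^V$ be the metric induced by $g$ on the vertical bundle $V$, and for $W\in S(\nu_bB)$ let $\mathrm{II}_W(X,Y)=g(\nabla_XY,W)$, $X,Y\in T_bB$, be the second fundamental form ($Y$ being extended to a tangent field of $B$), pulled back to $S(\nu B)$ by $\pi$. On $[0,\epsilon)\times S(\nu B)$ consider $$h_1=dr^2\oplus r^2g^V\oplus\pi^*g^B,\qquad \hat h_1=h_1-2r\,\mathrm{II},\qquad g_1=\mathcal E^*g,\qquad \mathcal E(r,W)=\exp_{\pi (W)}(rW),$$ and let $\varphi$ be the endomorphism of the tangent bundle of $[0,\epsilon)\times S(\nu B)$ which multiplies vertical vectors by $r$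 and is the identity on horizontal vectors and on $\partial_r$; for a field $h$ of bilinear forms put $h^\varphi=h(\varphi^{-1}\cdot,\varphi^{-1}\cdot)$ for $r>0$. A field $h'$ of symmetric positive definite bilinear forms on $(0,\epsilon)\times S(\nu B)$ is called a perturbation of order $p$ of $h$ if $h'^{\varphi}=h^\varphi+r^p\alpha$ for $r>0$, where $\alpha$ is a field of symmetric bilinear forms on the tangent spaces of $[0,\epsilon)\times S(\nu B)$, smooth up to the boundary $r=0$. Call $\epsilon>0$ a collar width if $\mathcal E$ is defined and smooth at all points of $[0,\epsilon)\times S(\nu B)$ and is an immersion on $(0,\epsilon)\times S(\nu B)$ (this holds in particular if $\mathcal E$ is smooth on $[0,\epsilon)\times S(\nu B)$ and a diffeomorphism onto its image for $r\neq 0$). Then: 1. there is a collar width $\epsilon$ for which $\hat h_1$ is a first-order perturbation of $h_1$ on $[0,\epsilon)\times S(\nu B)$; in particular $\hat h_1$ is positive definite there for $r>0$; 2. for every collar width $\epsilon$, the degenerate metric $g_1$ on $[0,\epsilon)\times S(\nu B)$ is a second-order perturbation of $\hat h_1$. -/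

import Mathlib

set_option maxSynthPendingDepth 3

open scoped Manifold ContDiff Topology
open Set Bundle

noncomputable section

namespace NormalBlowUp

/-! ## Christoffel symbols, connector and exponential map of a Riemannian manifold -/

section Riemannian

variable {E : Type*} [NormedAddCommGroup E] [NormedSpace ℝ E]
  {M : Type*} [TopologicalSpace M] [ChartedSpace E M] [IsManifold 𝓘(ℝ, E) ∞ M]

/-- Smooth Riemannian metrics on the manifold `M` modelled on `E`. -/
abbrev Metric (E : Type*) [NormedAddCommGroup E] [NormedSpace ℝ E]
    (M : Type*) [TopologicalSpace M] [ChartedSpace E M] [IsManifold 𝓘(ℝ, E) ∞ M] :=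
  ContMDiffRiemannianMetric 𝓘(ℝ, E) ∞ E (fun x : M => TangentSpace 𝓘(ℝ, E) x)

/-- The scalar product on the tangent space at `x`. -/
def metricForm (g : Metric E M) (x : M) : LinearMap.BilinForm ℝ (TangentSpace 𝓘(ℝ, E) x) :=
  LinearMap.mk₂ ℝ (fun u v => g.inner x u v) (by simp) (by simp) (by simp) (by simp)

/-- The coefficients of the metric in the preferred chart at `x`: the value at the point `y` of
the chart is the bilinear form `(u, v) ↦ g (∂_u, ∂_v)`. -/
def chartMetric (g : Metric E M) (x : M) (y : E) : E →L[ℝ] E →L[ℝ] ℝ :=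
  let p : M := (extChartAt 𝓘(ℝ, E) x).symm y
  let G : E →L[ℝ] E →L[ℝ] ℝ := g.inner p
  let D : E →L[ℝ] E := mfderiv 𝓘(ℝ, E) 𝓘(ℝ, E) (extChartAt 𝓘(ℝ, E) x).symm y
  G.bilinearComp D D

/-- The Koszul expression `(u, v) ↦ (w ↦ ½ (∂_u G (v, w) + ∂_v G (u, w) - ∂_w G (u, v)))`, as a
function of the derivative `DG u (v, w) = ∂_u G (v, w)` of the metric coefficients. -/
def koszul (DG : E →L[ℝ] (E →L[ℝ] E →L[ℝ] ℝ)) : E →L[ℝ] E →L[ℝ] (E →L[ℝ] ℝ) :=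
  (1 / 2 : ℝ) • (DG + ContinuousLinearMap.flip DG -
    ((ContinuousLinearMap.flipₗᵢ ℝ E E ℝ : _ →L[ℝ] E →L[ℝ] E →L[ℝ] ℝ).comp
      (ContinuousLinearMap.flip DG)))

theorem koszul_apply (DG : E →L[ℝ] (E →L[ℝ] E →L[ℝ] ℝ)) (u v w : E) :
    koszul DG u v w = (1 / 2) * (DG u v w + DG v u w - DG w u v) := by
  rfl

/-- The Christoffel symbols of the Levi-Civita connection at `x`, in the preferred chart at `x`:
`Γ (u, v)` is the vector whose scalar product with `w` is the Koszul expression. -/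
def christoffel (g : Metric E M) (x : M) : E →L[ℝ] E →L[ℝ] E :=
  let y : E := extChartAt 𝓘(ℝ, E) x x
  (ContinuousLinearMap.compL ℝ E (E →L[ℝ] ℝ) E (chartMetric g x y).inverse).comp
    (koszul (fderiv ℝ (chartMetric g x) y))

/-- The connector of the Levi-Civita connection. A tangent vector to `TM` at the point `Y` has in
the preferred chart the coordinates `ξ = (a, c)`, with `a` the velocity of the base point and `c`
the derivative of the components of `Y`; it is sent to the covariant derivative
`∇_a Y = c + Γ (a, Y)`. -/
def connector (g : Metric E M) (Y : TangentBundle 𝓘(ℝ, E) M) :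
    TangentSpace 𝓘(ℝ, E).tangent Y →ₗ[ℝ] TangentSpace 𝓘(ℝ, E) Y.proj :=
  (LinearMap.snd ℝ E E + ((christoffel g Y.proj).flip Y.2).toLinearMap.comp (LinearMap.fst ℝ E E) :
    E × E →ₗ[ℝ] E)

/-- The geodesic spray: the vector field on `TM` whose integral curves are the velocity fields
`(γ, γ')` of the geodesics (`γ'' + Γ (γ', γ') = 0`). -/
def geodesicSpray (g : Metric E M) (Y : TangentBundle 𝓘(ℝ, E) M) :
    TangentSpace 𝓘(ℝ, E).tangent Y :=
  ((Y.2, - christoffel g Y.proj Y.2 Y.2) : E × E)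

/-- `β` is the velocity field of a geodesic, defined on the time interval `[0, 1]`, with initial
velocity `Y`. -/
def IsGeodesicLift (g : Metric E M) (Y : TangentBundle 𝓘(ℝ, E) M)
    (β : ℝ → TangentBundle 𝓘(ℝ, E) M) : Prop :=
  β 0 = Y ∧ IsMIntegralCurveOn β (geodesicSpray g) (Icc 0 1)

/-- The domain of the exponential map. -/
def expDomain (g : Metric E M) : Set (TangentBundle 𝓘(ℝ, E) M) :=
  {Y | ∃ β, IsGeodesicLift g Y β}

open Classical in
/-- The exponential map `exp_x v = γ_v 1` (with the dummy value `x` outside of its domain). -/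
def expMap (g : Metric E M) (Y : TangentBundle 𝓘(ℝ, E) M) : M :=
  if h : Y ∈ expDomain g then (h.choose 1).proj else Y.proj

end Riemannian

/-! ## The unit normal bundle of a submanifold and the metrics on the blow-up -/

section Submanifold

variable {E : Type*} [NormedAddCommGroup E] [NormedSpace ℝ E]
  {M : Type*} [TopologicalSpace M] [ChartedSpace E M] [IsManifold 𝓘(ℝ, E) ∞ M]
  {F : Type*} [NormedAddCommGroup F] [NormedSpace ℝ F]
  {B : Type*} [TopologicalSpace B] [ChartedSpace F B] [IsManifold 𝓘(ℝ, F) ∞ B]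

/-- The total space of `TM|_B = ι^* TM`, a smooth manifold with model `F × E`. Its points are
written `⟨b, w⟩` with `b : B` and `w ∈ T_{ι b} M`. -/
abbrev AmbientBundle (ι : C^∞⟮𝓘(ℝ, F), B; 𝓘(ℝ, E), M⟯) :=
  TotalSpace E (ι *ᵖ (TangentSpace 𝓘(ℝ, E) : M → Type _))

/-- The differential of `ι` at `b`. -/
abbrev dι (ι : C^∞⟮𝓘(ℝ, F), B; 𝓘(ℝ, E), M⟯) (b : B) :
    TangentSpace 𝓘(ℝ, F) b →L[ℝ] TangentSpace 𝓘(ℝ, E) (ι b) :=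
  mfderiv 𝓘(ℝ, F) 𝓘(ℝ, E) ι b

/-- Tangent space of the manifold `TM|_B` at `W`. -/
abbrev AmbientTangent (ι : C^∞⟮𝓘(ℝ, F), B; 𝓘(ℝ, E), M⟯) (W : AmbientBundle ι) :=
  TangentSpace (𝓘(ℝ, F).prod 𝓘(ℝ, E)) W

/-- The canonical map `TM|_B → TM`. -/
def toTangentBundle (ι : C^∞⟮𝓘(ℝ, F), B; 𝓘(ℝ, E), M⟯) (W : AmbientBundle ι) :
    TangentBundle 𝓘(ℝ, E) M :=
  ⟨ι W.proj, W.2⟩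

/-- The metric `g^B` on `B` induced by `g`. -/
def baseMetric (g : Metric E M) (ι : C^∞⟮𝓘(ℝ, F), B; 𝓘(ℝ, E), M⟯) (b : B) :
    LinearMap.BilinForm ℝ (TangentSpace 𝓘(ℝ, F) b) :=
  (metricForm g (ι b)).compl₁₂ (dι ι b).toLinearMap (dι ι b).toLinearMap

/-- The `g`-orthogonal projection `T_{ι b} M → T_b B`: the vector `u` with
`g^B (u, u') = g (w, dι u')` for all `u'`. -/
def tangentialPart (g : Metric E M) (ι : C^∞⟮𝓘(ℝ, F), B; 𝓘(ℝ, E), M⟯) (b : B) :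
    TangentSpace 𝓘(ℝ, E) (ι b) →ₗ[ℝ] TangentSpace 𝓘(ℝ, F) b :=
  let G : E →L[ℝ] E →L[ℝ] ℝ := g.inner (ι b)
  let D : F →L[ℝ] E := dι ι b
  ((G.bilinearComp D D).inverse.comp (G.bilinearComp (ContinuousLinearMap.id ℝ E) D)).toLinearMap

/-- The `g`-orthogonal projection of `T_{ι b} M` onto the normal space `ν_b B`. -/
def normalPart (g : Metric E M) (ι : C^∞⟮𝓘(ℝ, F), B; 𝓘(ℝ, E), M⟯) (b : B) :
    TangentSpace 𝓘(ℝ, E) (ι b) →ₗ[ℝ] TangentSpace 𝓘(ℝ, E) (ι b) :=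
  LinearMap.id - (dι ι b).toLinearMap ∘ₗ tangentialPart g ι b

/-- The Levi-Civita derivative `∇_u Y` of the vector field `Y = dι V` along `B`, where `V` is the
field on `B` near `b` with constant components `v` in the preferred chart at `b`. In the preferred
charts at `b` and `ι b` the components of `Y` are `Dι v`, hence
`∇_u Y = D²ι (u, v) + Γ (Dι u, Dι v)`. -/
def covDerivTangent (g : Metric E M) (ι : C^∞⟮𝓘(ℝ, F), B; 𝓘(ℝ, E), M⟯) (b : B) :
    TangentSpace 𝓘(ℝ, F) b →ₗ[ℝ] TangentSpace 𝓘(ℝ, F) b →ₗ[ℝ] TangentSpace 𝓘(ℝ, E) (ι b) :=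
  let c : F → E := writtenInExtChartAt 𝓘(ℝ, F) 𝓘(ℝ, E) b ι
  let D₂ : F →L[ℝ] F →L[ℝ] E := fderiv ℝ (fderiv ℝ c) (extChartAt 𝓘(ℝ, F) b b)
  let D : F →L[ℝ] E := dι ι b
  ContinuousLinearMap.toLinearMap₁₂ (D₂ + (christoffel g (ι b)).bilinearComp D D)

/-- The second fundamental form `II_W (u, v) = g (∇_u Y, W)`, with `Y` a tangent field of `B`
extending `v`. -/
def secondFundamentalForm (g : Metric E M) (ι : C^∞⟮𝓘(ℝ, F), B; 𝓘(ℝ, E), M⟯)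
    (W : AmbientBundle ι) : LinearMap.BilinForm ℝ (TangentSpace 𝓘(ℝ, F) W.proj) :=
  (covDerivTangent g ι W.proj).compr₂
    ((metricForm g (ι W.proj)).flip W.2)

/-- The unit normal bundle `S(νB)`, as a subset of `TM|_B`. -/
def unitNormalBundle (g : Metric E M) (ι : C^∞⟮𝓘(ℝ, F), B; 𝓘(ℝ, E), M⟯) :
    Set (AmbientBundle ι) :=
  {W | g.inner (ι W.proj) W.2 W.2 = 1 ∧ ∀ u, g.inner (ι W.proj) W.2 (dι ι W.proj u) = 0}

/-- Tangent vectors to a submanifold `N` of `TM|_B` at `W`: the velocities at `W` of the smooth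
curves contained in `N`. -/
def tangentVectors (ι : C^∞⟮𝓘(ℝ, F), B; 𝓘(ℝ, E), M⟯) (N : Set (AmbientBundle ι))
    (W : AmbientBundle ι) : Set (AmbientTangent ι W) :=
  {ζ | ∃ c : ℝ → AmbientBundle ι, ContMDiff 𝓘(ℝ, ℝ) (𝓘(ℝ, F).prod 𝓘(ℝ, E)) ∞ c ∧
    (∀ t, c t ∈ N) ∧
    (⟨W, ζ⟩ : TangentBundle (𝓘(ℝ, F).prod 𝓘(ℝ, E)) (AmbientBundle ι)) =
      ⟨c 0, mfderiv 𝓘(ℝ, ℝ) (𝓘(ℝ, F).prod 𝓘(ℝ, E)) c 0 (1 : ℝ)⟩}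

/-- The differential of the projection `π : TM|_B → B`. -/
def dπ (ι : C^∞⟮𝓘(ℝ, F), B; 𝓘(ℝ, E), M⟯) (W : AmbientBundle ι) :
    AmbientTangent ι W →L[ℝ] TangentSpace 𝓘(ℝ, F) W.proj :=
  mfderiv (𝓘(ℝ, F).prod 𝓘(ℝ, E)) 𝓘(ℝ, F) (fun V : AmbientBundle ι => V.proj) W

/-- The covariant derivative `∇_u W` with respect to the pulled-back Levi-Civita connection on
`TM|_B`, as a function of the velocity of `W`. -/
def covDeriv (g : Metric E M) (ι : C^∞⟮𝓘(ℝ, F), B; 𝓘(ℝ, E), M⟯) (W : AmbientBundle ι) :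
    AmbientTangent ι W →ₗ[ℝ] TangentSpace 𝓘(ℝ, E) (ι W.proj) :=
  connector g (toTangentBundle ι W) ∘ₗ
    (mfderiv (𝓘(ℝ, F).prod 𝓘(ℝ, E)) 𝓘(ℝ, E).tangent (toTangentBundle ι) W).toLinearMap

/-- The covariant derivative `∇^ν_u W = P^ν ∇_u W` of the normal connection. On vectors tangent
to `S(νB)` this is the vertical component, an element of `ν_b B`; the horizontal component is
given by `dπ`. -/
def normalCovDeriv (g : Metric E M) (ι : C^∞⟮𝓘(ℝ, F), B; 𝓘(ℝ, E), M⟯) (W : AmbientBundle ι) :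
    AmbientTangent ι W →ₗ[ℝ] TangentSpace 𝓘(ℝ, E) (ι W.proj) :=
  normalPart g ι W.proj ∘ₗ covDeriv g ι W

/-- The vertical lift `T_{ι b} M → T_W (TM|_B)`, sending `w'` to the velocity of `W + t w'`. -/
def verticalLift (ι : C^∞⟮𝓘(ℝ, F), B; 𝓘(ℝ, E), M⟯) (W : AmbientBundle ι) :
    TangentSpace 𝓘(ℝ, E) (ι W.proj) →ₗ[ℝ] AmbientTangent ι W :=
  (LinearMap.inr ℝ F E : E →ₗ[ℝ] F × E)

/-- Tangent vectors `τ ∂_r + ζ` of `ℝ × TM|_B` at points `(r, W)`. -/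
abbrev CollarTangent (ι : C^∞⟮𝓘(ℝ, F), B; 𝓘(ℝ, E), M⟯) (W : AmbientBundle ι) :=
  ℝ × AmbientTangent ι W

/-- The vectors tangent to `ℝ × N`, for a submanifold `N` of `TM|_B`. -/
def collarTangentVectors (ι : C^∞⟮𝓘(ℝ, F), B; 𝓘(ℝ, E), M⟯) (N : Set (AmbientBundle ι))
    (W : AmbientBundle ι) : Set (CollarTangent ι W) :=
  {X | X.2 ∈ tangentVectors ι N W}

/-- Fields of bilinear forms on `ℝ × TM|_B`. Only the values on vectors tangent to `ℝ × S(νB)`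
matter. -/
abbrev CollarForm (ι : C^∞⟮𝓘(ℝ, F), B; 𝓘(ℝ, E), M⟯) :=
  ∀ (_ : ℝ) (W : AmbientBundle ι), LinearMap.BilinForm ℝ (CollarTangent ι W)

/-- The endomorphism which multiplies the vertical component of a tangent vector of
`ℝ × S(νB)` by `s` and fixes its horizontal component and its `∂_r` component. For `s = r` this is
`φ` at `(r, W)`, and for `s = r⁻¹` it is `φ⁻¹` when `r ≠ 0`. -/
def scaleVertical (g : Metric E M) (ι : C^∞⟮𝓘(ℝ, F), B; 𝓘(ℝ, E), M⟯) (s : ℝ)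
    (W : AmbientBundle ι) : CollarTangent ι W →ₗ[ℝ] CollarTangent ι W :=
  LinearMap.id + (s - 1) • (LinearMap.inr ℝ ℝ (AmbientTangent ι W) ∘ₗ verticalLift ι W ∘ₗ
    normalCovDeriv g ι W ∘ₗ LinearMap.snd ℝ ℝ (AmbientTangent ι W))

/-- The pulled-back field `h^φ = h (φ⁻¹ ·, φ⁻¹ ·)`. -/
def twist (g : Metric E M) (ι : C^∞⟮𝓘(ℝ, F), B; 𝓘(ℝ, E), M⟯) (h : CollarForm ι) :
    CollarForm ι :=
  fun r W => (h r W).comp (scaleVertical g ι r⁻¹ W) (scaleVertical g ι r⁻¹ W)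

/-- Smoothness of a field of bilinear forms on the manifold with boundary `[0, ε) × N`, where `N`
is a submanifold of `TM|_B`: in every smooth parametrization `x ↦ P x` of pieces of `N` (no matter
whether `P` is a local diffeomorphism), the coefficients of the form with respect to `∂_r` and the
coordinate vectors `dP e` are smooth functions of `(r, x)`, up to the boundary `r = 0`. -/
def IsSmoothForm (ι : C^∞⟮𝓘(ℝ, F), B; 𝓘(ℝ, E), M⟯) (N : Set (AmbientBundle ι)) (ε : ℝ)
    (α : CollarForm ι) : Prop :=
  ∀ (k : ℕ) (O : Set (EuclideanSpace ℝ (Fin k))) (P : EuclideanSpace ℝ (Fin k) → AmbientBundle ι),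
    IsOpen O → ContMDiffOn 𝓘(ℝ, EuclideanSpace ℝ (Fin k)) (𝓘(ℝ, F).prod 𝓘(ℝ, E)) ∞ P O →
    (∀ x ∈ O, P x ∈ N) →
    ∀ (τ τ' : ℝ) (e e' : EuclideanSpace ℝ (Fin k)),
      ContDiffOn ℝ ∞ (fun q : ℝ × EuclideanSpace ℝ (Fin k) =>
        α q.1 (P q.2)
          (τ, mfderiv 𝓘(ℝ, EuclideanSpace ℝ (Fin k)) (𝓘(ℝ, F).prod 𝓘(ℝ, E)) P q.2 e)
          (τ', mfderiv 𝓘(ℝ, EuclideanSpace ℝ (Fin k)) (𝓘(ℝ, F).prod 𝓘(ℝ, E)) P q.2 e'))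
        (Ico 0 ε ×ˢ O)

/-- `h'` is a perturbation of order `p` of `h` on `[0, ε) × S(νB)`: for `r ≠ 0` it is symmetric and
positive definite, and `h'^φ = h^φ + r^p α` with a symmetric form `α` which is smooth down to
`r = 0`. -/
structure IsPerturbation (g : Metric E M) (ι : C^∞⟮𝓘(ℝ, F), B; 𝓘(ℝ, E), M⟯) (p : ℕ) (ε : ℝ)
    (h h' : CollarForm ι) : Prop where
  symm : ∀ r ∈ Ioo 0 ε, ∀ W ∈ unitNormalBundle g ι,
    ∀ X ∈ collarTangentVectors ι (unitNormalBundle g ι) W,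
    ∀ Y ∈ collarTangentVectors ι (unitNormalBundle g ι) W, h' r W X Y = h' r W Y X
  pos : ∀ r ∈ Ioo 0 ε, ∀ W ∈ unitNormalBundle g ι,
    ∀ X ∈ collarTangentVectors ι (unitNormalBundle g ι) W, X ≠ 0 → 0 < h' r W X X
  expansion : ∃ α : CollarForm ι, IsSmoothForm ι (unitNormalBundle g ι) ε α ∧
    (∀ r ∈ Ico 0 ε, ∀ W ∈ unitNormalBundle g ι,
      ∀ X ∈ collarTangentVectors ι (unitNormalBundle g ι) W,
      ∀ Y ∈ collarTangentVectors ι (unitNormalBundle g ι) W, α r W X Y = α r W Y X) ∧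
    ∀ r ∈ Ioo 0 ε, ∀ W ∈ unitNormalBundle g ι,
      ∀ X ∈ collarTangentVectors ι (unitNormalBundle g ι) W,
      ∀ Y ∈ collarTangentVectors ι (unitNormalBundle g ι) W,
        twist g ι h' r W X Y = twist g ι h r W X Y + r ^ p * α r W X Y

/-- The model edge metric `h₁ = dr² ⊕ r² g^V ⊕ π^* g^B`, the splitting of `T S(νB)` being the one
defined by the normal connection. -/
def modelMetric (g : Metric E M) (ι : C^∞⟮𝓘(ℝ, F), B; 𝓘(ℝ, E), M⟯) : CollarForm ι :=
  fun r W =>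
    (LinearMap.mul ℝ ℝ).compl₁₂ (LinearMap.fst ℝ ℝ (AmbientTangent ι W))
      (LinearMap.fst ℝ ℝ (AmbientTangent ι W)) +
    r ^ 2 • (metricForm g (ι W.proj)).compl₁₂
      (normalCovDeriv g ι W ∘ₗ LinearMap.snd ℝ ℝ (AmbientTangent ι W))
      (normalCovDeriv g ι W ∘ₗ LinearMap.snd ℝ ℝ (AmbientTangent ι W)) +
    (baseMetric g ι W.proj).compl₁₂
      ((dπ ι W).toLinearMap ∘ₗ LinearMap.snd ℝ ℝ (AmbientTangent ι W))
      ((dπ ι W).toLinearMap ∘ₗ LinearMap.snd ℝ ℝ (AmbientTangent ι W))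

/-- The reference metric `ĥ₁ = h₁ - 2 r II`. -/
def correctedModelMetric (g : Metric E M) (ι : C^∞⟮𝓘(ℝ, F), B; 𝓘(ℝ, E), M⟯) : CollarForm ι :=
  fun r W => modelMetric g ι r W - (2 * r) • (secondFundamentalForm g ι W).compl₁₂
    ((dπ ι W).toLinearMap ∘ₗ LinearMap.snd ℝ ℝ (AmbientTangent ι W))
    ((dπ ι W).toLinearMap ∘ₗ LinearMap.snd ℝ ℝ (AmbientTangent ι W))

/-- The normal exponential map `(r, W) ↦ exp (r W)`. -/
def blowDown (g : Metric E M) (ι : C^∞⟮𝓘(ℝ, F), B; 𝓘(ℝ, E), M⟯) (q : ℝ × AmbientBundle ι) : M :=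
  expMap g ⟨ι q.2.proj, q.1 • q.2.2⟩

/-- The differential of the normal exponential map at `(r, W)`. -/
def dBlowDown (g : Metric E M) (ι : C^∞⟮𝓘(ℝ, F), B; 𝓘(ℝ, E), M⟯) (r : ℝ) (W : AmbientBundle ι) :
    CollarTangent ι W →ₗ[ℝ] TangentSpace 𝓘(ℝ, E) (blowDown g ι (r, W)) :=
  (mfderiv (𝓘(ℝ, ℝ).prod (𝓘(ℝ, F).prod 𝓘(ℝ, E))) 𝓘(ℝ, E) (blowDown g ι) (r, W)).toLinearMap

/-- The degenerate metric `g₁`, the pull-back of `g` by the normal exponential map. -/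
def pullbackMetric (g : Metric E M) (ι : C^∞⟮𝓘(ℝ, F), B; 𝓘(ℝ, E), M⟯) : CollarForm ι :=
  fun r W => (metricForm g (blowDown g ι (r, W))).compl₁₂
    (dBlowDown g ι r W) (dBlowDown g ι r W)

/-- `ε` is an admissible width for the collar `[0, ε) × S(νB)`: the normal exponential map is
defined and smooth there, and it is an immersion for `r ≠ 0`. -/
structure IsCollarWidth (g : Metric E M) (ι : C^∞⟮𝓘(ℝ, F), B; 𝓘(ℝ, E), M⟯) (ε : ℝ) : Prop where
  pos : 0 < ε
  mem_expDomain : ∀ r ∈ Ico 0 ε, ∀ W ∈ unitNormalBundle g ι,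
    (⟨ι W.proj, r • W.2⟩ : TangentBundle 𝓘(ℝ, E) M) ∈ expDomain g
  smooth : ∀ r ∈ Ico 0 ε, ∀ W ∈ unitNormalBundle g ι,
    ContMDiffAt (𝓘(ℝ, ℝ).prod (𝓘(ℝ, F).prod 𝓘(ℝ, E))) 𝓘(ℝ, E) ∞ (blowDown g ι) (r, W)
  immersive : ∀ r ∈ Ioo 0 ε, ∀ W ∈ unitNormalBundle g ι,
    ∀ X ∈ collarTangentVectors ι (unitNormalBundle g ι) W, dBlowDown g ι r W X = 0 → X = 0

end Submanifold

end NormalBlowUp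

end

/-! Fix charts of B and M. Write a point of S(νB) as (y, w), let c be the local form of the
embedding, let (u, ω) be a tangent vector, and put b = c(y), v = Dc u. Split ∇_u W = ω + Γ(v, w)
into its normal part p and a part tangent to B. The differential of ℰ sends (τ, u, ω) to D Exp(b, r
w)(v, τ w + r ω). Since φ⁻¹ adds (r⁻¹ - 1) p to ω, the factor r absorbs the pole: dℰ ∘ φ⁻¹ becomes D
Exp(b, r w)(v, τ w + p + r m) with m = ω - p, which is smooth across r = 0
(`fderiv_localBlowDown_rescaled`).

So only the first two Taylor coefficients of g₁^φ in r matter. They follow from D Exp(b, 0)(a, a') =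
a + a' and from D² Exp(b, 0) being -Γ in the velocity variables. At r = 0 the vectors v, w, p are
mutually orthogonal and w is a unit vector, which gives h₁^φ. In the first derivative, metric
compatibility turns the derivative of the metric along w into Christoffel terms, which combine with
those of D² Exp; what remains is the pairing of m + Γ(v, w), the tangential part of ∇_u W, with v'.
Differentiating g(W, Y) = 0 along S(νB) identifies it with -II_W(u, u'), and the two symmetric
contributions give -2r II (`hasDerivAt_metric_expDifferential`, `innerAt_covDerivAt`). Hence g₁^φ -
ĥ₁^φ vanishes to second order at r = 0, and Hadamard's lemma makes its quotient by r² smooth up to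
the boundary (`IsSmoothFamily.exists_expansion`).

The map Exp comes from the flow of the geodesic spray S. Integral curves on [0, 1] solve α - ∫ S ∘ α
= const in a space of continuous maps, where superposition with a smooth map is smooth. At zero
velocity the linearization of S squares to zero, so the linearized equation has an explicit inverse
on the whole unit interval and the inverse function theorem yields the time-one flow
(`exists_flow`). Rescaling the time of geodesics gives the two derivatives of Exp
(`IsMetricOn.exists_exp`), and uniqueness of geodesics identifies Exp with `expMap`.

For the existence of a collar, compactness of S(νB) reduces everything to a neighbourhood of a point
(0, W₀). Immersivity follows from an operator which is injective at r = 0, hence nearby, and which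
controls dℰ for r ≠ 0 (`collarOperator`). Positivity of ĥ₁ holds because g^B - 2r II stays positive
definite for small r. The first-order expansion is exact: φ fixes horizontal vectors, so ĥ₁^φ - h₁^φ
= -2r II. -/

set_option linter.unusedSectionVars false

noncomputable section

namespace NormalBlowUp

/-! ## Superposition operators on spaces of continuous maps -/

section Superposition

universe u

variable {K : Type*} [TopologicalSpace K] [CompactSpace K]

open Classical in
/-- The superposition operator `α ↦ f ∘ α`, with the dummy value `0` where `f ∘ α` is not
continuous. -/
def superpose {E F : Type*} [NormedAddCommGroup E] [NormedAddCommGroup F] (f : E → F)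
    (α : C(K, E)) : C(K, F) :=
  if h : Continuous (f ∘ α) then ⟨f ∘ α, h⟩ else 0

theorem superpose_apply {E F : Type*} [NormedAddCommGroup E] [NormedAddCommGroup F] {f : E → F}
    {U : Set E} (hf : ContinuousOn f U) {α : C(K, E)} (hα : ∀ k, α k ∈ U) (k : K) :
    superpose f α k = f (α k) := by
  have h : Continuous (f ∘ α) := hf.comp_continuous α.continuous hα
  simp [superpose, h]

variable (K) in
/-- Pointwise application of a continuous family of continuous linear maps. -/
def pointwiseApply (E F : Type*) [NormedAddCommGroup E] [NormedSpace ℝ E]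
    [NormedAddCommGroup F] [NormedSpace ℝ F] :
    C(K, E →L[ℝ] F) →L[ℝ] C(K, E) →L[ℝ] C(K, F) :=
  LinearMap.mkContinuous₂
    (LinearMap.mk₂ ℝ (fun A η => (⟨fun k => A k (η k), by fun_prop⟩ : C(K, F)))
      (fun A A' η => by ext; simp) (fun r A η => by ext; simp)
      (fun A η η' => by ext; simp) (fun r A η => by ext; simp)) 1
    (fun A η => by
      rw [one_mul]
      refine (ContinuousMap.norm_le _ (by positivity)).2 fun k => ?_
      exact (A k).le_of_opNorm_le_of_le (A.norm_coe_le_norm k) (η.norm_coe_le_norm k))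

@[simp]
theorem pointwiseApply_apply (E F : Type*) [NormedAddCommGroup E] [NormedSpace ℝ E]
    [NormedAddCommGroup F] [NormedSpace ℝ F] (A : C(K, E →L[ℝ] F)) (η : C(K, E)) (k : K) :
    pointwiseApply K E F A η k = A k (η k) := rfl

theorem isOpen_setOf_forall_mem {E : Type*} [NormedAddCommGroup E] {U : Set E} (hU : IsOpen U) :
    IsOpen {α : C(K, E) | ∀ k, α k ∈ U} := by
  have := ContinuousMap.isOpen_setOfPred_mapsTo (X := K) (Y := E) isCompact_univ hU
  simpa [MapsTo] using this

theorem continuousOn_superpose {E F : Type*} [NormedAddCommGroup E] [NormedAddCommGroup F]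
    {f : E → F} {U : Set E} (hU : IsOpen U) (hf : ContinuousOn f U) :
    ContinuousOn (superpose f) {α : C(K, E) | ∀ k, α k ∈ U} := by
  intro α hα
  refine ContinuousAt.continuousWithinAt ?_
  rw [Metric.continuousAt_iff']
  intro ε hε
  -- Joint continuity in (v, k) and compactness of K give one neighbourhood of 0 valid for all k.
  -- The half of ε leaves room because the sup distance is only bounded by a non-strict inequality.
  have key : ∀ᶠ v in 𝓝 (0 : E), ∀ k ∈ (univ : Set K), dist (f (α k + v)) (f (α k)) < ε / 2 := by
    refine isCompact_univ.eventually_forall_of_forall_eventually fun k _ => ?_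
    have hk : ContinuousAt f (α k) := hf.continuousAt (hU.mem_nhds (hα k))
    have h1 : Filter.Tendsto (fun q : E × K => f (α q.2 + q.1)) (𝓝 (0, k)) (𝓝 (f (α k))) := by
      refine ContinuousAt.tendsto (f := f) hk |>.comp ?_
      have : Continuous fun q : E × K => α q.2 + q.1 := by fun_prop
      simpa using this.tendsto (0, k)
    have h2 : Filter.Tendsto (fun q : E × K => f (α q.2)) (𝓝 (0, k)) (𝓝 (f (α k))) := by
      refine ContinuousAt.tendsto (f := f) hk |>.comp ?_
      have : Continuous fun q : E × K => α q.2 := by fun_prop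
      simpa using this.tendsto (0, k)
    have h3 := (h1.dist h2)
    rw [dist_self] at h3
    exact h3.eventually_lt_const (by positivity)
  obtain ⟨δ, hδ, hδ'⟩ := Metric.eventually_nhds_iff_ball.1 key
  filter_upwards [(isOpen_setOf_forall_mem hU).mem_nhds hα, Metric.ball_mem_nhds α hδ] with β hβ hd
  refine lt_of_le_of_lt ((ContinuousMap.dist_le (C := ε / 2) (by positivity)).2 fun k => ?_)
    (half_lt_self hε)
  rw [superpose_apply hf hβ, superpose_apply hf hα]
  have := hδ' (β k - α k) (by
    rw [mem_ball_zero_iff, ← dist_eq_norm]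
    exact (ContinuousMap.dist_apply_le_dist k).trans_lt hd) k (mem_univ k)
  rw [add_sub_cancel] at this
  exact this.le

/-- A C¹ map is strictly differentiable, so the remainder at α k + v is controlled uniformly for
base points near a given one; compactness of K then makes the estimate uniform in k. -/
theorem hasFDerivAt_superpose {E F : Type*} [NormedAddCommGroup E] [NormedSpace ℝ E]
    [NormedAddCommGroup F] [NormedSpace ℝ F] {f : E → F} {U : Set E} (hU : IsOpen U)
    (hf : ContDiffOn ℝ 1 f U) {α : C(K, E)} (hα : ∀ k, α k ∈ U) :
    HasFDerivAt (superpose f) (pointwiseApply K E F (superpose (fderiv ℝ f) α)) α := by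
  have hf' : ContinuousOn (fderiv ℝ f) U := hf.continuousOn_fderiv_of_isOpen hU le_rfl
  rw [hasFDerivAt_iff_isLittleO_nhds_zero, Asymptotics.isLittleO_iff]
  intro ε hε
  have key : ∀ᶠ v in 𝓝 (0 : E), ∀ k ∈ (univ : Set K),
      ‖f (α k + v) - f (α k) - fderiv ℝ f (α k) v‖ ≤ ε * ‖v‖ := by
    refine isCompact_univ.eventually_forall_of_forall_eventually fun k _ => ?_
    have hk : HasStrictFDerivAt f (fderiv ℝ f (α k)) (α k) :=
      (hf.contDiffAt (hU.mem_nhds (hα k))).hasStrictFDerivAt one_ne_zero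
    have h1 : Filter.Tendsto (fun q : E × K => (α q.2 + q.1, α q.2)) (𝓝 (0, k))
        (𝓝 (α k, α k)) := by
      have : Continuous fun q : E × K => (α q.2 + q.1, α q.2) := by fun_prop
      simpa using this.tendsto (0, k)
    have h2 := h1.eventually (hk.isLittleO.def (half_pos hε))
    have h3 : Filter.Tendsto (fun q : E × K => dist (fderiv ℝ f (α q.2)) (fderiv ℝ f (α k)))
        (𝓝 (0, k)) (𝓝 0) := by
      rw [← tendsto_iff_dist_tendsto_zero]
      refine ContinuousAt.tendsto (f := fderiv ℝ f)
        (hf'.continuousAt (hU.mem_nhds (hα k))) |>.comp ?_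
      have : Continuous fun q : E × K => α q.2 := by fun_prop
      simpa using this.tendsto (0, k)
    filter_upwards [h2, h3.eventually_lt_const (half_pos hε)] with q hq hq'
    -- The base point moves with q. The derivative at the fixed point α k is compared with the
    -- moving one, each error taking half of ε.
    have e1 : f (α q.2 + q.1) - f (α q.2) - fderiv ℝ f (α q.2) q.1 =
        (f (α q.2 + q.1) - f (α q.2) - fderiv ℝ f (α k) (α q.2 + q.1 - α q.2)) -
          (fderiv ℝ f (α q.2) - fderiv ℝ f (α k)) q.1 := by
      simp
    rw [e1]
    refine (norm_sub_le _ _).trans ?_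
    have e2 := (fderiv ℝ f (α q.2) - fderiv ℝ f (α k)).le_of_opNorm_le
      ((dist_eq_norm _ _).symm.trans_le hq'.le) q.1
    simp only [add_sub_cancel_left] at hq ⊢
    linarith
  obtain ⟨δ, hδ, hδ'⟩ := Metric.eventually_nhds_iff_ball.1 key
  have hopen : ∀ᶠ η in 𝓝 (0 : C(K, E)), ∀ k, (α + η) k ∈ U := by
    have : Filter.Tendsto (fun η : C(K, E) => α + η) (𝓝 0) (𝓝 α) := by
      have h : Continuous fun η : C(K, E) => α + η := by fun_prop
      simpa using h.tendsto 0
    exact this.eventually ((isOpen_setOf_forall_mem hU).mem_nhds hα)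
  filter_upwards [hopen, Metric.ball_mem_nhds 0 hδ] with η hη hd
  refine (ContinuousMap.norm_le _ (by positivity)).2 fun k => ?_
  rw [ContinuousMap.sub_apply, ContinuousMap.sub_apply, superpose_apply hf.continuousOn hη,
    superpose_apply hf.continuousOn hα, pointwiseApply_apply, superpose_apply hf' hα]
  have hk : ‖η k‖ ≤ ‖η‖ := η.norm_coe_le_norm k
  refine (hδ' (η k) ?_ k (mem_univ k)).trans (by gcongr)
  rw [mem_ball_zero_iff] at hd ⊢
  exact hk.trans_lt hd

/-- The derivative of a superposition operator is the superposition with `fderiv ℝ f` followed by a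
fixed continuous linear map, so induction applies. The common universe of E and F keeps the new
target `E →L[ℝ] F` within reach of the induction hypothesis. -/
theorem contDiffOn_superpose_nat {E : Type u} [NormedAddCommGroup E] [NormedSpace ℝ E]
    {U : Set E} (hU : IsOpen U) (n : ℕ) :
    ∀ {F : Type u} [NormedAddCommGroup F] [NormedSpace ℝ F] {f : E → F}, ContDiffOn ℝ n f U →
      ContDiffOn ℝ n (superpose f) {α : C(K, E) | ∀ k, α k ∈ U} := by
  induction n with
  | zero =>
    intro F _ _ f hf
    simp only [Nat.cast_zero, contDiffOn_zero] at hf ⊢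
    exact continuousOn_superpose hU hf
  | succ n ih =>
    intro F _ _ f hf
    have h1 : ContDiffOn ℝ 1 f U := hf.of_le (by simp)
    rw [Nat.cast_succ, contDiffOn_succ_iff_fderiv_of_isOpen (isOpen_setOf_forall_mem hU)]
    refine ⟨fun α hα => (hasFDerivAt_superpose hU h1 hα).differentiableAt.differentiableWithinAt,
      by simp, ?_⟩
    rw [Nat.cast_succ, contDiffOn_succ_iff_fderiv_of_isOpen hU] at hf
    refine ContDiffOn.congr (f := fun α => pointwiseApply K E F (superpose (fderiv ℝ f) α)) ?_
      fun α hα => (hasFDerivAt_superpose hU h1 hα).fderiv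
    exact (pointwiseApply K E F).contDiff.comp_contDiffOn (ih hf.2.2)

theorem contDiffOn_superpose {E F : Type u} [NormedAddCommGroup E] [NormedSpace ℝ E]
    [NormedAddCommGroup F] [NormedSpace ℝ F] {U : Set E} (hU : IsOpen U) {n : ℕ∞} {f : E → F}
    (hf : ContDiffOn ℝ n f U) :
    ContDiffOn ℝ n (superpose f) {α : C(K, E) | ∀ k, α k ∈ U} := by
  rw [contDiffOn_iff_forall_nat_le] at hf ⊢
  exact fun m hm => contDiffOn_superpose_nat hU m (hf m hm)

end Superposition

/-! ## Integration and the Hadamard lemma -/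

section Integration

variable {V : Type*} [NormedAddCommGroup V] [NormedSpace ℝ V]

/-- The operator `η ↦ (t ↦ ∫₀ᵗ η)` on continuous maps on `[0, 1]`. -/
def primitiveCLM (V : Type*) [NormedAddCommGroup V] [NormedSpace ℝ V] :
    C(Icc (0 : ℝ) 1, V) →L[ℝ] C(Icc (0 : ℝ) 1, V) :=
  LinearMap.mkContinuous
    { toFun := fun η =>
        ⟨fun t => ∫ s in (0 : ℝ)..t, IccExtend zero_le_one η s, by
          have h : Continuous (IccExtend zero_le_one η : ℝ → V) := η.continuous.Icc_extend'
          exact (intervalIntegral.continuous_primitive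
            (fun a b => h.intervalIntegrable a b) 0).comp continuous_subtype_val⟩
      map_add' := fun η η' => by
        ext t
        have h : Continuous (IccExtend zero_le_one η : ℝ → V) := η.continuous.Icc_extend'
        have h' : Continuous (IccExtend zero_le_one η' : ℝ → V) := η'.continuous.Icc_extend'
        exact intervalIntegral.integral_add (h.intervalIntegrable _ _) (h'.intervalIntegrable _ _)
      map_smul' := fun c η => by
        ext t
        exact intervalIntegral.integral_smul c _ }
    1 (fun η => by
      rw [one_mul]
      refine (ContinuousMap.norm_le _ (norm_nonneg _)).2 fun t => ?_
      refine (intervalIntegral.norm_integral_le_of_norm_le_const (C := ‖η‖)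
        fun s _ => η.norm_coe_le_norm _).trans ?_
      have h1 := t.2.1
      have h2 := t.2.2
      rw [sub_zero, abs_of_nonneg h1]
      exact mul_le_of_le_one_right (norm_nonneg _) h2)

theorem primitiveCLM_apply (η : C(Icc (0 : ℝ) 1, V)) (t : Icc (0 : ℝ) 1) :
    primitiveCLM V η t = ∫ s in (0 : ℝ)..t, IccExtend zero_le_one η s := rfl

theorem hasDerivWithinAt_primitiveCLM [CompleteSpace V] (η : C(Icc (0 : ℝ) 1, V)) {t : ℝ}
    (ht : t ∈ Icc (0 : ℝ) 1) :
    HasDerivWithinAt (IccExtend zero_le_one (primitiveCLM V η)) (η ⟨t, ht⟩) (Icc 0 1) t := by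
  have h : Continuous (IccExtend zero_le_one η : ℝ → V) := η.continuous.Icc_extend'
  have h1 := (intervalIntegral.integral_hasDerivAt_right (h.intervalIntegrable 0 t)
    (h.stronglyMeasurableAtFilter _ _) h.continuousAt).hasDerivWithinAt (s := Icc 0 1)
  rw [IccExtend_of_mem _ _ ht] at h1
  refine h1.congr (fun s hs => ?_) ?_
  · rw [IccExtend_of_mem _ _ hs]; rfl
  · rw [IccExtend_of_mem _ _ ht]; rfl

end Integration

section Hadamard

/-- The constant maps, as a continuous linear map. -/
def constCLM (V : Type*) [NormedAddCommGroup V] [NormedSpace ℝ V] : V →L[ℝ] C(Icc (0 : ℝ) 1, V) :=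
  LinearMap.mkContinuous
    { toFun := fun v => ContinuousMap.const _ v
      map_add' := fun v w => by ext; simp
      map_smul' := fun c v => by ext; simp } 1 fun v => by
    rw [one_mul]
    exact (ContinuousMap.norm_le _ (norm_nonneg _)).2 fun t => le_rfl

@[simp]
theorem constCLM_apply {V : Type*} [NormedAddCommGroup V] [NormedSpace ℝ V] (v : V)
    (t : Icc (0 : ℝ) 1) : constCLM V v t = v := rfl

/-- The map sending `(r, x)` to the segment `s ↦ (s r, x)`. -/
def segmentCLM (X : Type*) [NormedAddCommGroup X] [NormedSpace ℝ X] :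
    ℝ × X →L[ℝ] C(Icc (0 : ℝ) 1, ℝ × X) :=
  LinearMap.mkContinuous
    { toFun := fun q => ⟨fun s => ((s : ℝ) * q.1, q.2), by fun_prop⟩
      map_add' := fun v w => by ext <;> simp [mul_add]
      map_smul' := fun c v => by ext <;> simp; ring } 1 fun q => by
    rw [one_mul]
    refine (ContinuousMap.norm_le _ (norm_nonneg _)).2 fun s => ?_
    refine max_le_max ?_ le_rfl
    change ‖(s : ℝ) * q.1‖ ≤ ‖q.1‖
    rw [norm_mul]
    refine mul_le_of_le_one_left (norm_nonneg _) ?_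
    rw [Real.norm_of_nonneg s.2.1]
    exact s.2.2

theorem segmentCLM_apply {X : Type*} [NormedAddCommGroup X] [NormedSpace ℝ X] (q : ℝ × X)
    (s : Icc (0 : ℝ) 1) : segmentCLM X q s = ((s : ℝ) * q.1, q.2) := rfl

/-- **Hadamard's lemma**: a smooth function which vanishes for `r = 0` is divisible by `r`. -/
theorem exists_eq_mul_of_contDiffAt {X : Type} [NormedAddCommGroup X] [NormedSpace ℝ X]
    {f : ℝ × X → ℝ} {x₀ : X} (hf : ContDiffAt ℝ ∞ f (0, x₀)) (h0 : ∀ᶠ x in 𝓝 x₀, f (0, x) = 0) :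
    ∃ k : ℝ × X → ℝ, ContDiffAt ℝ ∞ k (0, x₀) ∧ (∀ᶠ q in 𝓝 ((0 : ℝ), x₀), f q = q.1 * k q) ∧
      ∀ᶠ x in 𝓝 x₀, k (0, x) = fderiv ℝ f (0, x) (1, 0) := by
  set h : ℝ × X → ℝ := fun p => fderiv ℝ f p (1, 0) with h_def
  -- This is k(r, x) = ∫₀¹ ∂_r f(s r, x) ds, factored as a linear map, a superposition operator and
  -- an integration, so no differentiation under the integral sign is needed. Superposition wants ℝ
  -- × X and ℝ in one universe, hence X : Type.
  set k : ℝ × X → ℝ := fun q => primitiveCLM ℝ (superpose h (segmentCLM X q)) ⟨1, by simp⟩ with k_def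
  have hseg : ∀ q : ℝ × X, ∀ δ > 0, q ∈ Metric.ball ((0 : ℝ), x₀) δ → ∀ s : Icc (0 : ℝ) 1,
      segmentCLM X q s ∈ Metric.ball ((0 : ℝ), x₀) δ := by
    intro q δ hδ hq s
    rw [mem_ball_iff_norm, Prod.norm_def, max_lt_iff] at hq ⊢
    refine ⟨lt_of_le_of_lt ?_ hq.1, hq.2⟩
    change ‖(s : ℝ) * q.1 - 0‖ ≤ ‖q.1 - 0‖
    rw [sub_zero, sub_zero, norm_mul]
    refine mul_le_of_le_one_left (norm_nonneg _) ?_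
    rw [Real.norm_of_nonneg s.2.1]
    exact s.2.2
  -- Smoothness at a point provides a neighbourhood for each finite order only, so the ball depends
  -- on n. Balls in the sup norm contain the segments from (0, x) to (r, x).
  have hball : ∀ n : ℕ, ∃ δ > 0, ContDiffOn ℝ (n + 1 : ℕ) f (Metric.ball ((0 : ℝ), x₀) δ) ∧
      ContDiffOn ℝ n h (Metric.ball ((0 : ℝ), x₀) δ) := by
    intro n
    obtain ⟨u, hu, hfu⟩ := (hf.of_le (m := (n + 1 : ℕ)) (by exact_mod_cast le_top)).contDiffOn
      (m := (n + 1 : ℕ)) le_rfl (by simp)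
    obtain ⟨δ, hδ, hδu⟩ := Metric.mem_nhds_iff.1 hu
    have h1 := hfu.mono hδu
    exact ⟨δ, hδ, h1, (h1.fderiv_of_isOpen Metric.isOpen_ball (by simp)).clm_apply contDiffOn_const⟩
  have heval : ContDiff ℝ ∞ fun η : C(Icc (0 : ℝ) 1, ℝ) =>
      primitiveCLM ℝ η ⟨1, by simp⟩ :=
    ((ContinuousMap.evalCLM ℝ (⟨1, by simp⟩ : Icc (0 : ℝ) 1)).comp (primitiveCLM ℝ)).contDiff
  refine ⟨k, ?_, ?_, ?_⟩
  · rw [contDiffAt_infty]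
    intro n
    obtain ⟨δ, hδ, -, h2⟩ := hball n
    have h3 := (contDiffOn_superpose (K := Icc (0 : ℝ) 1) Metric.isOpen_ball (n := n)
      (by exact_mod_cast h2)).contDiffAt (x := segmentCLM X (0, x₀))
      ((isOpen_setOf_forall_mem Metric.isOpen_ball).mem_nhds
        (hseg _ δ hδ (Metric.mem_ball_self hδ)))
    exact (heval.contDiffAt.of_le (by exact_mod_cast le_top)).comp _
      (ContDiffAt.comp (0, x₀) (by exact_mod_cast h3) (segmentCLM X).contDiff.contDiffAt)
  · obtain ⟨δ, hδ, h1, h2⟩ := hball 0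
    have h0' : ∀ᶠ q in 𝓝 ((0 : ℝ), x₀), f (0, q.2) = 0 :=
      (continuousAt_snd (p := ((0 : ℝ), x₀))).eventually h0
    filter_upwards [Metric.ball_mem_nhds _ hδ, h0'] with q hq hq0
    have hd : ∀ s ∈ uIcc (0 : ℝ) 1, HasDerivAt (fun s => f (s * q.1, q.2))
        (q.1 * h (s * q.1, q.2)) s := by
      intro s hs
      rw [uIcc_of_le zero_le_one] at hs
      have hm := hseg q δ hδ hq ⟨s, hs⟩
      have hf1 : HasFDerivAt f (fderiv ℝ f (s * q.1, q.2)) (s * q.1, q.2) :=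
        ((h1.contDiffAt (Metric.isOpen_ball.mem_nhds hm)).differentiableAt (by simp)).hasFDerivAt
      have hs' : HasDerivAt (fun s : ℝ => (s * q.1, q.2)) (q.1, (0 : X)) s :=
        (by simpa using (hasDerivAt_id s).mul_const q.1 : HasDerivAt (fun s => s * q.1) q.1 s).prodMk
          (hasDerivAt_const s q.2)
      have := hf1.comp_hasDerivAt s hs'
      have e : ((q.1, 0) : ℝ × X) = q.1 • (1, 0) := by simp
      rw [e, map_smul, smul_eq_mul] at this
      exact this
    have hcont : ContinuousOn (fun s : ℝ => q.1 * h (s * q.1, q.2)) (uIcc 0 1) := by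
      refine continuousOn_const.mul (h2.continuousOn.comp (by fun_prop) fun s hs => ?_)
      rw [uIcc_of_le zero_le_one] at hs
      exact hseg q δ hδ hq ⟨s, hs⟩
    have key := intervalIntegral.integral_eq_sub_of_hasDerivAt hd hcont.intervalIntegrable
    rw [one_mul, zero_mul, hq0, sub_zero, intervalIntegral.integral_const_mul] at key
    rw [← key]
    congr 1
    change _ = primitiveCLM ℝ (superpose h (segmentCLM X q)) ⟨1, _⟩
    rw [primitiveCLM_apply]
    refine intervalIntegral.integral_congr fun s hs => ?_
    rw [uIcc_of_le zero_le_one] at hs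
    rw [IccExtend_of_mem _ _ hs, superpose_apply h2.continuousOn (hseg q δ hδ hq)]
    rfl
  · obtain ⟨δ, hδ, -, h2⟩ := hball 0
    have hc : ContinuousAt (fun x : X => ((0 : ℝ), x)) x₀ := by fun_prop
    filter_upwards [hc.eventually (Metric.ball_mem_nhds _ hδ)] with x hx
    rw [k_def]
    simp only
    rw [primitiveCLM_apply]
    have : ∀ s ∈ uIcc (0 : ℝ) 1, IccExtend zero_le_one (superpose h (segmentCLM X (0, x))) s =
        h (0, x) := by
      intro s hs
      rw [uIcc_of_le zero_le_one] at hs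
      rw [IccExtend_of_mem _ _ hs, superpose_apply h2.continuousOn (hseg _ δ hδ hx),
        segmentCLM_apply]
      simp
    rw [intervalIntegral.integral_congr this]
    simp [h_def]

/-- A smooth function which vanishes to second order for `r = 0` is divisible by `r²`. -/
theorem exists_eq_sq_mul_of_contDiffAt {X : Type} [NormedAddCommGroup X] [NormedSpace ℝ X]
    {f : ℝ × X → ℝ} {x₀ : X} (hf : ContDiffAt ℝ ∞ f (0, x₀)) (h0 : ∀ᶠ x in 𝓝 x₀, f (0, x) = 0)
    (h1 : ∀ᶠ x in 𝓝 x₀, fderiv ℝ f (0, x) (1, 0) = 0) :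
    ∃ k : ℝ × X → ℝ, ContDiffAt ℝ ∞ k (0, x₀) ∧
      ∀ᶠ q in 𝓝 ((0 : ℝ), x₀), f q = q.1 ^ 2 * k q := by
  obtain ⟨k, hk, hfk, hk0⟩ := exists_eq_mul_of_contDiffAt hf h0
  obtain ⟨m, hm, hkm, -⟩ := exists_eq_mul_of_contDiffAt hk
    (by filter_upwards [hk0, h1] with x hx hx'; rw [hx, hx'])
  refine ⟨m, hm, ?_⟩
  filter_upwards [hfk, hkm] with q hq hq'
  rw [hq, hq']; ring

end Hadamard

/-! ### Smooth dependence of integral curves on the initial value. -/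

section Flow

universe u

variable {V : Type u} [NormedAddCommGroup V] [NormedSpace ℝ V]

/-- `α` is an integral curve of the vector field `S` on `[0, 1]` with initial value `p`. -/
def IsSolution (S : V → V) (p : V) (α : C(Icc (0 : ℝ) 1, V)) : Prop :=
  α ⟨0, by simp⟩ = p ∧ ∀ t (ht : t ∈ Icc (0 : ℝ) 1),
    HasDerivWithinAt (IccExtend zero_le_one α) (S (α ⟨t, ht⟩)) (Icc 0 1) t

/-- The difference of α and the primitive of S ∘ α has zero derivative, hence is constant;
conversely the fundamental theorem of calculus applies. The initial value problem becomes an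
equation between maps of Banach spaces. -/
theorem isSolution_iff [CompleteSpace V] {S : V → V} {U : Set V} (hS : ContinuousOn S U)
    {p : V} {α : C(Icc (0 : ℝ) 1, V)} (hα : ∀ t, α t ∈ U) :
    IsSolution S p α ↔ α - primitiveCLM V (superpose S α) = constCLM V p := by
  constructor
  · rintro ⟨h0, h⟩
    have key : ∀ t ∈ Icc (0 : ℝ) 1, IccExtend zero_le_one (α - primitiveCLM V (superpose S α)) t =
        IccExtend zero_le_one (α - primitiveCLM V (superpose S α)) 0 := by
      refine constant_of_has_deriv_right_zero (ContinuousMap.continuous _).Icc_extend'.continuousOn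
        fun t ht => ?_
      have ht' := Ico_subset_Icc_self ht
      have h1 := (h t ht').sub (hasDerivWithinAt_primitiveCLM (superpose S α) ht')
      rw [superpose_apply hS hα, sub_self] at h1
      exact (h1.mono_of_mem_nhdsWithin (Icc_mem_nhdsGE_of_mem ht)).congr_of_eventuallyEq
        (Filter.Eventually.of_forall fun s => rfl) rfl
    ext t
    have := key t t.2
    rw [IccExtend_of_mem _ _ t.2, IccExtend_of_mem _ _ (left_mem_Icc.2 zero_le_one)] at this
    refine this.trans ?_
    rw [ContinuousMap.sub_apply, h0, primitiveCLM_apply]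
    simp
  · intro h
    have h' : α = constCLM V p + primitiveCLM V (superpose S α) := by rw [← h]; abel
    constructor
    · rw [h', ContinuousMap.add_apply, primitiveCLM_apply]
      simp
    · intro t ht
      have h1 := (hasDerivWithinAt_primitiveCLM (superpose S α) ht).const_add p
      rw [superpose_apply hS hα] at h1
      refine h1.congr_of_eventuallyEq (Filter.Eventually.of_forall fun s => ?_) ?_ <;>
      · conv_lhs => rw [h']
        rfl

/-- Smooth dependence on the initial value, near an equilibrium `p₀` of the vector field `S` at
which the linearization squares to zero. -/
theorem exists_flow [CompleteSpace V] {U : Set V} (hU : IsOpen U) {S : V → V}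
    (hS : ContDiffOn ℝ ∞ S U) {p₀ : V} (hp₀ : p₀ ∈ U) (hS0 : S p₀ = 0)
    (hA : ∀ v, fderiv ℝ S p₀ (fderiv ℝ S p₀ v) = 0) :
    ∃ (Θ : V → C(Icc (0 : ℝ) 1, V)) (N : Set V) (δ : ℝ), IsOpen N ∧ p₀ ∈ N ∧ 0 < δ ∧
      Metric.ball p₀ δ ⊆ U ∧ (∀ p ∈ N, ContDiffAt ℝ ∞ Θ p) ∧
      (∀ p ∈ N, ∀ t, Θ p t ∈ Metric.ball p₀ δ) ∧ (∀ p ∈ N, IsSolution S p (Θ p)) ∧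
      ∀ p ∈ N, ∀ α : C(Icc (0 : ℝ) 1, V), (∀ t, α t ∈ Metric.ball p₀ δ) → IsSolution S p α →
        α = Θ p := by
  set Ψ : C(Icc (0 : ℝ) 1, V) → C(Icc (0 : ℝ) 1, V) :=
    fun α => α - primitiveCLM V (superpose S α) with Ψ_def
  set D : Set C(Icc (0 : ℝ) 1, V) := {α | ∀ t, α t ∈ U} with D_def
  have hD : IsOpen D := isOpen_setOf_forall_mem hU
  have hΨ : ContDiffOn ℝ ∞ Ψ D :=
    contDiffOn_id.sub ((primitiveCLM V).contDiff.comp_contDiffOn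
      (contDiffOn_superpose hU (n := ⊤) hS))
  set α₀ : C(Icc (0 : ℝ) 1, V) := constCLM V p₀ with α₀_def
  have hα₀ : α₀ ∈ D := fun t => hp₀
  have hS1 : ContDiffOn ℝ 1 S U := hS.of_le (by simp)
  have hS' : ContinuousOn (fderiv ℝ S) U := hS1.continuousOn_fderiv_of_isOpen hU le_rfl
  set A := fderiv ℝ S p₀ with A_def
  set Kop : C(Icc (0 : ℝ) 1, V) →L[ℝ] C(Icc (0 : ℝ) 1, V) :=
    (primitiveCLM V).comp (pointwiseApply _ V V (superpose (fderiv ℝ S) α₀)) with Kop_def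
  have hKop : ∀ η t, Kop η t = ∫ s in (0 : ℝ)..t, A (IccExtend zero_le_one η s) := by
    intro η t
    rw [Kop_def, ContinuousLinearMap.comp_apply, primitiveCLM_apply]
    refine intervalIntegral.integral_congr fun s hs => ?_
    simp only [IccExtend, Function.comp]
    rw [pointwiseApply_apply, superpose_apply hS' hα₀]
    rfl
  have hKK : ∀ η, Kop (Kop η) = 0 := by
    intro η
    ext t
    rw [hKop]
    have : ∀ s : ℝ, A (IccExtend zero_le_one (Kop η) s) = 0 := by
      intro s
      rw [IccExtend, Function.comp, hKop]
      have hc : Continuous (fun s => A (IccExtend zero_le_one η s)) :=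
        A.continuous.comp η.continuous.Icc_extend'
      rw [← A.intervalIntegral_comp_comm (hc.intervalIntegrable _ _)]
      simp [hA]
    simp [this]
  -- Since A² = 0 and A commutes with integration, Kop² = 0 and the Neumann series of (id - Kop)⁻¹
  -- stops after two terms. No shortening of the time interval is required.
  let L : C(Icc (0 : ℝ) 1, V) ≃L[ℝ] C(Icc (0 : ℝ) 1, V) :=
    ContinuousLinearEquiv.equivOfInverse (ContinuousLinearMap.id ℝ _ - Kop)
      (ContinuousLinearMap.id ℝ _ + Kop) (fun η => by simp [hKK]) (fun η => by simp [hKK])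
  have hL : HasFDerivAt Ψ (L : C(Icc (0 : ℝ) 1, V) →L[ℝ] C(Icc (0 : ℝ) 1, V)) α₀ :=
    (hasFDerivAt_id α₀).sub
      ((primitiveCLM V).hasFDerivAt.comp α₀ (hasFDerivAt_superpose hU hS1 hα₀))
  have hΨ0 : ContDiffAt ℝ ∞ Ψ α₀ := hΨ.contDiffAt (hD.mem_nhds hα₀)
  set e := hΨ0.toOpenPartialHomeomorph Ψ hL (by simp) with e_def
  have he : ∀ α, e α = Ψ α := fun α => rfl
  have hsrc : α₀ ∈ e.source := hΨ0.mem_toOpenPartialHomeomorph_source hL (by simp)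
  -- Smoothness of the local inverse is wanted at every nearby point, not only at the image of α₀,
  -- so the derivative has to remain invertible around α₀.
  have hinv : ∀ᶠ α in 𝓝 α₀, fderiv ℝ Ψ α ∈ range ((↑) : (C(Icc (0 : ℝ) 1, V) ≃L[ℝ]
      C(Icc (0 : ℝ) 1, V)) → C(Icc (0 : ℝ) 1, V) →L[ℝ] C(Icc (0 : ℝ) 1, V)) := by
    have h1 : ContinuousAt (fderiv ℝ Ψ) α₀ :=
      (hΨ.continuousOn_fderiv_of_isOpen hD (by simp)).continuousAt (hD.mem_nhds hα₀)
    refine h1.eventually ?_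
    rw [hL.fderiv]
    exact ContinuousLinearEquiv.nhds L
  obtain ⟨δ₁, hδ₁, hball⟩ := Metric.mem_nhds_iff.1
    (Filter.inter_mem (Filter.inter_mem (e.open_source.mem_nhds hsrc) (hD.mem_nhds hα₀)) hinv)
  obtain ⟨δ₂, hδ₂, hball₂⟩ := Metric.mem_nhds_iff.1 (hU.mem_nhds hp₀)
  -- Curves with values in the δ-ball lie at sup distance at most δ₁ / 2 < δ₁ from α₀. Uniqueness
  -- can therefore be stated by a pointwise condition on the curve.
  set δ := min (δ₁ / 2) δ₂ with δ_def
  have hδ : 0 < δ := lt_min (half_pos hδ₁) hδ₂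
  set W : Set C(Icc (0 : ℝ) 1, V) := {α | ∀ t, α t ∈ Metric.ball p₀ δ} with W_def
  have hW : IsOpen W := isOpen_setOf_forall_mem Metric.isOpen_ball
  have hWball : W ⊆ Metric.ball α₀ δ₁ := by
    intro α hα
    rw [Metric.mem_ball]
    refine lt_of_le_of_lt ((ContinuousMap.dist_le (C := δ₁ / 2) (by positivity)).2 fun t => ?_)
      (half_lt_self hδ₁)
    exact (Metric.mem_ball.1 (hα t)).le.trans (min_le_left _ _)
  have hWs : W ⊆ e.source := fun α hα => (hball (hWball hα)).1.1
  have hΨα₀ : Ψ α₀ = α₀ := by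
    rw [Ψ_def, sub_eq_self]
    have : superpose S α₀ = 0 := by
      ext t
      rw [superpose_apply hS.continuousOn hα₀]
      exact hS0
    simp [this]
  have hmem : ∀ p, constCLM V p ∈ e '' W → e.symm (constCLM V p) ∈ W := by
    rintro p ⟨α, hα, hp⟩
    rwa [← hp, e.left_inv (hWs hα)]
  have htar : ∀ p, constCLM V p ∈ e '' W → constCLM V p ∈ e.target := by
    rintro p ⟨α, hα, hp⟩
    rw [← hp]
    exact e.map_source (hWs hα)
  have hWU : ∀ α ∈ W, ∀ t, α t ∈ U := fun α hα t =>
    hball₂ (Metric.ball_subset_ball (min_le_right _ _) (hα t))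
  refine ⟨fun p => e.symm (constCLM V p), constCLM V ⁻¹' (e '' W), δ,
    (e.isOpen_image_of_subset_source hW hWs).preimage (constCLM V).continuous,
    ⟨α₀, fun t => Metric.mem_ball_self hδ, hΨα₀⟩, hδ,
    (Metric.ball_subset_ball (min_le_right _ _)).trans hball₂, fun p hp => ?_, hmem,
    fun p hp => ?_, fun p hp α hα hsol => ?_⟩
  · have h1 := hball (hWball (hmem p hp))
    obtain ⟨L', hL'⟩ := h1.2
    have h2 : ContDiffAt ℝ ∞ Ψ (e.symm (constCLM V p)) := hΨ.contDiffAt (hD.mem_nhds h1.1.2)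
    have h3 : HasFDerivAt e (L' : C(Icc (0 : ℝ) 1, V) →L[ℝ] C(Icc (0 : ℝ) 1, V))
        (e.symm (constCLM V p)) := by
      rw [hL']
      exact (h2.differentiableAt (by simp)).hasFDerivAt
    exact (e.contDiffAt_symm (htar p hp) h3 h2).comp p (constCLM V).contDiff.contDiffAt
  · rw [isSolution_iff hS.continuousOn (hWU _ (hmem p hp))]
    exact e.right_inv (htar p hp)
  · rw [isSolution_iff hS.continuousOn (hWU _ hα)] at hsol
    change α = e.symm (constCLM V p)
    rw [← hsol]
    exact (e.left_inv (hWs hα)).symm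

end Flow

/-! ## Riemannian metrics on open subsets of a vector space -/

section LocalMetric

universe u

variable {E : Type u} [NormedAddCommGroup E] [NormedSpace ℝ E]

theorem minSmoothness_two_le_infty : minSmoothness ℝ 2 ≤ ∞ := by
  rw [minSmoothness_of_isRCLikeNormedField]
  exact WithTop.coe_le_coe.2 le_top

theorem hasDerivWithinAt_fst {E F : Type*} [NormedAddCommGroup E] [NormedSpace ℝ E]
    [NormedAddCommGroup F] [NormedSpace ℝ F] {f : ℝ → E × F} {f' : E × F} {s : Set ℝ} {t : ℝ}
    (h : HasDerivWithinAt f f' s t) : HasDerivWithinAt (fun t => (f t).1) f'.1 s t :=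
  (ContinuousLinearMap.fst ℝ E F).hasFDerivAt.comp_hasDerivWithinAt t h

theorem hasDerivWithinAt_snd {E F : Type*} [NormedAddCommGroup E] [NormedSpace ℝ E]
    [NormedAddCommGroup F] [NormedSpace ℝ F] {f : ℝ → E × F} {f' : E × F} {s : Set ℝ} {t : ℝ}
    (h : HasDerivWithinAt f f' s t) : HasDerivWithinAt (fun t => (f t).2) f'.2 s t :=
  (ContinuousLinearMap.snd ℝ E F).hasFDerivAt.comp_hasDerivWithinAt t h

/-- The Christoffel symbols of a field `G` of bilinear forms on a vector space. -/
def christoffelSymbol (G : E → E →L[ℝ] E →L[ℝ] ℝ) (y : E) : E →L[ℝ] E →L[ℝ] E :=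
  (ContinuousLinearMap.compL ℝ E (E →L[ℝ] ℝ) E (G y).inverse).comp (koszul (fderiv ℝ G y))

/-- `G` is a smooth Riemannian metric on the open set `U`. -/
structure IsMetricOn (G : E → E →L[ℝ] E →L[ℝ] ℝ) (U : Set E) : Prop where
  isOpen : IsOpen U
  contDiffOn : ContDiffOn ℝ ∞ G U
  symm : ∀ y ∈ U, ∀ v w, G y v w = G y w v
  pos : ∀ y ∈ U, ∀ v, v ≠ 0 → 0 < G y v v

namespace IsMetricOn

variable {G : E → E →L[ℝ] E →L[ℝ] ℝ} {U : Set E}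

theorem contDiffAt (hG : IsMetricOn G U) {y : E} (hy : y ∈ U) : ContDiffAt ℝ ∞ G y :=
  hG.contDiffOn.contDiffAt (hG.isOpen.mem_nhds hy)

theorem hasFDerivAt (hG : IsMetricOn G U) {y : E} (hy : y ∈ U) :
    HasFDerivAt G (fderiv ℝ G y) y :=
  ((hG.contDiffAt hy).differentiableAt (by simp)).hasFDerivAt

theorem eq_zero_of_apply_self (hG : IsMetricOn G U) {y : E} (hy : y ∈ U) {v : E}
    (hv : G y v v = 0) : v = 0 := by
  by_contra h
  exact (hG.pos y hy v h).ne' hv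

theorem ext (hG : IsMetricOn G U) {y : E} (hy : y ∈ U) {v v' : E}
    (h : ∀ w, G y v w = G y v' w) : v = v' := by
  rw [← sub_eq_zero]
  have h' : G y (v - v') = 0 := by
    rw [map_sub, sub_eq_zero]
    exact ContinuousLinearMap.ext h
  exact hG.eq_zero_of_apply_self hy (by rw [h']; rfl)

theorem fderiv_symm (hG : IsMetricOn G U) {y : E} (hy : y ∈ U) (u v w : E) :
    fderiv ℝ G y u v w = fderiv ℝ G y u w v := by
  have h : ∀ v w, HasFDerivAt (fun y => G y v w)
      ((ContinuousLinearMap.apply ℝ ℝ w).comp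
        ((ContinuousLinearMap.apply ℝ (E →L[ℝ] ℝ) v).comp (fderiv ℝ G y))) y := fun v w =>
    (ContinuousLinearMap.apply ℝ ℝ w).hasFDerivAt.comp y
      ((ContinuousLinearMap.apply ℝ (E →L[ℝ] ℝ) v).hasFDerivAt.comp y (hG.hasFDerivAt hy))
  have h1 := (h w v).congr_of_eventuallyEq (f₁ := fun y => G y v w) (by
    filter_upwards [hG.isOpen.mem_nhds hy] with z hz
    exact hG.symm z hz v w)
  exact congrArg (fun L : E →L[ℝ] ℝ => L u) ((h v w).unique h1)

variable [FiniteDimensional ℝ E]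

/-- Positivity gives injectivity, and equality of dimensions does the rest.
`ContinuousLinearMap.inverse` has the value 0 at non-invertible maps, so this is what makes the
Christoffel symbols meaningful. -/
theorem exists_equiv (hG : IsMetricOn G U) {y : E} (hy : y ∈ U) :
    ∃ e : E ≃L[ℝ] (E →L[ℝ] ℝ), (e : E →L[ℝ] E →L[ℝ] ℝ) = G y := by
  have hinj : Function.Injective (G y).toLinearMap := by
    rw [← LinearMap.ker_eq_bot, LinearMap.ker_eq_bot']
    intro v hv
    refine hG.eq_zero_of_apply_self hy ?_
    exact congrArg (fun L : E →L[ℝ] ℝ => L v) hv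
  have hdim : Module.finrank ℝ E = Module.finrank ℝ (E →L[ℝ] ℝ) := by
    rw [← (LinearMap.toContinuousLinearMap (𝕜 := ℝ) (E := E) (F' := ℝ)).finrank_eq,
      Module.finrank_linearMap, Module.finrank_self, mul_one]
  refine ⟨(LinearEquiv.ofInjectiveOfFinrankEq _ hinj hdim).toContinuousLinearEquiv, ?_⟩
  ext v w
  rfl

theorem apply_inverse (hG : IsMetricOn G U) {y : E} (hy : y ∈ U) (l : E →L[ℝ] ℝ) :
    G y ((G y).inverse l) = l := by
  obtain ⟨e, he⟩ := hG.exists_equiv hy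
  rw [← he, ContinuousLinearMap.inverse_equiv]
  exact e.apply_symm_apply l

theorem apply_christoffelSymbol (hG : IsMetricOn G U) {y : E} (hy : y ∈ U) (u v w : E) :
    G y (christoffelSymbol G y u v) w =
      (1 / 2) * (fderiv ℝ G y u v w + fderiv ℝ G y v u w - fderiv ℝ G y w u v) := by
  rw [← koszul_apply]
  exact congrArg (fun L : E →L[ℝ] ℝ => L w) (hG.apply_inverse hy _)

theorem christoffelSymbol_symm (hG : IsMetricOn G U) {y : E} (hy : y ∈ U) (u v : E) :
    christoffelSymbol G y u v = christoffelSymbol G y v u := by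
  refine hG.ext hy fun w => ?_
  rw [hG.apply_christoffelSymbol hy, hG.apply_christoffelSymbol hy, hG.fderiv_symm hy w u v]
  ring

/-- The Levi-Civita connection is compatible with the metric. -/
theorem fderiv_apply (hG : IsMetricOn G U) {y : E} (hy : y ∈ U) (u v w : E) :
    fderiv ℝ G y u v w =
      G y (christoffelSymbol G y u v) w + G y v (christoffelSymbol G y u w) := by
  rw [hG.symm y hy v, hG.apply_christoffelSymbol hy, hG.apply_christoffelSymbol hy,
    hG.fderiv_symm hy u w v, hG.fderiv_symm hy w u v, hG.fderiv_symm hy v u w]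
  ring

theorem contDiffOn_inverse (hG : IsMetricOn G U) :
    ContDiffOn ℝ ∞ (fun y => (G y).inverse) U := by
  intro y hy
  obtain ⟨e, he⟩ := hG.exists_equiv hy
  have h : ContDiffAt ℝ ∞ ContinuousLinearMap.inverse (G y) := he ▸ contDiffAt_map_inverse e
  exact (h.comp y (hG.contDiffAt hy)).contDiffWithinAt

theorem contDiffOn_christoffelSymbol (hG : IsMetricOn G U) :
    ContDiffOn ℝ ∞ (christoffelSymbol G) U := by
  have h1 : ContDiffOn ℝ ∞ (fderiv ℝ G) U := hG.contDiffOn.fderiv_of_isOpen hG.isOpen (by simp)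
  have h2 : ContDiffOn ℝ ∞ (fun y => koszul (fderiv ℝ G y)) U := by
    have h3 : ∀ u v w, ContDiffOn ℝ ∞ (fun y => fderiv ℝ G y u v w) U := fun u v w =>
      ((h1.clm_apply contDiffOn_const).clm_apply contDiffOn_const).clm_apply contDiffOn_const
    refine contDiffOn_clm_apply.2 fun u => contDiffOn_clm_apply.2 fun v =>
      contDiffOn_clm_apply.2 fun w => ?_
    simp only [koszul_apply]
    exact contDiffOn_const.mul (((h3 u v w).add (h3 v u w)).sub (h3 w u v))
  exact ((ContinuousLinearMap.compL ℝ E (E →L[ℝ] ℝ) E).contDiff.comp_contDiffOn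
    hG.contDiffOn_inverse).clm_comp h2

/-- The transformation law of the Christoffel symbols. -/
theorem christoffelSymbol_transform {G₁ G₂ : E → E →L[ℝ] E →L[ℝ] ℝ} {U₁ U₂ : Set E}
    (hG₁ : IsMetricOn G₁ U₁) (hG₂ : IsMetricOn G₂ U₂) {τ : E → E} {y : E} (hy : y ∈ U₁)
    (hτy : τ y ∈ U₂) (hτ : ContDiffAt ℝ ∞ τ y)
    (hsurj : Function.Surjective (fderiv ℝ τ y))
    (h : ∀ᶠ z in 𝓝 y, ∀ v w, G₁ z v w = G₂ (τ z) (fderiv ℝ τ z v) (fderiv ℝ τ z w)) (u v : E) :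
    fderiv ℝ τ y (christoffelSymbol G₁ y u v) =
      christoffelSymbol G₂ (τ y) (fderiv ℝ τ y u) (fderiv ℝ τ y v) +
        fderiv ℝ (fderiv ℝ τ) y u v := by
  have hτ1 : HasFDerivAt τ (fderiv ℝ τ y) y := (hτ.differentiableAt (by simp)).hasFDerivAt
  have hτ2 : HasFDerivAt (fderiv ℝ τ) (fderiv ℝ (fderiv ℝ τ) y) y :=
    ((hτ.fderiv_right (m := ∞) (by simp)).differentiableAt (by simp)).hasFDerivAt
  have hsymm : ∀ u v, fderiv ℝ (fderiv ℝ τ) y u v = fderiv ℝ (fderiv ℝ τ) y v u := fun u v =>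
    (hτ.isSymmSndFDerivAt minSmoothness_two_le_infty).eq u v
  -- The isometry identity is differentiated. In the Koszul combination the symmetry of D²τ cancels
  -- all second-derivative terms except twice G₂(D²τ(u, v), Dτ w), the inhomogeneous term of the
  -- law.
  have hD : ∀ u v w, fderiv ℝ G₁ y u v w =
      fderiv ℝ G₂ (τ y) (fderiv ℝ τ y u) (fderiv ℝ τ y v) (fderiv ℝ τ y w) +
        (G₂ (τ y) (fderiv ℝ (fderiv ℝ τ) y u v) (fderiv ℝ τ y w) +
          G₂ (τ y) (fderiv ℝ τ y v) (fderiv ℝ (fderiv ℝ τ) y u w)) := by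
    intro u v w
    have h1 : HasFDerivAt (fun y => G₁ y v w) _ y :=
      (ContinuousLinearMap.apply ℝ ℝ w).hasFDerivAt.comp y
        ((ContinuousLinearMap.apply ℝ (E →L[ℝ] ℝ) v).hasFDerivAt.comp y (hG₁.hasFDerivAt hy))
    have h2 := ((hG₂.hasFDerivAt hτy).comp y hτ1).clm_apply
      ((ContinuousLinearMap.apply ℝ E v).hasFDerivAt.comp y hτ2) |>.clm_apply
      ((ContinuousLinearMap.apply ℝ E w).hasFDerivAt.comp y hτ2)
    have h3 := h1.unique (h2.congr_of_eventuallyEq (h.mono fun z hz => hz v w))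
    have h4 := congrArg (fun L : E →L[ℝ] ℝ => L u) h3
    simp at h4
    rw [h4]
    ring
  refine hG₂.ext hτy fun w' => ?_
  obtain ⟨w, rfl⟩ := hsurj w'
  rw [← h.self_of_nhds, hG₁.apply_christoffelSymbol hy, map_add, add_apply,
    hG₂.apply_christoffelSymbol hτy, hD, hD, hD, hsymm v u, hsymm w u, hsymm w v,
    hG₂.symm _ hτy (fderiv ℝ τ y v)]
  rw [hG₂.symm _ hτy (fderiv ℝ (fderiv ℝ τ) y u w)]
  ring

end IsMetricOn

/-- The geodesic spray of `G`. -/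
def localSpray (G : E → E →L[ℝ] E →L[ℝ] ℝ) (p : E × E) : E × E :=
  (p.2, -christoffelSymbol G p.1 p.2 p.2)

namespace IsMetricOn

variable {G : E → E →L[ℝ] E →L[ℝ] ℝ} {U : Set E} [FiniteDimensional ℝ E]

theorem contDiffOn_localSpray (hG : IsMetricOn G U) :
    ContDiffOn ℝ ∞ (localSpray G) (U ×ˢ univ) := by
  have h : ContDiffOn ℝ ∞ (fun p : E × E => christoffelSymbol G p.1) (U ×ˢ univ) :=
    hG.contDiffOn_christoffelSymbol.comp contDiffOn_fst fun p hp => hp.1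
  exact contDiffOn_snd.prodMk ((h.clm_apply contDiffOn_snd).clm_apply contDiffOn_snd).neg

/-- The Christoffel term is quadratic in the velocity and does not contribute at velocity zero. The
remaining map (a, c) ↦ (c, 0) squares to zero, as `exists_flow` requires. -/
theorem fderiv_localSpray_zero (hG : IsMetricOn G U) {y : E} (hy : y ∈ U) (v : E × E) :
    fderiv ℝ (localSpray G) (y, 0) v = (v.2, 0) := by
  have h : HasFDerivAt (fun p : E × E => christoffelSymbol G p.1)
      ((fderiv ℝ (christoffelSymbol G) y).comp (ContinuousLinearMap.fst ℝ E E)) (y, 0) :=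
    HasFDerivAt.comp (f := Prod.fst) (g := christoffelSymbol G) (y, (0 : E)) (((hG.contDiffOn_christoffelSymbol.contDiffAt
      (hG.isOpen.mem_nhds hy)).differentiableAt (by simp)).hasFDerivAt) hasFDerivAt_fst
  have h1 := (hasFDerivAt_snd (p := (y, (0 : E)))).prodMk
    (((h.clm_apply hasFDerivAt_snd).clm_apply hasFDerivAt_snd).neg)
  have h2 : fderiv ℝ (localSpray G) (y, 0) = _ := h1.fderiv
  rw [h2]
  ext <;> simp

set_option maxHeartbeats 1000000 in
/-- The exponential map in a chart, with its expansion to second order at zero vectors. -/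
theorem exists_exp (hG : IsMetricOn G U) {y₀ : E} (hy₀ : y₀ ∈ U) :
    ∃ (Θ : E × E → C(Icc (0 : ℝ) 1, E × E)) (Exp : E × E → E) (N : Set (E × E)),
      IsOpen N ∧ (y₀, 0) ∈ N ∧ (∀ p ∈ N, p.1 ∈ U) ∧ (∀ p ∈ N, ContDiffAt ℝ ∞ Exp p) ∧
      (∀ p ∈ N, ∀ t, (Θ p t).1 ∈ U) ∧ (∀ p ∈ N, IsSolution (localSpray G) p (Θ p)) ∧
      (∀ p, Exp p = (Θ p ⟨1, by simp⟩).1) ∧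
      (∀ y, (y, 0) ∈ N → Exp (y, 0) = y) ∧
      (∀ y, (y, 0) ∈ N → ∀ u v, fderiv ℝ Exp (y, 0) (u, v) = u + v) ∧
      (∀ y, (y, 0) ∈ N → ∀ u v u' v', fderiv ℝ (fderiv ℝ Exp) (y, 0) (u, v) (u', v') =
        -christoffelSymbol G y v v') := by
  obtain ⟨Θ, N₁, δ, hN₁, h0N₁, hδ, hδU, hΘ, hΘδ, hsol, huniq⟩ :=
    exists_flow (hG.isOpen.prod isOpen_univ) hG.contDiffOn_localSpray (p₀ := (y₀, 0))
      ⟨hy₀, mem_univ _⟩ (by simp [localSpray]) (fun v => by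
        rw [hG.fderiv_localSpray_zero hy₀, hG.fderiv_localSpray_zero hy₀]; rfl)
  obtain ⟨η, hη, hηN⟩ := Metric.isOpen_iff.1 hN₁ _ h0N₁
  -- A ball in the max norm is stable under (y, v) ↦ (y, t v) for 0 ≤ t ≤ 1; this is what the
  -- homogeneity argument needs.
  set N := Metric.ball (y₀, (0 : E)) (min η δ) with N_def
  have hNN₁ : N ⊆ N₁ := (Metric.ball_subset_ball (min_le_left _ _)).trans hηN
  have hNδ : N ⊆ Metric.ball (y₀, (0 : E)) δ := Metric.ball_subset_ball (min_le_right _ _)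
  obtain ⟨Exp, Exp_def⟩ : ∃ Exp : E × E → E, ∀ p, Exp p = (Θ p ⟨1, by simp⟩).1 := ⟨_, fun _ => rfl⟩
  have hExp : ∀ p ∈ N, ContDiffAt ℝ ∞ Exp p := fun p hp => by
    have h1 := ((ContinuousLinearMap.fst ℝ E E).comp (ContinuousMap.evalCLM ℝ
      (⟨1, by simp⟩ : Icc (0 : ℝ) 1))).contDiff.contDiffAt.comp p (hΘ p (hNN₁ hp))
    exact h1.congr_of_eventuallyEq (Filter.Eventually.of_forall Exp_def)
  have hNmul : ∀ y v, (y, v) ∈ N → ∀ t ∈ Icc (0 : ℝ) 1, (y, t • v) ∈ N := by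
    intro y v h t ht
    rw [N_def, mem_ball_iff_norm, Prod.norm_def, max_lt_iff] at h ⊢
    refine ⟨h.1, lt_of_le_of_lt ?_ h.2⟩
    change ‖t • v - 0‖ ≤ ‖v - 0‖
    rw [sub_zero, sub_zero, norm_smul, Real.norm_of_nonneg ht.1]
    exact mul_le_of_le_one_left (norm_nonneg _) ht.2
  have hNmem : ∀ y v, (y, v) ∈ N → (y, 0) ∈ N := fun y v h => by
    simpa using hNmul y v h 0 (by simp)
  have hΘd : ∀ p ∈ N, ∀ t ∈ Icc (0 : ℝ) 1, HasDerivWithinAt (IccExtend zero_le_one (Θ p))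
      (localSpray G (IccExtend zero_le_one (Θ p) t)) (Icc 0 1) t := by
    intro p hp t ht
    have := (hsol p (hNN₁ hp)).2 t ht
    rwa [← IccExtend_of_mem zero_le_one (Θ p) ht] at this
  -- The curve s ↦ (x(t s), t x'(t s)) is again an integral curve, with initial velocity t v. It
  -- stays in the δ-ball, so uniqueness identifies it with the constructed solution.
  have hscale : ∀ y v, (y, v) ∈ N → ∀ t ∈ Icc (0 : ℝ) 1,
      Exp (y, t • v) = (IccExtend zero_le_one (Θ (y, v)) t).1 := by
    intro y v h t ht
    have hmaps : MapsTo (fun s => t * s) (Icc (0 : ℝ) 1) (Icc 0 1) := fun s hs =>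
      ⟨mul_nonneg ht.1 hs.1, mul_le_one₀ ht.2 hs.1 hs.2⟩
    let β : ℝ → E × E := fun s => ((IccExtend zero_le_one (Θ (y, v)) (t * s)).1,
      t • (IccExtend zero_le_one (Θ (y, v)) (t * s)).2)
    have hβc : Continuous β := by
      have : Continuous (IccExtend zero_le_one (Θ (y, v)) : ℝ → E × E) :=
        (Θ (y, v)).continuous.Icc_extend'
      fun_prop
    let α : C(Icc (0 : ℝ) 1, E × E) := ⟨fun s => β s, by fun_prop⟩
    have hα : α = Θ (y, t • v) := by
      refine huniq _ (hNN₁ (hNmul y v h t ht)) α (fun s => ?_) ⟨?_, fun s hs => ?_⟩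
      · have := hΘδ _ (hNN₁ h) (projIcc 0 1 zero_le_one (t * s))
        rw [mem_ball_iff_norm, Prod.norm_def, max_lt_iff] at this ⊢
        refine ⟨this.1, lt_of_le_of_lt ?_ this.2⟩
        change ‖t • (Θ (y, v) (projIcc 0 1 zero_le_one (t * s))).2 - 0‖ ≤
          ‖(Θ (y, v) (projIcc 0 1 zero_le_one (t * s))).2 - 0‖
        rw [sub_zero, sub_zero, norm_smul, Real.norm_of_nonneg ht.1]
        exact mul_le_of_le_one_left (norm_nonneg _) ht.2
      · change β 0 = _
        have h0 := (hsol _ (hNN₁ h)).1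
        simp only [β, mul_zero]
        rw [IccExtend_of_mem _ _ (left_mem_Icc.2 zero_le_one), h0]
      · have h1 : HasDerivWithinAt (fun s : ℝ => t * s) t (Icc 0 1) s := by
          simpa using (hasDerivAt_id s).hasDerivWithinAt.const_mul t
        have h2 := (hΘd _ h _ (hmaps hs)).scomp s h1 hmaps
        have h3 : HasDerivWithinAt β (localSpray G (β s)) (Icc 0 1) s := by
          have h4 := (hasDerivWithinAt_fst h2).prodMk ((hasDerivWithinAt_snd h2).const_smul t)
          refine h4.congr_deriv ?_
          simp [localSpray, β, smul_smul]
        exact h3.congr (fun s' hs' => IccExtend_of_mem _ _ hs') (IccExtend_of_mem _ _ hs)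
    have h1 : α ⟨1, by simp⟩ = β 1 := rfl
    rw [Exp_def, ← hα, h1]
    simp [β]
  have hf1 : ∀ y v, (y, v) ∈ N → ∀ t ∈ Icc (0 : ℝ) 1,
      HasDerivAt (fun t : ℝ => Exp (y, t • v)) (fderiv ℝ Exp (y, t • v) (0, v)) t := by
    intro y v h t ht
    have h1 : HasDerivAt (fun t : ℝ => (y, t • v)) ((0 : E), v) t :=
      (hasDerivAt_const t y).prodMk (by simpa using (hasDerivAt_id t).smul_const v)
    exact ((hExp _ (hNmul y v h t ht)).differentiableAt (by simp)).hasFDerivAt.comp_hasDerivAt t h1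
  have hud : ∀ t ∈ Icc (0 : ℝ) 1, UniqueDiffWithinAt ℝ (Icc (0 : ℝ) 1) t := fun t ht =>
    uniqueDiffOn_Icc zero_lt_one t ht
  have hf1' : ∀ y v, (y, v) ∈ N → ∀ t ∈ Icc (0 : ℝ) 1,
      fderiv ℝ Exp (y, t • v) (0, v) = (IccExtend zero_le_one (Θ (y, v)) t).2 := by
    intro y v h t ht
    have h1 := hasDerivWithinAt_fst (hΘd _ h t ht)
    have h2 := (hf1 y v h t ht).hasDerivWithinAt (s := Icc (0 : ℝ) 1)
    exact (hud t ht).eq_deriv _ h2 (h1.congr (fun s hs => hscale y v h s hs) (hscale y v h t ht))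
  have hΘ0 : ∀ p ∈ N, IccExtend zero_le_one (Θ p) 0 = p := fun p hp => by
    rw [IccExtend_of_mem _ _ (left_mem_Icc.2 zero_le_one)]
    exact (hsol _ (hNN₁ hp)).1
  -- By homogeneity D Exp(y, t v)(0, v) is the velocity of the geodesic at time t; its derivative at
  -- t = 0 is given by the geodesic equation.
  have hf2 : ∀ y v, (y, v) ∈ N →
      fderiv ℝ (fderiv ℝ Exp) (y, 0) (0, v) (0, v) = -christoffelSymbol G y v v := by
    intro y v h
    have h0 := left_mem_Icc.2 (zero_le_one (α := ℝ))
    have h1 : HasDerivAt (fun t : ℝ => (y, t • v)) ((0 : E), v) 0 :=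
      (hasDerivAt_const 0 y).prodMk (by simpa using (hasDerivAt_id (0 : ℝ)).smul_const v)
    have h2 : HasFDerivAt (fderiv ℝ Exp) (fderiv ℝ (fderiv ℝ Exp) (y, (0 : ℝ) • v))
        (y, (0 : ℝ) • v) :=
      (((hExp _ (hNmul y v h 0 h0)).fderiv_right (m := ∞) (by simp)).differentiableAt
        (by simp)).hasFDerivAt
    have h3 := (h2.comp_hasDerivAt (0 : ℝ) h1).clm_apply (hasDerivAt_const (0 : ℝ) ((0 : E), v))
    have h4 := hasDerivWithinAt_snd (hΘd _ h 0 h0)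
    rw [hΘ0 _ h] at h4
    have h5 := (hud 0 h0).eq_deriv _ (h3.hasDerivWithinAt)
      (h4.congr (fun s hs => hf1' y v h s hs) (hf1' y v h 0 h0))
    simpa [localSpray] using h5
  have hE0 : ∀ y, (y, 0) ∈ N → Exp (y, 0) = y := by
    intro y h
    have := hscale y 0 h 0 (by simp)
    rwa [hΘ0 _ h, smul_zero] at this
  have hshrink : ∀ y, (y, 0) ∈ N → ∀ v : E, ∃ c : ℝ, c ≠ 0 ∧ (y, c • v) ∈ N := by
    intro y h v
    have hc : ContinuousAt (fun c : ℝ => (y, c • v)) 0 := by fun_prop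
    have h1 : ∀ᶠ c in 𝓝[≠] (0 : ℝ), (y, c • v) ∈ N :=
      (hc.eventually (Metric.isOpen_ball.mem_nhds (by
        change (y, (0 : ℝ) • v) ∈ N
        rwa [zero_smul]))).filter_mono
        nhdsWithin_le_nhds
    obtain ⟨c, hc, hc'⟩ := (h1.and self_mem_nhdsWithin).exists
    exact ⟨c, hc', hc⟩
  have hE1 : ∀ y, (y, 0) ∈ N → ∀ u v, fderiv ℝ Exp (y, 0) (u, v) = u + v := by
    intro y h u v
    have hu : fderiv ℝ Exp (y, 0) (u, 0) = u := by
      have h1 : HasFDerivAt (fun y : E => (y, (0 : E))) (ContinuousLinearMap.inl ℝ E E) y :=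
        (hasFDerivAt_id y).prodMk (hasFDerivAt_const _ _)
      have h2 := ((hExp _ h).differentiableAt (by simp)).hasFDerivAt.comp y h1
      have hc : ContinuousAt (fun y : E => (y, (0 : E))) y := by fun_prop
      have h3 : HasFDerivAt (Exp ∘ fun y : E => (y, (0 : E))) (ContinuousLinearMap.id ℝ E) y :=
        (hasFDerivAt_id y).congr_of_eventuallyEq
          ((hc.eventually (Metric.isOpen_ball.mem_nhds h)).mono fun z hz => hE0 z hz)
      exact congrArg (fun L : E →L[ℝ] E => L u) (h2.unique h3)
    have hv : fderiv ℝ Exp (y, 0) (0, v) = v := by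
      obtain ⟨c, hc, hcv⟩ := hshrink y h v
      have h1 := hf1' y (c • v) hcv 0 (by simp)
      rw [hΘ0 _ hcv, zero_smul] at h1
      have h2 : ((0 : E), c • v) = c • ((0 : E), v) := by simp
      rw [h2, map_smul] at h1
      exact smul_right_injective _ hc h1
    have h3 : (u, v) = (u, (0 : E)) + ((0 : E), v) := by simp
    rw [h3, map_add, hu, hv]
  refine ⟨Θ, Exp, N, Metric.isOpen_ball, Metric.mem_ball_self (lt_min hη hδ),
    fun p hp => (hδU (hNδ hp)).1, hExp,
    fun p hp t => (hδU (hΘδ p (hNN₁ hp) t)).1, fun p hp => hsol p (hNN₁ hp), Exp_def,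
    hE0, hE1, fun y h u v u' v' => ?_⟩
  have hD2 : HasFDerivAt (fderiv ℝ Exp) (fderiv ℝ (fderiv ℝ Exp) (y, 0)) (y, 0) :=
    (((hExp _ h).fderiv_right (m := ∞) (by simp)).differentiableAt (by simp)).hasFDerivAt
  have hsymm : ∀ p q, fderiv ℝ (fderiv ℝ Exp) (y, 0) p q = fderiv ℝ (fderiv ℝ Exp) (y, 0) q p :=
    fun p q => ((hExp _ h).isSymmSndFDerivAt minSmoothness_two_le_infty).eq p q
  -- Along the zero section D Exp is the constant map (u, v) ↦ u + v, so its derivative in base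
  -- directions vanishes. Only the velocity block remains; it is known on the diagonal and recovered
  -- by polarization.
  have hu : ∀ (u : E) (q : E × E), fderiv ℝ (fderiv ℝ Exp) (y, 0) (u, 0) q = 0 := by
    intro u q
    have h1 : HasFDerivAt (fun y : E => (y, (0 : E))) (ContinuousLinearMap.inl ℝ E E) y :=
      (hasFDerivAt_id y).prodMk (hasFDerivAt_const _ _)
    have h2 := hD2.comp y h1
    have hc : ContinuousAt (fun y : E => (y, (0 : E))) y := by fun_prop
    have h3 : HasFDerivAt (fderiv ℝ Exp ∘ fun y : E => (y, (0 : E)))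
      (0 : E →L[ℝ] E × E →L[ℝ] E) y := (hasFDerivAt_const (ContinuousLinearMap.fst ℝ E E +
      ContinuousLinearMap.snd ℝ E E) y).congr_of_eventuallyEq
      ((hc.eventually (Metric.isOpen_ball.mem_nhds h)).mono fun z hz => by
        ext v
        · simp [hE1 z hz]
        · simp [hE1 z hz])
    exact congrArg (fun L : E →L[ℝ] E × E →L[ℝ] E => L u q) (h2.unique h3)
  have hdiag : ∀ v, fderiv ℝ (fderiv ℝ Exp) (y, 0) (0, v) (0, v) = -christoffelSymbol G y v v := by
    intro v
    obtain ⟨c, hc, hcv⟩ := hshrink y h v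
    have h1 := hf2 y (c • v) hcv
    have h2 : ((0 : E), c • v) = c • ((0 : E), v) := by simp
    rw [h2] at h1
    simp only [map_smul, smul_apply, ← smul_neg] at h1
    exact smul_right_injective E hc (smul_right_injective E hc h1)
  have hpolar : fderiv ℝ (fderiv ℝ Exp) (y, 0) (0, v) (0, v') = -christoffelSymbol G y v v' := by
    have h1 := hdiag (v + v')
    have h2 : ((0 : E), v + v') = ((0 : E), v) + ((0 : E), v') := by simp
    have hy : y ∈ U := (hδU (hNδ h)).1
    rw [h2] at h1
    simp only [map_add, add_apply] at h1
    rw [hdiag, hdiag, hsymm (0, v') (0, v), hG.christoffelSymbol_symm hy v' v] at h1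
    have h3 : (2 : ℝ) • fderiv ℝ (fderiv ℝ Exp) (y, 0) (0, v) (0, v') =
        (2 : ℝ) • (-christoffelSymbol G y v v') := by
      rw [two_smul, two_smul]
      generalize fderiv ℝ (fderiv ℝ Exp) (y, 0) (0, v) (0, v') = a at h1 ⊢
      generalize christoffelSymbol G y v v' = b at h1 ⊢
      have h4 : a + a = (-christoffelSymbol G y v v + a + (a + -christoffelSymbol G y v' v')) +
          (christoffelSymbol G y v v + christoffelSymbol G y v' v') := by abel
      rw [h4, h1]
      abel
    exact smul_right_injective _ (two_ne_zero) h3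
  have e1 : (u, v) = (u, (0 : E)) + ((0 : E), v) := by simp
  have e2 : (u', v') = (u', (0 : E)) + ((0 : E), v') := by simp
  have hadd : ∀ (L : E × E →L[ℝ] E × E →L[ℝ] E) (p q r : E × E), L (p + q) r = L p r + L q r :=
    fun L p q r => by rw [map_add, add_apply]
  rw [e1, e2, hadd, hu, map_add, hpolar, hsymm, hu]
  simp

end IsMetricOn

end LocalMetric

/-! ## Differentials of charts -/

section ChartDifferential

variable {E : Type*} [NormedAddCommGroup E] [NormedSpace ℝ E] {H : Type*} [TopologicalSpace H]
  {I : ModelWithCorners ℝ E H} {M : Type*} [TopologicalSpace M] [ChartedSpace H M]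
  {E' : Type*} [NormedAddCommGroup E'] [NormedSpace ℝ E'] {H' : Type*} [TopologicalSpace H']
  {I' : ModelWithCorners ℝ E' H'} {M' : Type*} [TopologicalSpace M'] [ChartedSpace H' M']

variable (I) in
/-- The differential at `x` of the preferred chart at `x₀`. -/
def chartDifferential (x₀ x : M) : E →L[ℝ] E :=
  mfderiv I 𝓘(ℝ, E) (extChartAt I x₀) x

variable [IsManifold I 1 M] [IsManifold I' 1 M']

theorem hasMFDerivAt_chart {x₀ x : M} (hx : x ∈ (extChartAt I x₀).source) :
    HasMFDerivAt I 𝓘(ℝ, E) (extChartAt I x₀) x (mfderiv I 𝓘(ℝ, E) (extChartAt I x₀) x) :=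
  (mdifferentiableAt_extChartAt (by rwa [extChartAt_source] at hx)).hasMFDerivAt

theorem chartDifferential_self (x : M) (v : E) : chartDifferential I x x v = v := by
  have : chartDifferential I x x = ContinuousLinearMap.id ℝ E := mfderiv_extChartAt_self
  rw [this]; rfl

theorem chartDifferential_injective {x₀ x : M} (hx : x ∈ (extChartAt I x₀).source) :
    Function.Injective (chartDifferential I x₀ x) :=
  (isInvertible_mfderiv_extChartAt hx).injective

theorem chartDifferential_surjective {x₀ x : M} (hx : x ∈ (extChartAt I x₀).source) :
    Function.Surjective (chartDifferential I x₀ x) :=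
  (isInvertible_mfderiv_extChartAt hx).surjective

/-- The differential of a map in terms of a local expression of the map. -/
theorem chartDifferential_mfderiv {f : M → M'} {x₀ x : M} {x₀' : M'}
    (hx : x ∈ (extChartAt I x₀).source) (hx' : f x ∈ (extChartAt I' x₀').source)
    (hf : MDifferentiableAt I I' f x) {F : E → E'}
    (hF : DifferentiableAt ℝ F (extChartAt I x₀ x))
    (h : ∀ᶠ z in 𝓝 x, extChartAt I' x₀' (f z) = F (extChartAt I x₀ z)) (v : E) :
    chartDifferential I' x₀' (f x) (mfderiv I I' f x v) =
      fderiv ℝ F (extChartAt I x₀ x) (chartDifferential I x₀ x v) := by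
  have h1 := (hasMFDerivAt_chart hx').comp x hf.hasMFDerivAt
  have h2 := hF.hasFDerivAt.hasMFDerivAt.comp x (hasMFDerivAt_chart hx)
  have h3 := hasMFDerivAt_unique h1 (h2.congr_of_eventuallyEq h)
  exact congrArg (fun L : E →L[ℝ] E' => L v) h3

/-- Change of charts. -/
theorem chartDifferential_eq {x₀ x₁ x : M} (hx : x ∈ (extChartAt I x₀).source)
    (hx' : x ∈ (extChartAt I x₁).source) {F : E → E}
    (hF : DifferentiableAt ℝ F (extChartAt I x₁ x))
    (h : ∀ᶠ z in 𝓝 x, extChartAt I x₀ z = F (extChartAt I x₁ z)) (v : E) :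
    chartDifferential I x₀ x v =
      fderiv ℝ F (extChartAt I x₁ x) (chartDifferential I x₁ x v) := by
  have h1 := hasMFDerivAt_chart hx
  have h2 := hF.hasFDerivAt.hasMFDerivAt.comp x (hasMFDerivAt_chart hx')
  have h3 := hasMFDerivAt_unique h1 (h2.congr_of_eventuallyEq h)
  exact congrArg (fun L : E →L[ℝ] E => L v) h3

end ChartDifferential

/-! ### Coordinate changes and differentials of inverse charts. -/

section Transition

variable {E : Type*} [NormedAddCommGroup E] [NormedSpace ℝ E] {H : Type*} [TopologicalSpace H]
  {I : ModelWithCorners ℝ E H} [I.Boundaryless] {M : Type*} [TopologicalSpace M] [ChartedSpace H M]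
  [IsManifold I ∞ M]

variable (I) in
/-- The coordinate change from the chart at `x` to the chart at `x₀`. -/
def transition (x x₀ : M) : E → E := extChartAt I x₀ ∘ (extChartAt I x).symm

theorem transition_apply {x x₀ z : M} (hz : z ∈ (extChartAt I x).source) :
    transition I x x₀ (extChartAt I x z) = extChartAt I x₀ z := by
  rw [transition, Function.comp_apply, (extChartAt I x).left_inv hz]

theorem contDiffAt_transition {x x₀ z : M} (hz : z ∈ (extChartAt I x).source)
    (hz₀ : z ∈ (extChartAt I x₀).source) :
    ContDiffAt ℝ ∞ (transition I x x₀) (extChartAt I x z) := by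
  have h := contDiffWithinAt_ext_coord_change (I := I) (n := ∞) x₀ x
    (y := extChartAt I x z) (by
      rw [PartialEquiv.trans_source, PartialEquiv.symm_source]
      refine ⟨(extChartAt I x).map_source hz, ?_⟩
      rw [mem_preimage, (extChartAt I x).left_inv hz]
      exact hz₀)
  rw [I.range_eq_univ, contDiffWithinAt_univ] at h
  exact h

theorem chartDifferential_transition {x x₀ z : M} (hz : z ∈ (extChartAt I x).source)
    (hz₀ : z ∈ (extChartAt I x₀).source) (v : E) :
    chartDifferential I x₀ z v =
      fderiv ℝ (transition I x x₀) (extChartAt I x z) (chartDifferential I x z v) := by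
  refine chartDifferential_eq hz₀ hz ((contDiffAt_transition hz hz₀).differentiableAt (by simp)) ?_ v
  filter_upwards [(isOpen_extChartAt_source x).mem_nhds hz] with p hp
  rw [transition_apply hp]

variable (I) in
/-- The differential of the inverse of the preferred chart at `x₀`. -/
def symmDifferential (x₀ : M) (y : E) : E →L[ℝ] E :=
  mfderiv 𝓘(ℝ, E) I (extChartAt I x₀).symm y

theorem mfderiv_symm_chartDifferential {x₀ x : M} (hx : x ∈ (extChartAt I x₀).source)
    (v : E) :
    symmDifferential I x₀ (extChartAt I x₀ x) (chartDifferential I x₀ x v) = v := by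
  have h := mfderivWithin_extChartAt_symm_comp_mfderiv_extChartAt' (I := I) hx
  rw [I.range_eq_univ, mfderivWithin_univ] at h
  exact congrArg (fun L : E →L[ℝ] E => L v) h

theorem chartDifferential_mfderiv_symm {x₀ : M} {y : E} (hy : y ∈ (extChartAt I x₀).target)
    (v : E) :
    chartDifferential I x₀ ((extChartAt I x₀).symm y) (symmDifferential I x₀ y v) = v := by
  have h := mfderiv_extChartAt_comp_mfderivWithin_extChartAt_symm (I := I) hy
  rw [I.range_eq_univ, mfderivWithin_univ] at h
  exact congrArg (fun L : E →L[ℝ] E => L v) h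

theorem hasMFDerivAt_chart_symm {x₀ : M} {y : E} (hy : y ∈ (extChartAt I x₀).target) :
    HasMFDerivAt 𝓘(ℝ, E) I (extChartAt I x₀).symm y
      (mfderiv 𝓘(ℝ, E) I (extChartAt I x₀).symm y) := by
  have := mdifferentiableWithinAt_extChartAt_symm (I := I) (x := x₀) hy
  rw [ModelWithCorners.range_eq_univ, mdifferentiableWithinAt_univ] at this
  exact this.hasMFDerivAt

end Transition

/-! ## The metric in a fixed chart -/

section FixedChart

variable {E : Type*} [NormedAddCommGroup E] [NormedSpace ℝ E]
  {M : Type*} [TopologicalSpace M] [ChartedSpace E M] [IsManifold 𝓘(ℝ, E) ∞ M]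

/-- The scalar product on the tangent space at `x`, identified with the model space. -/
def innerAt (g : Metric E M) (x : M) : E →L[ℝ] E →L[ℝ] ℝ := g.inner x

theorem innerAt_symm (g : Metric E M) (x : M) (v w : E) : innerAt g x v w = innerAt g x w v :=
  g.symm x v w

theorem innerAt_self_pos (g : Metric E M) (x : M) {v : E} (hv : v ≠ 0) : 0 < innerAt g x v v :=
  g.pos x v hv

theorem christoffel_eq (g : Metric E M) (x : M) :
    christoffel g x = christoffelSymbol (chartMetric g x) (extChartAt 𝓘(ℝ, E) x x) := rfl

theorem inner_eq_chartMetric (g : Metric E M) {x₀ x : M}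
    (hx : x ∈ (extChartAt 𝓘(ℝ, E) x₀).source) (u v : E) :
    innerAt g x u v = chartMetric g x₀ (extChartAt 𝓘(ℝ, E) x₀ x)
      (chartDifferential 𝓘(ℝ, E) x₀ x u) (chartDifferential 𝓘(ℝ, E) x₀ x v) := by
  have h : ∀ p, p = x → innerAt g x u v =
      innerAt g p u v := by rintro p rfl; rfl
  rw [h _ ((extChartAt 𝓘(ℝ, E) x₀).left_inv hx)]
  change _ = innerAt g ((extChartAt 𝓘(ℝ, E) x₀).symm (extChartAt 𝓘(ℝ, E) x₀ x))
    (symmDifferential 𝓘(ℝ, E) x₀ (extChartAt 𝓘(ℝ, E) x₀ x) (chartDifferential 𝓘(ℝ, E) x₀ x u))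
    (symmDifferential 𝓘(ℝ, E) x₀ (extChartAt 𝓘(ℝ, E) x₀ x) (chartDifferential 𝓘(ℝ, E) x₀ x v))
  rw [mfderiv_symm_chartDifferential hx, mfderiv_symm_chartDifferential hx]

theorem chartMetric_apply (g : Metric E M) (x₀ : M) (y u v : E) :
    chartMetric g x₀ y u v = innerAt g ((extChartAt 𝓘(ℝ, E) x₀).symm y)
      (symmDifferential 𝓘(ℝ, E) x₀ y u)
      (symmDifferential 𝓘(ℝ, E) x₀ y v) := rfl

/-- The coordinate field with constant component v is the image of a constant section under the
inverse trivialization of the tangent bundle. Pairing g with such fields yields smooth coefficients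
in `isMetricOn_chartMetric`. -/
theorem contMDiffOn_symm_vector (x₀ : M) (v : E) :
    ContMDiffOn 𝓘(ℝ, E) 𝓘(ℝ, E).tangent ∞
      (fun y => (⟨(extChartAt 𝓘(ℝ, E) x₀).symm y,
        symmDifferential 𝓘(ℝ, E) x₀ y v⟩ :
        TangentBundle 𝓘(ℝ, E) M)) (extChartAt 𝓘(ℝ, E) x₀).target := by
  have h1 : ContMDiffOn (𝓘(ℝ, E).prod 𝓘(ℝ, E)) 𝓘(ℝ, E).tangent ∞
      (trivializationAt E (TangentSpace 𝓘(ℝ, E)) x₀).toOpenPartialHomeomorph.symm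
      (trivializationAt E (TangentSpace 𝓘(ℝ, E)) x₀).target :=
    Bundle.Trivialization.contMDiffOn_symm _
  have h2 : ContMDiffOn 𝓘(ℝ, E) (𝓘(ℝ, E).prod 𝓘(ℝ, E)) ∞
      (fun y => ((extChartAt 𝓘(ℝ, E) x₀).symm y, v)) (extChartAt 𝓘(ℝ, E) x₀).target :=
    (contMDiffOn_extChartAt_symm x₀).prodMk contMDiffOn_const
  have hs : ∀ y ∈ (extChartAt 𝓘(ℝ, E) x₀).target, (extChartAt 𝓘(ℝ, E) x₀).symm y ∈
      (chartAt E x₀).source := fun y hy => by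
    have := (extChartAt 𝓘(ℝ, E) x₀).map_target hy
    rwa [extChartAt_source] at this
  refine (h1.comp h2 fun y hy => ?_).congr fun y hy => ?_
  · rw [TangentBundle.trivializationAt_target]
    exact ⟨hs y hy, mem_univ _⟩
  · have h3 := TangentBundle.symmL_trivializationAt (I := 𝓘(ℝ, E)) (hs y hy)
    rw [𝓘(ℝ, E).range_eq_univ, mfderivWithin_univ, (extChartAt 𝓘(ℝ, E) x₀).right_inv hy] at h3
    have h4 := congrArg (fun L : E →L[ℝ] E => L v) h3
    have h5 := (trivializationAt E (TangentSpace 𝓘(ℝ, E)) x₀).mk_symm (hs y hy) v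
    rw [Function.comp_apply]
    refine Eq.trans ?_ h5
    congr 1
    exact h4.symm.trans (Bundle.Trivialization.symmL_apply _ (hs y hy) v)

/-- The bridge from the manifold to the theory of metrics on open subsets of a vector space. -/
theorem isMetricOn_chartMetric [FiniteDimensional ℝ E] (g : Metric E M) (x₀ : M) :
    IsMetricOn (chartMetric g x₀) (extChartAt 𝓘(ℝ, E) x₀).target where
  isOpen := isOpen_extChartAt_target x₀
  contDiffOn := by
    refine contDiffOn_clm_apply.2 fun u => contDiffOn_clm_apply.2 fun v => ?_
    rw [← contMDiffOn_iff_contDiffOn]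
    intro y hy
    have h1 := contMDiffOn_symm_vector x₀ u y hy
    have h2 := contMDiffOn_symm_vector x₀ v y hy
    have h3 := g.contMDiff.contMDiffAt.comp_contMDiffWithinAt y
      (contMDiffOn_extChartAt_symm x₀ y hy)
    have h4 := ContMDiffWithinAt.clm_bundle_apply₂ (E₃ := Bundle.Trivial M ℝ) (F₃ := ℝ) h3 h1 h2
    simp only [contMDiffWithinAt_totalSpace] at h4
    exact h4.2
  symm y hy v w := by
    rw [chartMetric_apply, chartMetric_apply]
    exact innerAt_symm g _ _ _
  pos y hy v hv := by
    rw [chartMetric_apply]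
    refine innerAt_self_pos g _ fun h0 => hv ?_
    rw [← chartDifferential_mfderiv_symm hy v, h0, map_zero]

/-- The transformation law of the Christoffel symbols of a Riemannian manifold. -/
theorem fderiv_transition_christoffel [FiniteDimensional ℝ E] (g : Metric E M) {x₀ x : M}
    (hx : x ∈ (extChartAt 𝓘(ℝ, E) x₀).source) (u v : E) :
    chartDifferential 𝓘(ℝ, E) x₀ x (christoffel g x u v) =
      christoffelSymbol (chartMetric g x₀) (extChartAt 𝓘(ℝ, E) x₀ x)
        (chartDifferential 𝓘(ℝ, E) x₀ x u) (chartDifferential 𝓘(ℝ, E) x₀ x v) +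
        fderiv ℝ (fderiv ℝ (transition 𝓘(ℝ, E) x x₀)) (extChartAt 𝓘(ℝ, E) x x) u v := by
  -- The chart preferred at x has identity differential at x, so u and v are their own components
  -- there, and the law compares that chart with the one at x₀.
  have hx' := mem_extChartAt_source (I := 𝓘(ℝ, E)) x
  have hcd : ∀ v, chartDifferential 𝓘(ℝ, E) x₀ x v =
      fderiv ℝ (transition 𝓘(ℝ, E) x x₀) (extChartAt 𝓘(ℝ, E) x x) v := fun v => by
    rw [chartDifferential_transition hx' hx, chartDifferential_self]
  have hτ := contDiffAt_transition (I := 𝓘(ℝ, E)) hx' hx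
  have hev : ∀ᶠ z in 𝓝 (extChartAt 𝓘(ℝ, E) x x), z ∈ (extChartAt 𝓘(ℝ, E) x).target ∧
      (extChartAt 𝓘(ℝ, E) x).symm z ∈ (extChartAt 𝓘(ℝ, E) x₀).source := by
    have h1 : ∀ᶠ z in 𝓝 (extChartAt 𝓘(ℝ, E) x x), z ∈ (extChartAt 𝓘(ℝ, E) x).target :=
      extChartAt_target_mem_nhds x
    refine h1.and ((continuousAt_extChartAt_symm x).eventually ((isOpen_extChartAt_source x₀).mem_nhds ?_))
    rwa [extChartAt_to_inv]
  rw [hcd, hcd, hcd, ← transition_apply (x₀ := x₀) hx']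
  refine (isMetricOn_chartMetric g x).christoffelSymbol_transform (isMetricOn_chartMetric g x₀)
    (mem_extChartAt_target x) ?_ hτ ?_ ?_ u v
  · rw [transition_apply hx']
    exact (extChartAt 𝓘(ℝ, E) x₀).map_source hx
  · intro w
    obtain ⟨v, hv⟩ := chartDifferential_surjective hx w
    exact ⟨v, by rw [← hcd, hv]⟩
  · filter_upwards [hev] with z hz v w
    rw [chartMetric_apply, inner_eq_chartMetric g hz.2,
      chartDifferential_transition ((extChartAt 𝓘(ℝ, E) x).map_target hz.1) hz.2,
      chartDifferential_transition ((extChartAt 𝓘(ℝ, E) x).map_target hz.1) hz.2,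
      chartDifferential_mfderiv_symm hz.1, chartDifferential_mfderiv_symm hz.1,
      (extChartAt 𝓘(ℝ, E) x).right_inv hz.1]
    rfl

end FixedChart

/-! ## The tangent bundle in a fixed chart -/

section TangentBundleChart

variable {E : Type*} [NormedAddCommGroup E] [NormedSpace ℝ E]
  {M : Type*} [TopologicalSpace M] [ChartedSpace E M] [IsManifold 𝓘(ℝ, E) ∞ M]

theorem mem_tangent_source_iff {Y₀ Z : TangentBundle 𝓘(ℝ, E) M} :
    Z ∈ (extChartAt 𝓘(ℝ, E).tangent Y₀).source ↔
      Z.proj ∈ (extChartAt 𝓘(ℝ, E) Y₀.proj).source := by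
  rw [extChartAt_source, extChartAt_source, TangentBundle.mem_chart_source_iff]

/-- The vector underlying a point of the tangent bundle. -/
def vec (Y : TangentBundle 𝓘(ℝ, E) M) : E := Y.2

theorem extChartAt_tangent_apply {Y₀ Z : TangentBundle 𝓘(ℝ, E) M}
    (hZ : Z.proj ∈ (extChartAt 𝓘(ℝ, E) Y₀.proj).source) :
    extChartAt 𝓘(ℝ, E).tangent Y₀ Z = (extChartAt 𝓘(ℝ, E) Y₀.proj Z.proj,
      chartDifferential 𝓘(ℝ, E) Y₀.proj Z.proj (vec Z)) := by
  rw [extChartAt_source] at hZ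
  have h1 := TangentBundle.continuousLinearMapAt_trivializationAt (I := 𝓘(ℝ, E)) hZ
  have h2 := congrArg (fun L : E →L[ℝ] E => L (vec Z)) h1
  have h3 : extChartAt 𝓘(ℝ, E).tangent Y₀ Z = (extChartAt 𝓘(ℝ, E) Y₀.proj Z.proj,
      (trivializationAt E (TangentSpace 𝓘(ℝ, E)) Y₀.proj Z).2) := by
    rw [FiberBundle.extChartAt]
    rfl
  rw [h3]
  congr 1
  refine Eq.trans ?_ h2
  exact (congrFun ((trivializationAt E (TangentSpace 𝓘(ℝ, E))
    Y₀.proj).coe_linearMapAt_of_mem (R := ℝ) hZ) Z.2).symm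

theorem extChartAt_tangent_self (Y : TangentBundle 𝓘(ℝ, E) M) :
    extChartAt 𝓘(ℝ, E).tangent Y Y = (extChartAt 𝓘(ℝ, E) Y.proj Y.proj, vec Y) := by
  rw [extChartAt_tangent_apply (mem_extChartAt_source _), chartDifferential_self]

/-- Tangent charts change by (y, w) ↦ (τ y, Dτ(y) w), and differentiating the second entry in y
produces D²τ(a, w). This term matches the inhomogeneous term of the Christoffel transformation law,
which makes spray and connector independent of the chart. -/
theorem chartDifferential_tangent {Y₀ Y : TangentBundle 𝓘(ℝ, E) M}
    (hY : Y.proj ∈ (extChartAt 𝓘(ℝ, E) Y₀.proj).source) (a c : E) :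
    chartDifferential 𝓘(ℝ, E).tangent Y₀ Y (a, c) =
      (chartDifferential 𝓘(ℝ, E) Y₀.proj Y.proj a,
        chartDifferential 𝓘(ℝ, E) Y₀.proj Y.proj c +
          fderiv ℝ (fderiv ℝ (transition 𝓘(ℝ, E) Y.proj Y₀.proj))
            (extChartAt 𝓘(ℝ, E) Y.proj Y.proj) a (vec Y)) := by
  set τ := transition 𝓘(ℝ, E) Y.proj Y₀.proj with τ_def
  set y := extChartAt 𝓘(ℝ, E) Y.proj Y.proj with y_def
  have hτ : ContDiffAt ℝ ∞ τ y := contDiffAt_transition (mem_extChartAt_source _) hY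
  have hτ1 : HasFDerivAt τ (fderiv ℝ τ y) y := (hτ.differentiableAt (by simp)).hasFDerivAt
  have hτ2 : HasFDerivAt (fderiv ℝ τ) (fderiv ℝ (fderiv ℝ τ) y) y :=
    ((hτ.fderiv_right (m := ∞) (by simp)).differentiableAt (by simp)).hasFDerivAt
  have hcd : ∀ v, chartDifferential 𝓘(ℝ, E) Y₀.proj Y.proj v = fderiv ℝ τ y v := fun v => by
    rw [chartDifferential_transition (mem_extChartAt_source _) hY, chartDifferential_self]
  have hT := (HasFDerivAt.comp (f := Prod.fst) (g := τ) (y, vec Y) hτ1 hasFDerivAt_fst).prodMk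
      ((HasFDerivAt.comp (f := Prod.fst) (g := fderiv ℝ τ) (y, vec Y) hτ2
        hasFDerivAt_fst).clm_apply hasFDerivAt_snd)
  have h := chartDifferential_eq (I := 𝓘(ℝ, E).tangent) (x₀ := Y₀) (x₁ := Y) (x := Y)
    (mem_tangent_source_iff.2 hY) (mem_extChartAt_source _) (F := fun p : E × E => (τ p.1, fderiv ℝ τ p.1 p.2))
    (by rw [extChartAt_tangent_self]; exact hT.differentiableAt) ?_ (a, c)
  · rw [h, chartDifferential_self, extChartAt_tangent_self]
    refine (congrArg (fun L : E × E →L[ℝ] E × E => L (a, c)) hT.fderiv).trans ?_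
    rw [hcd, hcd]
    simp
  · have hc : ContinuousAt (fun Z : TangentBundle 𝓘(ℝ, E) M => Z.proj) Y :=
      (FiberBundle.continuous_proj E (TangentSpace 𝓘(ℝ, E))).continuousAt
    filter_upwards [hc.eventually ((isOpen_extChartAt_source (I := 𝓘(ℝ, E)) Y.proj).mem_nhds
      (mem_extChartAt_source Y.proj)),
      hc.eventually ((isOpen_extChartAt_source Y₀.proj).mem_nhds hY)] with Z hZ hZ₀
    rw [extChartAt_tangent_apply hZ₀, extChartAt_tangent_apply hZ]
    have h1 := transition_apply (I := 𝓘(ℝ, E)) (M := M) (x := Y.proj) (x₀ := Y₀.proj)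
      (z := Z.proj) hZ
    have h2 := chartDifferential_transition (I := 𝓘(ℝ, E)) (M := M) (x := Y.proj)
      (x₀ := Y₀.proj) (z := Z.proj) hZ hZ₀ (vec Z)
    rw [Prod.mk.injEq]
    exact ⟨h1.symm, h2⟩

variable [FiniteDimensional ℝ E]

/-- The geodesic spray as a map to the model space. -/
def sprayAt (g : Metric E M) (Y : TangentBundle 𝓘(ℝ, E) M) : E × E :=
  (vec Y, -christoffel g Y.proj (vec Y) (vec Y))

/-- The geodesic spray in a fixed chart. -/
theorem chartDifferential_sprayAt (g : Metric E M) {Y₀ Y : TangentBundle 𝓘(ℝ, E) M}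
    (hY : Y.proj ∈ (extChartAt 𝓘(ℝ, E) Y₀.proj).source) :
    chartDifferential 𝓘(ℝ, E).tangent Y₀ Y (sprayAt g Y) =
      localSpray (chartMetric g Y₀.proj) (extChartAt 𝓘(ℝ, E).tangent Y₀ Y) := by
  rw [sprayAt, chartDifferential_tangent hY, map_neg, fderiv_transition_christoffel g hY,
    extChartAt_tangent_apply hY, localSpray, neg_add_rev]
  simp

/-- The connector as a map between model spaces. -/
def connectorAt (g : Metric E M) (Y : TangentBundle 𝓘(ℝ, E) M) (ξ : E × E) : E :=
  ξ.2 + christoffel g Y.proj ξ.1 (vec Y)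

/-- The connector in a fixed chart. -/
theorem chartDifferential_connectorAt (g : Metric E M) {Y₀ Y : TangentBundle 𝓘(ℝ, E) M}
    (hY : Y.proj ∈ (extChartAt 𝓘(ℝ, E) Y₀.proj).source) (ξ : E × E) :
    chartDifferential 𝓘(ℝ, E) Y₀.proj Y.proj (connectorAt g Y ξ) =
      (chartDifferential 𝓘(ℝ, E).tangent Y₀ Y ξ).2 +
      christoffelSymbol (chartMetric g Y₀.proj) (extChartAt 𝓘(ℝ, E) Y₀.proj Y.proj)
        (chartDifferential 𝓘(ℝ, E).tangent Y₀ Y ξ).1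
        (chartDifferential 𝓘(ℝ, E) Y₀.proj Y.proj (vec Y)) := by
  obtain ⟨a, c⟩ := ξ
  rw [chartDifferential_tangent hY, connectorAt, map_add]
  simp only
  rw [fderiv_transition_christoffel g hY]
  abel

end TangentBundleChart

/-! ## Geodesics -/

section Geodesics

variable {E : Type*} [NormedAddCommGroup E] [NormedSpace ℝ E]
  {M : Type*} [TopologicalSpace M] [ChartedSpace E M] [IsManifold 𝓘(ℝ, E) ∞ M]

/-- Vectors over distinct points are separated in M, vectors over one point in a common chart. It
makes the set of times where two geodesic lifts agree closed. -/
theorem t2Space_tangentBundle [T2Space M] : T2Space (TangentBundle 𝓘(ℝ, E) M) := by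
  refine ⟨fun Y Z hYZ => ?_⟩
  have hc : Continuous (fun Z : TangentBundle 𝓘(ℝ, E) M => Z.proj) :=
    FiberBundle.continuous_proj E (TangentSpace 𝓘(ℝ, E))
  by_cases h : Y.proj = Z.proj
  · set e := (chartAt (ModelProd E E) Y)
    have hY : Y ∈ e.source := mem_chart_source _ Y
    have hZ : Z ∈ e.source := by
      rw [TangentBundle.mem_chart_source_iff, ← h]
      exact mem_chart_source _ _
    have hne : e Y ≠ e Z := fun h' => hYZ (e.injOn hY hZ h')
    have : T2Space (ModelProd E E) := inferInstanceAs (T2Space (E × E))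
    obtain ⟨u, v, hu, hv, hYu, hZv, huv⟩ := t2_separation hne
    exact ⟨e.source ∩ e ⁻¹' u, e.source ∩ e ⁻¹' v, e.isOpen_inter_preimage hu,
      e.isOpen_inter_preimage hv, ⟨hY, hYu⟩, ⟨hZ, hZv⟩,
      Disjoint.mono inter_subset_right inter_subset_right (huv.preimage e)⟩
  · obtain ⟨u, v, hu, hv, hYu, hZv, huv⟩ := t2_separation h
    exact ⟨_, _, hu.preimage hc, hv.preimage hc, hYu, hZv, huv.preimage _⟩

variable [FiniteDimensional ℝ E]

/-- Geodesics in a fixed chart are integral curves of the local spray. -/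
theorem hasDerivWithinAt_of_isMIntegralCurveOn {g : Metric E M}
    {β : ℝ → TangentBundle 𝓘(ℝ, E) M} {s : Set ℝ}
    (hβ : IsMIntegralCurveOn β (geodesicSpray g) s) {Y₀ : TangentBundle 𝓘(ℝ, E) M} {t : ℝ}
    (ht : t ∈ s) (hsrc : (β t).proj ∈ (extChartAt 𝓘(ℝ, E) Y₀.proj).source) :
    HasDerivWithinAt (fun t => extChartAt 𝓘(ℝ, E).tangent Y₀ (β t))
      (localSpray (chartMetric g Y₀.proj) (extChartAt 𝓘(ℝ, E).tangent Y₀ (β t))) s t := by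
  have h1 := (hasMFDerivAt_chart (I := 𝓘(ℝ, E).tangent) (x₀ := Y₀) (x := β t)
    (mem_tangent_source_iff.2 hsrc)).comp_hasMFDerivWithinAt t (hβ t ht)
  have h2 : HasFDerivWithinAt (fun t => extChartAt 𝓘(ℝ, E).tangent Y₀ (β t))
      ((chartDifferential 𝓘(ℝ, E).tangent Y₀ (β t)).comp
        ((1 : ℝ →L[ℝ] ℝ).smulRight (sprayAt g (β t)))) s t := h1.hasFDerivWithinAt
  refine h2.hasDerivWithinAt.congr_deriv ?_
  rw [← chartDifferential_sprayAt g hsrc]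
  simp

/-- Supplies actual geodesics, and hence elements of `expDomain`, from solutions of the local
equation that stay in the chart. -/
theorem isMIntegralCurveOn_of_isSolution {g : Metric E M} {Y₀ : TangentBundle 𝓘(ℝ, E) M}
    {p : E × E} {α : C(Icc (0 : ℝ) 1, E × E)}
    (hsol : IsSolution (localSpray (chartMetric g Y₀.proj)) p α)
    (hα : ∀ t, (α t).1 ∈ (extChartAt 𝓘(ℝ, E) Y₀.proj).target) :
    IsMIntegralCurveOn
      (fun t => (extChartAt 𝓘(ℝ, E).tangent Y₀).symm (IccExtend zero_le_one α t))
      (geodesicSpray g) (Icc 0 1) := by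
  intro t ht
  set Φ := extChartAt 𝓘(ℝ, E).tangent Y₀ with Φ_def
  have htar : α ⟨t, ht⟩ ∈ Φ.target := by
    rw [Φ_def, FiberBundle.extChartAt_target]
    refine ⟨⟨hα _, ?_⟩, mem_univ _⟩
    have h := (extChartAt 𝓘(ℝ, E) Y₀.proj).map_target (hα ⟨t, ht⟩)
    rwa [extChartAt_source] at h
  have hsrc : Φ.symm (α ⟨t, ht⟩) ∈ Φ.source := Φ.map_target htar
  have h2 := (hsol.2 t ht).hasFDerivWithinAt.hasMFDerivWithinAt
  have e1 : IccExtend zero_le_one α t = α ⟨t, ht⟩ := IccExtend_of_mem _ _ ht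
  have h3 := HasMFDerivAt.comp_hasMFDerivWithinAt (f := IccExtend zero_le_one α) t
    (by rw [e1]; exact hasMFDerivAt_chart_symm htar) h2
  refine h3.congr_mfderiv ?_
  have h5 := mfderiv_symm_chartDifferential hsrc (sprayAt g (Φ.symm (α ⟨t, ht⟩)))
  rw [chartDifferential_sprayAt g (mem_tangent_source_iff.1 hsrc), Φ.right_inv htar] at h5
  have h6 : (symmDifferential 𝓘(ℝ, E).tangent Y₀ (α ⟨t, ht⟩)).comp
      (ContinuousLinearMap.toSpanSingleton ℝ (localSpray (chartMetric g Y₀.proj) (α ⟨t, ht⟩))) =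
      (1 : ℝ →L[ℝ] ℝ).smulRight (sprayAt g (Φ.symm (IccExtend zero_le_one α t))) := by
    ext1
    rw [e1]
    simp [h5]
  exact h6

end Geodesics

/-! ## The exponential map in a fixed chart -/

section Exponential

variable {E : Type*} [NormedAddCommGroup E] [NormedSpace ℝ E]
  {M : Type*} [TopologicalSpace M] [ChartedSpace E M] [IsManifold 𝓘(ℝ, E) ∞ M]

theorem extChartAt_tangent_mem_target {Y₀ Z : TangentBundle 𝓘(ℝ, E) M}
    (hZ : Z.proj ∈ (extChartAt 𝓘(ℝ, E) Y₀.proj).source) :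
    (extChartAt 𝓘(ℝ, E).tangent Y₀ Z).1 ∈ (extChartAt 𝓘(ℝ, E) Y₀.proj).target := by
  rw [extChartAt_tangent_apply hZ]
  exact (extChartAt 𝓘(ℝ, E) Y₀.proj).map_source hZ

theorem IsGeodesicLift.mem_expDomain {g : Metric E M} {Y : TangentBundle 𝓘(ℝ, E) M}
    {β : ℝ → TangentBundle 𝓘(ℝ, E) M} (hβ : IsGeodesicLift g Y β) : Y ∈ expDomain g := ⟨β, hβ⟩

variable [FiniteDimensional ℝ E]

/-- Geodesics are determined by their initial velocity. -/
theorem IsGeodesicLift.eqOn [T2Space M] {g : Metric E M} {Y : TangentBundle 𝓘(ℝ, E) M}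
    {β β' : ℝ → TangentBundle 𝓘(ℝ, E) M} (hβ : IsGeodesicLift g Y β)
    (hβ' : IsGeodesicLift g Y β') : EqOn β β' (Icc 0 1) := by
  have := t2Space_tangentBundle (E := E) (M := M)
  have hc : Continuous (fun Z : TangentBundle 𝓘(ℝ, E) M => Z.proj) :=
    FiberBundle.continuous_proj E (TangentSpace 𝓘(ℝ, E))
  have hcβ : ContinuousOn β (Icc 0 1) := fun t ht => (hβ.2 t ht).continuousWithinAt
  have hcβ' : ContinuousOn β' (Icc 0 1) := fun t ht => (hβ'.2 t ht).continuousWithinAt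
  have hclosed : IsClosed ({t | β t = β' t} ∩ Icc (0 : ℝ) 1) := by
    have h := (hcβ.prodMk hcβ').preimage_isClosed_of_isClosed isClosed_Icc
      (isClosed_diagonal (X := TangentBundle 𝓘(ℝ, E) M))
    convert h using 1
    ext t
    exact and_comm
  -- Continuation: the agreement set is closed and contains 0, and from each of its points t < 1 it
  -- extends to the right by uniqueness for the local spray in the chart at β t.
  refine hclosed.Icc_subset_of_forall_exists_gt (hβ.1.trans hβ'.1.symm) ?_
  rintro t ⟨hteq, ht⟩ y hy
  have hteq : β t = β' t := hteq
  have ht' : t ∈ Icc (0 : ℝ) 1 := Ico_subset_Icc_self ht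
  set Φ := extChartAt 𝓘(ℝ, E).tangent (β t) with Φ_def
  set G := chartMetric g (β t).proj with G_def
  have hG := isMetricOn_chartMetric g (β t).proj
  have hS : ContDiffAt ℝ 1 (localSpray G) (Φ (β t)) :=
    (hG.contDiffOn_localSpray.contDiffAt ((hG.isOpen.prod isOpen_univ).mem_nhds
      ⟨extChartAt_tangent_mem_target (mem_extChartAt_source _), mem_univ _⟩)).of_le (by simp)
  obtain ⟨K, s, hs, hK⟩ := hS.exists_lipschitzOnWith
  have hgood : ∀ {γ : ℝ → TangentBundle 𝓘(ℝ, E) M}, ContinuousOn γ (Icc 0 1) → γ t = β t →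
      ∀ᶠ t' in 𝓝[Icc 0 1] t, (γ t').proj ∈ (extChartAt 𝓘(ℝ, E) (β t).proj).source ∧
        Φ (γ t') ∈ s := by
    intro γ hγ h0
    have h1 := hγ t ht'
    have h2 : ∀ᶠ Z in 𝓝 (γ t), Z.proj ∈ (extChartAt 𝓘(ℝ, E) (β t).proj).source ∧ Φ Z ∈ s := by
      rw [h0]
      exact (hc.continuousAt.eventually ((isOpen_extChartAt_source _).mem_nhds
        (mem_extChartAt_source _))).and ((continuousAt_extChartAt (β t)).eventually hs)
    exact h1.eventually h2
  obtain ⟨δ, hδ, hball⟩ := Metric.mem_nhdsWithin_iff.1 ((hgood hcβ rfl).and (hgood hcβ' hteq.symm))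
  -- On [t, b] both curves remain in the chart and in the set where the spray is Lipschitz, while b
  -- exceeds neither y nor the end of the interval.
  set b := min (min y 1) (t + δ / 2) with b_def
  have htb : t < b := lt_min (lt_min hy ht.2) (by linarith)
  have hb1 : b ≤ 1 := (min_le_left _ _).trans (min_le_right _ _)
  have hsub : Icc t b ⊆ Icc 0 1 := Icc_subset_Icc ht.1 hb1
  have hgd : ∀ t' ∈ Icc t b, ((β t').proj ∈ (extChartAt 𝓘(ℝ, E) (β t).proj).source ∧
      Φ (β t') ∈ s) ∧ ((β' t').proj ∈ (extChartAt 𝓘(ℝ, E) (β t).proj).source ∧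
      Φ (β' t') ∈ s) := by
    intro t' ht'
    refine hball ⟨?_, hsub ht'⟩
    rw [Metric.mem_ball, Real.dist_eq, abs_lt]
    have := min_le_right (min y 1) (t + δ / 2)
    constructor <;> linarith [ht'.1, ht'.2]
  have hder : ∀ {γ : ℝ → TangentBundle 𝓘(ℝ, E) M}, IsMIntegralCurveOn γ (geodesicSpray g)
      (Icc 0 1) → (∀ t' ∈ Icc t b, (γ t').proj ∈ (extChartAt 𝓘(ℝ, E) (β t).proj).source) →
      ∀ t' ∈ Icc t b, HasDerivWithinAt (fun t => Φ (γ t)) (localSpray G (Φ (γ t')))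
        (Icc 0 1) t' := fun hγ hsrc t' ht' =>
    hasDerivWithinAt_of_isMIntegralCurveOn hγ (hsub ht') (hsrc t' ht')
  have hIci : ∀ t' ∈ Ico t b, Icc (0 : ℝ) 1 ∈ 𝓝[Ici t'] t' := fun t' ht' =>
    Filter.mem_of_superset (Icc_mem_nhdsGE (ht'.2.trans_le hb1))
      (Icc_subset_Icc_left (ht.1.trans ht'.1))
  have heq := ODE_solution_unique_of_mem_Icc_right (v := fun _ => localSpray G) (s := fun _ => s)
    (K := K) (f := fun t => Φ (β t)) (g := fun t => Φ (β' t)) (a := t) (b := b)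
    (fun _ _ => hK)
    (fun t' ht' => ((hder hβ.2 (fun t' h => (hgd t' h).1.1) t' ht').continuousWithinAt).mono hsub)
    (fun t' ht' => (hder hβ.2 (fun t' h => (hgd t' h).1.1) t'
      (Ico_subset_Icc_self ht')).mono_of_mem_nhdsWithin (hIci t' ht'))
    (fun t' ht' => (hgd t' (Ico_subset_Icc_self ht')).1.2)
    (fun t' ht' => ((hder hβ'.2 (fun t' h => (hgd t' h).2.1) t' ht').continuousWithinAt).mono hsub)
    (fun t' ht' => (hder hβ'.2 (fun t' h => (hgd t' h).2.1) t'
      (Ico_subset_Icc_self ht')).mono_of_mem_nhdsWithin (hIci t' ht'))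
    (fun t' ht' => (hgd t' (Ico_subset_Icc_self ht')).2.2) (by simp only [hteq])
  refine ⟨b, ?_, htb, (min_le_left _ _).trans (min_le_left _ _)⟩
  have hb := right_mem_Icc.2 htb.le
  exact Φ.injOn (mem_tangent_source_iff.2 (hgd b hb).1.1)
    (mem_tangent_source_iff.2 (hgd b hb).2.1) (heq hb)

theorem IsGeodesicLift.expMap_eq [T2Space M] {g : Metric E M} {Y : TangentBundle 𝓘(ℝ, E) M}
    {β : ℝ → TangentBundle 𝓘(ℝ, E) M} (hβ : IsGeodesicLift g Y β) :
    expMap g Y = (β 1).proj := by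
  have h := hβ.mem_expDomain
  rw [expMap, dif_pos h]
  rw [IsGeodesicLift.eqOn h.choose_spec hβ (right_mem_Icc.2 zero_le_one)]

/-- A smooth map `Exp`, defined near the zero vectors over an open set `U` with metric `G`, which
agrees with the exponential map to second order. -/
structure IsExponential {V : Type*} [NormedAddCommGroup V] [NormedSpace ℝ V]
    (G : V → V →L[ℝ] V →L[ℝ] ℝ) (U : Set V) (Exp : V × V → V) (N : Set (V × V)) : Prop where
  isOpen : IsOpen N
  fst_mem : ∀ p ∈ N, p.1 ∈ U
  contDiffAt : ∀ p ∈ N, ContDiffAt ℝ ∞ Exp p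
  mem : ∀ p ∈ N, Exp p ∈ U
  apply_zero : ∀ y, (y, 0) ∈ N → Exp (y, 0) = y
  fderiv_zero : ∀ y, (y, 0) ∈ N → ∀ u v, fderiv ℝ Exp (y, 0) (u, v) = u + v
  fderiv_fderiv_zero : ∀ y, (y, 0) ∈ N → ∀ u v u' v',
    fderiv ℝ (fderiv ℝ Exp) (y, 0) (u, v) (u', v') = -christoffelSymbol G y v v'

/-- The exponential map near the zero vector at `x₀`, in the preferred chart at `x₀`. -/
theorem exists_local_exp [T2Space M] (g : Metric E M) (x₀ : M) :
    ∃ (Exp : E × E → E) (N : Set (E × E)),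
      IsExponential (chartMetric g x₀) (extChartAt 𝓘(ℝ, E) x₀).target Exp N ∧
      (extChartAt 𝓘(ℝ, E) x₀ x₀, 0) ∈ N ∧
      ∀ Z : TangentBundle 𝓘(ℝ, E) M, Z.proj ∈ (extChartAt 𝓘(ℝ, E) x₀).source →
        (extChartAt 𝓘(ℝ, E) x₀ Z.proj, chartDifferential 𝓘(ℝ, E) x₀ Z.proj (vec Z)) ∈ N →
        Z ∈ expDomain g ∧ expMap g Z = (extChartAt 𝓘(ℝ, E) x₀).symm
          (Exp (extChartAt 𝓘(ℝ, E) x₀ Z.proj,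
            chartDifferential 𝓘(ℝ, E) x₀ Z.proj (vec Z))) := by
  have hG := isMetricOn_chartMetric g x₀
  obtain ⟨Θ, Exp, N, hN, h0, hNU, hsm, hΘ, hsol, hExp, h1, h2, h3⟩ :=
    hG.exists_exp (mem_extChartAt_target x₀)
  refine ⟨Exp, N, ⟨hN, hNU, hsm, fun p hp => by rw [hExp]; exact hΘ p hp _, h1, h2, h3⟩, h0,
    fun Z hZ hZN => ?_⟩
  -- A tangent-bundle chart depends only on the base point of its centre, so the zero vector is an
  -- arbitrary choice.
  set Y₀ : TangentBundle 𝓘(ℝ, E) M := ⟨x₀, 0⟩ with Y₀_def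
  set p := (extChartAt 𝓘(ℝ, E) x₀ Z.proj, chartDifferential 𝓘(ℝ, E) x₀ Z.proj (vec Z)) with p_def
  have hp : extChartAt 𝓘(ℝ, E).tangent Y₀ Z = p := extChartAt_tangent_apply (Y₀ := Y₀) hZ
  have hcurve := isMIntegralCurveOn_of_isSolution (Y₀ := Y₀) (hsol p hZN) (hΘ p hZN)
  have hlift : IsGeodesicLift g Z
      (fun t => (extChartAt 𝓘(ℝ, E).tangent Y₀).symm (IccExtend zero_le_one (Θ p) t)) := by
    refine ⟨?_, hcurve⟩
    simp only
    rw [IccExtend_of_mem _ _ (left_mem_Icc.2 zero_le_one), (hsol p hZN).1, ← hp]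
    exact (extChartAt 𝓘(ℝ, E).tangent Y₀).left_inv (mem_tangent_source_iff.2 hZ)
  refine ⟨hlift.mem_expDomain, hlift.expMap_eq.trans ?_⟩
  rw [IccExtend_of_mem _ _ (right_mem_Icc.2 zero_le_one), hExp]
  have htar : Θ p ⟨1, right_mem_Icc.2 zero_le_one⟩ ∈
      (extChartAt 𝓘(ℝ, E).tangent Y₀).target := by
    rw [FiberBundle.extChartAt_target]
    refine ⟨⟨hΘ p hZN _, ?_⟩, mem_univ _⟩
    have h := (extChartAt 𝓘(ℝ, E) x₀).map_target (hΘ p hZN ⟨1, right_mem_Icc.2 zero_le_one⟩)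
    rwa [extChartAt_source] at h
  have hsrc := (extChartAt 𝓘(ℝ, E).tangent Y₀).map_target htar
  have h4 := extChartAt_tangent_apply (mem_tangent_source_iff.1 hsrc)
  rw [(extChartAt 𝓘(ℝ, E).tangent Y₀).right_inv htar] at h4
  exact ((extChartAt 𝓘(ℝ, E) x₀).left_inv (mem_tangent_source_iff.1 hsrc)).symm.trans
    (congrArg (fun q : E × E => (extChartAt 𝓘(ℝ, E) x₀).symm q.1) h4.symm)

end Exponential

/-! ## Second-order expansion of the pulled-back metric -/

section Expansion

variable {V : Type*} [NormedAddCommGroup V] [NormedSpace ℝ V]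
  {G : V → V →L[ℝ] V →L[ℝ] ℝ} {U : Set V} {Exp : V × V → V} {N : Set (V × V)}

/-- The derivative, as a function of `r`, of the differential of `(b, w) ↦ exp_b (r w)`. -/
theorem IsExponential.hasDerivAt_fderiv (hE : IsExponential G U Exp N) {b : V} (hb : (b, 0) ∈ N)
    (w v A m : V) :
    HasDerivAt (fun r : ℝ => fderiv ℝ Exp (b, r • w) (v, A + r • m))
      (m - christoffelSymbol G b w A) 0 := by
  have h0 : HasDerivAt (fun r : ℝ => (b, r • w)) (0, w) 0 := by
    have := (hasDerivAt_const (0 : ℝ) b).prodMk ((hasDerivAt_id (0 : ℝ)).smul_const w)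
    simpa using this
  have h1 : HasDerivAt (fun r : ℝ => (v, A + r • m)) (0, m) 0 := by
    have := (hasDerivAt_const (0 : ℝ) v).prodMk
      (((hasDerivAt_id (0 : ℝ)).smul_const m).const_add A)
    simpa using this
  have h2 : HasFDerivAt (fderiv ℝ Exp) (fderiv ℝ (fderiv ℝ Exp) (b, 0)) (b, (0 : ℝ) • w) := by
    rw [zero_smul]
    exact (((hE.contDiffAt _ hb).fderiv_right (m := ∞) (by simp)).differentiableAt
      (by simp)).hasFDerivAt
  have h3 : HasDerivAt (fun r : ℝ => fderiv ℝ Exp (b, r • w))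
      (fderiv ℝ (fderiv ℝ Exp) (b, 0) (0, w)) 0 := h2.comp_hasDerivAt (0 : ℝ) h0
  have h4 := HasDerivAt.clm_apply (c := fun r : ℝ => fderiv ℝ Exp (b, r • w))
    (u := fun r : ℝ => (v, A + r • m)) h3 h1
  refine h4.congr_deriv ?_
  simp only [zero_smul, add_zero]
  rw [hE.fderiv_fderiv_zero b hb, hE.fderiv_zero b hb]
  abel

theorem IsExponential.hasDerivAt (hE : IsExponential G U Exp N) {b : V} (hb : (b, 0) ∈ N)
    (w : V) : HasDerivAt (fun r : ℝ => Exp (b, r • w)) w 0 := by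
  have h0 : HasDerivAt (fun r : ℝ => (b, r • w)) (0, w) 0 := by
    have := (hasDerivAt_const (0 : ℝ) b).prodMk ((hasDerivAt_id (0 : ℝ)).smul_const w)
    simpa using this
  have h2 : HasFDerivAt Exp (fderiv ℝ Exp (b, 0)) (b, (0 : ℝ) • w) := by
    rw [zero_smul]
    exact ((hE.contDiffAt _ hb).differentiableAt (by simp)).hasFDerivAt
  refine (h2.comp_hasDerivAt (0 : ℝ) h0).congr_deriv ?_
  rw [hE.fderiv_zero b hb, zero_add]

/-- The differential of `(r, b, w) ↦ exp_b (r w)` in the direction `(τ, v, r⁻¹ p + m)`. -/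
def expDifferential (Exp : V × V → V) (b w : V) (r τ : ℝ) (v p m : V) : V :=
  fderiv ℝ Exp (b, r • w) (v, (τ • w + p) + r • m)

/-- No negative power of r is left in `expDifferential`, which is therefore smooth on both sides of
r = 0; this lets Hadamard's lemma be applied on a full neighbourhood. -/
theorem contDiffAt_expDifferential {X : Type*} [NormedAddCommGroup X] [NormedSpace ℝ X]
    (hE : IsExponential G U Exp N) {x₀ : X} {b w v p m : X → V} {τ : X → ℝ}
    (hb₀ : (b x₀, 0) ∈ N) (hb : ContDiffAt ℝ ∞ b x₀) (hw : ContDiffAt ℝ ∞ w x₀)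
    (hv : ContDiffAt ℝ ∞ v x₀) (hp : ContDiffAt ℝ ∞ p x₀) (hm : ContDiffAt ℝ ∞ m x₀)
    (hτ : ContDiffAt ℝ ∞ τ x₀) :
    ContDiffAt ℝ ∞ (fun q : ℝ × X =>
      expDifferential Exp (b q.2) (w q.2) q.1 (τ q.2) (v q.2) (p q.2) (m q.2)) (0, x₀) := by
  have hs {f : X → V} (hf : ContDiffAt ℝ ∞ f x₀) :
      ContDiffAt ℝ ∞ (fun q : ℝ × X => f q.2) (0, x₀) :=
    ContDiffAt.comp (g := f) (f := Prod.snd) ((0 : ℝ), x₀) hf contDiffAt_snd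
  have hs' : ContDiffAt ℝ ∞ (fun q : ℝ × X => τ q.2) (0, x₀) :=
    ContDiffAt.comp (g := τ) (f := Prod.snd) ((0 : ℝ), x₀) hτ contDiffAt_snd
  have h1 : ContDiffAt ℝ ∞ (fun q : ℝ × X => (b q.2, q.1 • w q.2)) (0, x₀) :=
    (hs hb).prodMk (contDiffAt_fst.smul (hs hw))
  have h2 : ContDiffAt ℝ ∞ (fderiv ℝ Exp) (b x₀, (0 : ℝ) • w x₀) := by
    rw [zero_smul]
    exact (hE.contDiffAt _ hb₀).fderiv_right (by simp)
  exact (ContDiffAt.comp (f := fun q : ℝ × X => (b q.2, q.1 • w q.2)) ((0 : ℝ), x₀) h2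
    h1).clm_apply ((hs hv).prodMk (((hs'.smul (hs hw)).add (hs hp)).add
      (contDiffAt_fst.smul (hs hm))))

theorem contDiffAt_metric_exp {X : Type*} [NormedAddCommGroup X] [NormedSpace ℝ X]
    (hG : IsMetricOn G U) (hE : IsExponential G U Exp N) {x₀ : X} {b w : X → V}
    (hb₀ : (b x₀, 0) ∈ N) (hb : ContDiffAt ℝ ∞ b x₀) (hw : ContDiffAt ℝ ∞ w x₀) :
    ContDiffAt ℝ ∞ (fun q : ℝ × X => G (Exp (b q.2, q.1 • w q.2))) (0, x₀) := by
  have hs {f : X → V} (hf : ContDiffAt ℝ ∞ f x₀) :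
      ContDiffAt ℝ ∞ (fun q : ℝ × X => f q.2) (0, x₀) :=
    ContDiffAt.comp (g := f) (f := Prod.snd) ((0 : ℝ), x₀) hf contDiffAt_snd
  have h1 : ContDiffAt ℝ ∞ (fun q : ℝ × X => (b q.2, q.1 • w q.2)) (0, x₀) :=
    (hs hb).prodMk (contDiffAt_fst.smul (hs hw))
  have h2 : ContDiffAt ℝ ∞ (G ∘ Exp) (b x₀, (0 : ℝ) • w x₀) := by
    rw [zero_smul]
    exact (hG.contDiffAt (hE.mem _ hb₀)).comp _ (hE.contDiffAt _ hb₀)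
  exact ContDiffAt.comp (f := fun q : ℝ × X => (b q.2, q.1 • w q.2)) ((0 : ℝ), x₀) h2 h1

variable [FiniteDimensional ℝ V]

/-- The central computation. With A = v + τ w + p, compatibility turns the derivative of G along w
into Γ(w, A) in the first slot plus the analogous term in the second, and the derivative of the
first argument is m - Γ(w, τ w + p). Their sum m + Γ(v, w) is orthogonal to w and p', so only its
pairing with v' survives. -/
theorem hasDerivAt_metric_expDifferential (hG : IsMetricOn G U) (hE : IsExponential G U Exp N)
    {b w v p m v' p' m' : V} {τ τ' : ℝ} (hb : (b, 0) ∈ N) (hwt : ∀ t ∈ ({m + christoffelSymbol G b v w,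
      m' + christoffelSymbol G b v' w} : Set V), G b t w = 0)
    (htp : G b (m + christoffelSymbol G b v w) p' = 0)
    (htp' : G b (m' + christoffelSymbol G b v' w) p = 0) :
    HasDerivAt (fun r : ℝ => G (Exp (b, r • w)) (expDifferential Exp b w r τ v p m)
      (expDifferential Exp b w r τ' v' p' m'))
      (G b (m + christoffelSymbol G b v w) v' + G b (m' + christoffelSymbol G b v' w) v) 0 := by
  have hbU : b ∈ U := hE.fst_mem _ hb
  have hE1 := hE.hasDerivAt hb w
  have hG1 : HasFDerivAt G (fderiv ℝ G b) (Exp (b, (0 : ℝ) • w)) := by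
    rw [zero_smul, hE.apply_zero b hb]
    exact hG.hasFDerivAt hbU
  have hG2 : HasDerivAt (fun r : ℝ => G (Exp (b, r • w))) (fderiv ℝ G b w) 0 :=
    hG1.comp_hasDerivAt (0 : ℝ) hE1
  have h1 := HasDerivAt.clm_apply (c := fun r : ℝ => G (Exp (b, r • w)))
    (u := fun r => expDifferential Exp b w r τ v p m) hG2
    (hE.hasDerivAt_fderiv hb w v (τ • w + p) m)
  have h := HasDerivAt.clm_apply (c := fun r : ℝ => G (Exp (b, r • w))
      (expDifferential Exp b w r τ v p m))
    (u := fun r => expDifferential Exp b w r τ' v' p' m') h1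
      (hE.hasDerivAt_fderiv hb w v' (τ' • w + p') m')
  refine h.congr_deriv ?_
  have hz : ∀ (τ : ℝ) (v p m : V), expDifferential Exp b w 0 τ v p m = v + (τ • w + p) := by
    intro τ v p m
    rw [expDifferential, zero_smul, zero_smul, add_zero, hE.fderiv_zero b hb]
  simp only [hz]
  rw [zero_smul, hE.apply_zero b hb, add_apply, hG.fderiv_apply hbU]
  have e1 : ∀ v A m : V, christoffelSymbol G b w (v + A) + (m - christoffelSymbol G b w A) =
      m + christoffelSymbol G b v w := fun v A m => by
    rw [map_add, hG.christoffelSymbol_symm hbU v w]; abel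
  have hlin : ∀ {p : V} (L : V →L[ℝ] ℝ), L w = 0 → L p = 0 → ∀ (v : V) (τ : ℝ),
      L (v + (τ • w + p)) = L v := fun L h1 h2 v τ => by
    rw [map_add, map_add, map_smul, h1, h2, smul_zero, add_zero, add_zero]
  have e2 : G b (christoffelSymbol G b w (v + (τ • w + p))) (v' + (τ' • w + p')) +
      G b (m - christoffelSymbol G b w (τ • w + p)) (v' + (τ' • w + p')) =
      G b (m + christoffelSymbol G b v w) v' := by
    rw [← add_apply, ← map_add, e1]
    exact hlin _ (hwt _ (Or.inl rfl)) htp _ _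
  have e3 : G b (v + (τ • w + p)) (christoffelSymbol G b w (v' + (τ' • w + p'))) +
      G b (v + (τ • w + p)) (m' - christoffelSymbol G b w (τ' • w + p')) =
      G b (m' + christoffelSymbol G b v' w) v := by
    rw [← map_add, e1, hG.symm b hbU]
    exact hlin _ (hwt _ (Or.inr rfl)) htp' _ _
  rw [← e2, ← e3]
  ring

/-- The expansion to second order of the metric pulled back by `(r, b, w) ↦ exp_b (r w)`. -/
theorem exists_expansion {X : Type} [NormedAddCommGroup X] [NormedSpace ℝ X]
    (hG : IsMetricOn G U) (hE : IsExponential G U Exp N) {x₀ : X} {b w v p m v' p' m' : X → V}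
    {τ τ' : X → ℝ} (hb₀ : (b x₀, 0) ∈ N) (hb : ContDiffAt ℝ ∞ b x₀) (hw : ContDiffAt ℝ ∞ w x₀)
    (hv : ContDiffAt ℝ ∞ v x₀) (hp : ContDiffAt ℝ ∞ p x₀) (hm : ContDiffAt ℝ ∞ m x₀)
    (hv' : ContDiffAt ℝ ∞ v' x₀) (hp' : ContDiffAt ℝ ∞ p' x₀) (hm' : ContDiffAt ℝ ∞ m' x₀)
    (hτ : ContDiffAt ℝ ∞ τ x₀) (hτ' : ContDiffAt ℝ ∞ τ' x₀)
    (hww : ∀ᶠ x in 𝓝 x₀, G (b x) (w x) (w x) = 1)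
    (hwu : ∀ᶠ x in 𝓝 x₀, ∀ u ∈ ({v x, v' x, p x, p' x,
      m x + christoffelSymbol G (b x) (v x) (w x),
      m' x + christoffelSymbol G (b x) (v' x) (w x)} : Set V), G (b x) u (w x) = 0)
    (hnu : ∀ᶠ x in 𝓝 x₀, ∀ u ∈ ({v x, v' x, m x + christoffelSymbol G (b x) (v x) (w x),
      m' x + christoffelSymbol G (b x) (v' x) (w x)} : Set V),
        G (b x) u (p x) = 0 ∧ G (b x) u (p' x) = 0) :
    ∃ k : ℝ × X → ℝ, ContDiffAt ℝ ∞ k (0, x₀) ∧ ∀ᶠ q in 𝓝 ((0 : ℝ), x₀),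
      G (Exp (b q.2, q.1 • w q.2))
        (expDifferential Exp (b q.2) (w q.2) q.1 (τ q.2) (v q.2) (p q.2) (m q.2))
        (expDifferential Exp (b q.2) (w q.2) q.1 (τ' q.2) (v' q.2) (p' q.2) (m' q.2)) =
      τ q.2 * τ' q.2 + G (b q.2) (p q.2) (p' q.2) + G (b q.2) (v q.2) (v' q.2) +
        q.1 * (G (b q.2) (m q.2 + christoffelSymbol G (b q.2) (v q.2) (w q.2)) (v' q.2) +
          G (b q.2) (m' q.2 + christoffelSymbol G (b q.2) (v' q.2) (w q.2)) (v q.2)) +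
        q.1 ^ 2 * k q := by
  set Q : ℝ × X → ℝ := fun q => G (Exp (b q.2, q.1 • w q.2))
        (expDifferential Exp (b q.2) (w q.2) q.1 (τ q.2) (v q.2) (p q.2) (m q.2))
        (expDifferential Exp (b q.2) (w q.2) q.1 (τ' q.2) (v' q.2) (p' q.2) (m' q.2)) with Q_def
  set R : X → ℝ := fun x => τ x * τ' x + G (b x) (p x) (p' x) + G (b x) (v x) (v' x) with R_def
  set S : X → ℝ := fun x => G (b x) (m x + christoffelSymbol G (b x) (v x) (w x)) (v' x) +
          G (b x) (m' x + christoffelSymbol G (b x) (v' x) (w x)) (v x) with S_def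
  have hbU : b x₀ ∈ U := hE.fst_mem _ hb₀
  have hbN : ∀ᶠ x in 𝓝 x₀, (b x, 0) ∈ N :=
    (hb.continuousAt.prodMk continuousAt_const).eventually (hE.isOpen.mem_nhds hb₀)
  have hGb : ContDiffAt ℝ ∞ (fun x => G (b x)) x₀ := (hG.contDiffAt hbU).comp x₀ hb
  have hΓb : ContDiffAt ℝ ∞ (fun x => christoffelSymbol G (b x)) x₀ :=
    (hG.contDiffOn_christoffelSymbol.contDiffAt (hG.isOpen.mem_nhds hbU)).comp x₀ hb
  have hQ : ContDiffAt ℝ ∞ Q (0, x₀) :=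
    ((contDiffAt_metric_exp hG hE hb₀ hb hw).clm_apply
      (contDiffAt_expDifferential hE hb₀ hb hw hv hp hm hτ)).clm_apply
      (contDiffAt_expDifferential hE hb₀ hb hw hv' hp' hm' hτ')
  have hR : ContDiffAt ℝ ∞ R x₀ := ((hτ.mul hτ').add ((hGb.clm_apply hp).clm_apply hp')).add
    ((hGb.clm_apply hv).clm_apply hv')
  have hS : ContDiffAt ℝ ∞ S x₀ :=
    ((hGb.clm_apply (hm.add ((hΓb.clm_apply hv).clm_apply hw))).clm_apply hv').add
      ((hGb.clm_apply (hm'.add ((hΓb.clm_apply hv').clm_apply hw))).clm_apply hv)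
  -- R and S are the Taylor coefficients of order 0 and 1, so f and ∂_r f vanish at r = 0: f by the
  -- orthogonality relations, ∂_r f by the preceding derivative formula.
  set f : ℝ × X → ℝ := fun q => Q q - (R q.2 + q.1 * S q.2) with f_def
  have hf : ContDiffAt ℝ ∞ f (0, x₀) := hQ.sub
    ((ContDiffAt.comp (g := R) (f := Prod.snd) ((0 : ℝ), x₀) hR contDiffAt_snd).add
      (contDiffAt_fst.mul
        (ContDiffAt.comp (g := S) (f := Prod.snd) ((0 : ℝ), x₀) hS contDiffAt_snd)))
  have hz : ∀ x, (b x, 0) ∈ N → ∀ (τ : ℝ) (v p m : V),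
      expDifferential Exp (b x) (w x) 0 τ v p m = v + (τ • w x + p) := by
    intro x hx τ v p m
    rw [expDifferential, zero_smul, zero_smul, add_zero, hE.fderiv_zero _ hx]
  have hf0 : ∀ᶠ x in 𝓝 x₀, f (0, x) = 0 := by
    filter_upwards [hbN, hww, hwu, hnu] with x hx hww hwu hnu
    have hxU : b x ∈ U := hE.fst_mem _ hx
    have hsymm := hG.symm (b x) hxU
    have a1 := hwu (v x) (by simp)
    have a2 := hwu (v' x) (by simp)
    have a3 := hwu (p x) (by simp)
    have a4 := hwu (p' x) (by simp)
    have a5 := hnu (v x) (by simp)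
    have a6 := hnu (v' x) (by simp)
    have a2' := hsymm (v' x) (w x) ▸ a2
    have a4' := hsymm (p' x) (w x) ▸ a4
    have a6' := hsymm (v' x) (p x) ▸ a6.1
    simp only [f_def, Q_def, R_def, S_def]
    rw [hz x hx, hz x hx, zero_smul, hE.apply_zero _ hx]
    simp only [map_add, map_smul, add_apply, smul_apply, smul_eq_mul, hww, a1, a2', a3, a4', a5.2,
      a6']
    ring
  have hf1 : ∀ᶠ x in 𝓝 x₀, fderiv ℝ f (0, x) (1, 0) = 0 := by
    have hd : ∀ᶠ x in 𝓝 x₀, DifferentiableAt ℝ f (0, x) := by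
      have h1 : ∀ᶠ q in 𝓝 ((0 : ℝ), x₀), ContDiffAt ℝ 1 f q :=
        (hf.of_le (by simp)).eventually (by simp)
      have h2 : ContinuousAt (fun x : X => ((0 : ℝ), x)) x₀ := by fun_prop
      exact (h2.eventually h1).mono fun x hx => hx.differentiableAt (by simp)
    filter_upwards [hbN, hwu, hnu, hd] with x hx hwu hnu hd
    have h1 : HasDerivAt (fun r : ℝ => (r, x)) ((1 : ℝ), (0 : X)) 0 :=
      (hasDerivAt_id (0 : ℝ)).prodMk (hasDerivAt_const _ _)
    have h2 := hd.hasFDerivAt.comp_hasDerivAt (0 : ℝ) h1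
    have h3 := hasDerivAt_metric_expDifferential hG hE (w := w x) (v := v x) (p := p x) (m := m x)
      (v' := v' x) (p' := p' x) (m' := m' x) (τ := τ x) (τ' := τ' x) hx
      (by rintro t (rfl | rfl) <;> exact hwu _ (by simp)) (hnu _ (by simp)).2 (hnu _ (by simp)).1
    have h4 := h3.sub (((hasDerivAt_id (0 : ℝ)).mul_const (S x)).const_add (R x))
    have h5 := h2.unique h4
    rw [h5]
    simp [S_def]
  obtain ⟨k, hk, hfk⟩ := exists_eq_sq_mul_of_contDiffAt hf hf0 hf1
  refine ⟨k, hk, ?_⟩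
  filter_upwards [hfk] with q hq
  rw [← hq]
  simp only [f_def, Q_def, R_def, S_def]
  ring

end Expansion

/-! ## The ambient bundle in a fixed chart -/

section AmbientChart

variable {E : Type*} [NormedAddCommGroup E] [NormedSpace ℝ E]
  {M : Type*} [TopologicalSpace M] [ChartedSpace E M]
  {F : Type*} [NormedAddCommGroup F] [NormedSpace ℝ F]
  {B : Type*} [TopologicalSpace B] [ChartedSpace F B]
  {ι : C^∞⟮𝓘(ℝ, F), B; 𝓘(ℝ, E), M⟯}

variable (ι) in
/-- The points of `B` at which the charts at `b₀` and at `ι b₀` are defined. -/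
def chartDomain (b₀ : B) : Set B :=
  (extChartAt 𝓘(ℝ, F) b₀).source ∩ ι ⁻¹' (extChartAt 𝓘(ℝ, E) (ι b₀)).source

theorem isOpen_chartDomain (b₀ : B) : IsOpen (chartDomain ι b₀) :=
  (isOpen_extChartAt_source b₀).inter
    ((isOpen_extChartAt_source (ι b₀)).preimage ι.contMDiff.continuous)

theorem mem_chartDomain (b₀ : B) : b₀ ∈ chartDomain ι b₀ :=
  ⟨mem_extChartAt_source b₀, mem_extChartAt_source (ι b₀)⟩

variable (ι) in
/-- The map `ι` in the charts at `b₀` and `ι b₀`. -/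
def localMap (b₀ : B) : F → E := writtenInExtChartAt 𝓘(ℝ, F) 𝓘(ℝ, E) b₀ ι

theorem localMap_apply {b₀ b : B} (hb : b ∈ chartDomain ι b₀) :
    localMap ι b₀ (extChartAt 𝓘(ℝ, F) b₀ b) = extChartAt 𝓘(ℝ, E) (ι b₀) (ι b) := by
  rw [localMap, writtenInExtChartAt, Function.comp_apply, Function.comp_apply,
    (extChartAt 𝓘(ℝ, F) b₀).left_inv hb.1]

variable [IsManifold 𝓘(ℝ, E) ∞ M] [IsManifold 𝓘(ℝ, F) ∞ B]

theorem contDiffAt_localMap {b₀ b : B} (hb : b ∈ chartDomain ι b₀) :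
    ContDiffAt ℝ ∞ (localMap ι b₀) (extChartAt 𝓘(ℝ, F) b₀ b) := by
  rw [← contMDiffAt_iff_contDiffAt]
  have h1 := contMDiffAt_extChartAt' (I := 𝓘(ℝ, E)) (n := ∞) (x := ι b₀) (x' := ι b)
    (by rw [← extChartAt_source 𝓘(ℝ, E)]; exact hb.2)
  have h2 := (contMDiffOn_extChartAt_symm (I := 𝓘(ℝ, F)) (n := ∞) b₀).contMDiffAt
    (extChartAt_target_mem_nhds' ((extChartAt 𝓘(ℝ, F) b₀).map_source hb.1))
  have h3 : ContMDiffAt 𝓘(ℝ, F) 𝓘(ℝ, E) ∞ (fun z => extChartAt 𝓘(ℝ, E) (ι b₀) (ι z)) b :=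
    h1.comp b ι.contMDiff.contMDiffAt
  exact ContMDiffAt.comp_of_eq (f := (extChartAt 𝓘(ℝ, F) b₀).symm) h3 h2
    ((extChartAt 𝓘(ℝ, F) b₀).left_inv hb.1)

/-- The vector underlying a point of the ambient bundle. -/
def ambientVec (W : AmbientBundle ι) : E := W.2

/-- The preferred chart of the ambient bundle. -/
def coords (W₀ W : AmbientBundle ι) : F × E := extChartAt (𝓘(ℝ, F).prod 𝓘(ℝ, E)) W₀ W

/-- The differential of the preferred chart of the ambient bundle. -/
def coordsDifferential (W₀ W : AmbientBundle ι) : F × E →L[ℝ] F × E :=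
  chartDifferential (𝓘(ℝ, F).prod 𝓘(ℝ, E)) W₀ W

theorem mem_ambient_source_iff {W₀ W : AmbientBundle ι} :
    W ∈ (extChartAt (𝓘(ℝ, F).prod 𝓘(ℝ, E)) W₀).source ↔ W.proj ∈ chartDomain ι W₀.proj := by
  rw [FiberBundle.extChartAt]
  simp only [PartialEquiv.trans_source, PartialEquiv.prod_source, PartialEquiv.refl_source]
  constructor
  · rintro ⟨h1, h2, -⟩
    refine ⟨h2, ?_⟩
    rw [mem_preimage, extChartAt_source]
    exact h1
  · rintro ⟨h1, h2⟩
    rw [mem_preimage, extChartAt_source] at h2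
    exact ⟨h2, h1, mem_univ _⟩

/-- The pulled-back bundle inherits the trivialization of TM at ι b₀, so its fibre coordinate can be
read off the tangent-bundle chart there. -/
theorem coords_apply {W₀ W : AmbientBundle ι} (hW : W.proj ∈ chartDomain ι W₀.proj) :
    coords W₀ W = (extChartAt 𝓘(ℝ, F) W₀.proj W.proj,
      chartDifferential 𝓘(ℝ, E) (ι W₀.proj) (ι W.proj) (ambientVec W)) := by
  have h2 : extChartAt 𝓘(ℝ, E).tangent (⟨ι W₀.proj, 0⟩ : TangentBundle 𝓘(ℝ, E) M)
      (toTangentBundle ι W) = (extChartAt 𝓘(ℝ, E) (ι W₀.proj) (ι W.proj),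
      chartDifferential 𝓘(ℝ, E) (ι W₀.proj) (ι W.proj) (ambientVec W)) :=
    extChartAt_tangent_apply (Y₀ := (⟨ι W₀.proj, 0⟩ : TangentBundle 𝓘(ℝ, E) M)) hW.2
  have h3 := congrArg (fun p : E × E => p.2) h2
  rw [FiberBundle.extChartAt] at h3
  rw [coords, FiberBundle.extChartAt]
  exact Prod.ext rfl h3

theorem coords_self (W : AmbientBundle ι) :
    coords W W = (extChartAt 𝓘(ℝ, F) W.proj W.proj, ambientVec W) := by
  rw [coords_apply (mem_chartDomain _), chartDifferential_self]

theorem coordsDifferential_self (W : AmbientBundle ι) (ζ : F × E) :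
    coordsDifferential W W ζ = ζ := chartDifferential_self _ _

theorem continuous_ambient_proj : Continuous (fun W : AmbientBundle ι => W.proj) :=
  FiberBundle.continuous_proj E (ι *ᵖ (TangentSpace 𝓘(ℝ, E) : M → Type _))

theorem eventually_mem_chartDomain {b₀ : B} {W : AmbientBundle ι}
    (hW : W.proj ∈ chartDomain ι b₀) : ∀ᶠ V in 𝓝 W, V.proj ∈ chartDomain ι b₀ :=
  continuous_ambient_proj.continuousAt.eventually ((isOpen_chartDomain b₀).mem_nhds hW)

/-- The differential of `ι`, as a map between model spaces. -/
def dιAt (ι : C^∞⟮𝓘(ℝ, F), B; 𝓘(ℝ, E), M⟯) (b : B) : F →L[ℝ] E := dι ι b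

/-- The differential of the projection, as a map between model spaces. -/
def dπAt (W : AmbientBundle ι) : F × E →L[ℝ] F := dπ ι W

/-- The covariant derivative, as a map between model spaces. -/
def covDerivAt (g : Metric E M) (W : AmbientBundle ι) : F × E →ₗ[ℝ] E := covDeriv g ι W

theorem chartDifferential_dιAt {b₀ b : B} (hb : b ∈ chartDomain ι b₀) (u : F) :
    chartDifferential 𝓘(ℝ, E) (ι b₀) (ι b) (dιAt ι b u) =
      fderiv ℝ (localMap ι b₀) (extChartAt 𝓘(ℝ, F) b₀ b) (chartDifferential 𝓘(ℝ, F) b₀ b u) := by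
  refine chartDifferential_mfderiv hb.1 hb.2 (ι.contMDiff.mdifferentiable (by simp) b)
    ((contDiffAt_localMap hb).differentiableAt (by simp)) ?_ u
  filter_upwards [(isOpen_chartDomain b₀).mem_nhds hb] with z hz
  exact (localMap_apply hz).symm

theorem chartDifferential_dπAt {W₀ W : AmbientBundle ι} (hW : W.proj ∈ chartDomain ι W₀.proj)
    (ζ : F × E) :
    chartDifferential 𝓘(ℝ, F) W₀.proj W.proj (dπAt W ζ) = (coordsDifferential W₀ W ζ).1 := by
  have h := chartDifferential_mfderiv (I := 𝓘(ℝ, F).prod 𝓘(ℝ, E)) (I' := 𝓘(ℝ, F))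
    (f := fun V : AmbientBundle ι => V.proj) (x₀ := W₀) (x := W) (x₀' := W₀.proj)
    (mem_ambient_source_iff.2 hW) hW.1
    ((Bundle.contMDiff_proj (n := ∞) (ι *ᵖ (TangentSpace 𝓘(ℝ, E) : M → Type _))).mdifferentiable
      (by simp) W) (F := Prod.fst) differentiableAt_fst
    (by
      filter_upwards [eventually_mem_chartDomain hW] with V hV
      exact (congrArg Prod.fst (coords_apply hV)).symm) ζ
  refine h.trans ?_
  rw [fderiv_fst]
  rfl

theorem extChartAt_toTangentBundle {W₀ V : AmbientBundle ι}
    (hV : V.proj ∈ chartDomain ι W₀.proj) :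
    extChartAt 𝓘(ℝ, E).tangent (⟨ι W₀.proj, 0⟩ : TangentBundle 𝓘(ℝ, E) M)
      (toTangentBundle ι V) = (localMap ι W₀.proj (coords W₀ V).1, (coords W₀ V).2) := by
  rw [coords_apply hV]
  refine (extChartAt_tangent_apply (Y₀ := (⟨ι W₀.proj, 0⟩ : TangentBundle 𝓘(ℝ, E) M))
    (Z := toTangentBundle ι V) hV.2).trans (Prod.ext ?_ rfl)
  exact (localMap_apply hV).symm

theorem contMDiffAt_coords {W₀ W : AmbientBundle ι} (hW : W.proj ∈ chartDomain ι W₀.proj) :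
    ContMDiffAt (𝓘(ℝ, F).prod 𝓘(ℝ, E)) 𝓘(ℝ, F × E) ∞ (coords W₀) W :=
  contMDiffAt_extChartAt' (by
    rw [← extChartAt_source (𝓘(ℝ, F).prod 𝓘(ℝ, E))]; exact mem_ambient_source_iff.2 hW)

/-- `covDeriv` contains the `mfderiv` of this map, which would be 0 without differentiability. In
charts the map is (y, w) ↦ (c(y), w). -/
theorem mdifferentiableAt_toTangentBundle (W : AmbientBundle ι) :
    MDifferentiableAt (𝓘(ℝ, F).prod 𝓘(ℝ, E)) 𝓘(ℝ, E).tangent (toTangentBundle ι) W := by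
  set Y₀ : TangentBundle 𝓘(ℝ, E) M := ⟨ι W.proj, 0⟩ with Y₀_def
  have hW := mem_chartDomain (ι := ι) W.proj
  have h1 : ContDiffAt ℝ ∞ (fun z : F × E => (localMap ι W.proj z.1, z.2)) (coords W W) := by
    refine (ContDiffAt.comp (g := localMap ι W.proj) (f := Prod.fst) _ ?_
      contDiffAt_fst).prodMk contDiffAt_snd
    rw [coords_apply hW]
    exact contDiffAt_localMap hW
  have h2 : ContMDiffAt (𝓘(ℝ, F).prod 𝓘(ℝ, E)) 𝓘(ℝ, E × E) ∞
      (fun V => (localMap ι W.proj (coords W V).1, (coords W V).2)) W :=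
    h1.contMDiffAt.comp W (contMDiffAt_coords hW)
  have h3 : ContMDiffAt 𝓘(ℝ, E × E) 𝓘(ℝ, E).tangent ∞ (extChartAt 𝓘(ℝ, E).tangent Y₀).symm
      (localMap ι W.proj (coords W W).1, (coords W W).2) := by
    refine (contMDiffOn_extChartAt_symm (I := 𝓘(ℝ, E).tangent) (n := ∞) Y₀).contMDiffAt
      (extChartAt_target_mem_nhds' ?_)
    rw [← extChartAt_toTangentBundle hW]
    exact (extChartAt 𝓘(ℝ, E).tangent Y₀).map_source (mem_tangent_source_iff.2 hW.2)
  refine ((h3.comp W h2).congr_of_eventuallyEq ?_).mdifferentiableAt (by simp)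
  filter_upwards [eventually_mem_chartDomain hW] with V hV
  rw [Function.comp_apply, ← extChartAt_toTangentBundle hV]
  exact ((extChartAt 𝓘(ℝ, E).tangent Y₀).left_inv
    ((mem_tangent_source_iff (Y₀ := Y₀) (Z := toTangentBundle ι V)).2 hV.2)).symm

/-- The definition uses a different chart at every point; this formula in one fixed chart is what
shows smooth dependence on W. -/
theorem chartDifferential_covDerivAt [FiniteDimensional ℝ E] (g : Metric E M)
    {W₀ W : AmbientBundle ι} (hW : W.proj ∈ chartDomain ι W₀.proj) (ζ : F × E) :
    chartDifferential 𝓘(ℝ, E) (ι W₀.proj) (ι W.proj) (covDerivAt g W ζ) =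
      (coordsDifferential W₀ W ζ).2 + christoffelSymbol (chartMetric g (ι W₀.proj))
        (localMap ι W₀.proj (coords W₀ W).1)
        (fderiv ℝ (localMap ι W₀.proj) (coords W₀ W).1 (coordsDifferential W₀ W ζ).1)
        (coords W₀ W).2 := by
  set Y₀ : TangentBundle 𝓘(ℝ, E) M := ⟨ι W₀.proj, 0⟩ with Y₀_def
  set c := localMap ι W₀.proj with c_def
  have hc : ContDiffAt ℝ ∞ c (coords W₀ W).1 := by
    rw [coords_apply hW]
    exact contDiffAt_localMap hW
  have hF : HasFDerivAt (fun z : F × E => (c z.1, z.2))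
      (((fderiv ℝ c (coords W₀ W).1).comp (ContinuousLinearMap.fst ℝ F E)).prod
        (ContinuousLinearMap.snd ℝ F E)) (coords W₀ W) :=
    (HasFDerivAt.comp (f := Prod.fst) (g := c) (coords W₀ W)
      (hc.differentiableAt (by simp)).hasFDerivAt hasFDerivAt_fst).prodMk hasFDerivAt_snd
  have h := chartDifferential_mfderiv (I := 𝓘(ℝ, F).prod 𝓘(ℝ, E)) (I' := 𝓘(ℝ, E).tangent)
    (f := toTangentBundle ι) (x₀ := W₀) (x := W) (x₀' := Y₀)
    (mem_ambient_source_iff.2 hW) (mem_tangent_source_iff.2 hW.2)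
    (mdifferentiableAt_toTangentBundle W) (F := fun z : F × E => (c z.1, z.2))
    hF.differentiableAt
    (by
      filter_upwards [eventually_mem_chartDomain hW] with V hV
      exact extChartAt_toTangentBundle hV) ζ
  have h1 : chartDifferential 𝓘(ℝ, E).tangent Y₀ (toTangentBundle ι W)
      (mfderiv (𝓘(ℝ, F).prod 𝓘(ℝ, E)) 𝓘(ℝ, E).tangent (toTangentBundle ι) W ζ) =
      (fderiv ℝ c (coords W₀ W).1 (coordsDifferential W₀ W ζ).1, (coordsDifferential W₀ W ζ).2) :=
    h.trans (congrArg (fun L : F × E →L[ℝ] E × E => L (coordsDifferential W₀ W ζ)) hF.fderiv)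
  have h2 := chartDifferential_connectorAt g (Y₀ := Y₀) (Y := toTangentBundle ι W) hW.2
    (mfderiv (𝓘(ℝ, F).prod 𝓘(ℝ, E)) 𝓘(ℝ, E).tangent (toTangentBundle ι) W ζ)
  refine h2.trans ?_
  rw [h1, coords_apply hW, c_def, localMap_apply hW]
  rfl

end AmbientChart

/-! ## The unit normal bundle in a fixed chart -/

section UnitNormalBundle

variable {E : Type*} [NormedAddCommGroup E] [NormedSpace ℝ E]
  {M : Type*} [TopologicalSpace M] [ChartedSpace E M] [IsManifold 𝓘(ℝ, E) ∞ M]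
  {F : Type*} [NormedAddCommGroup F] [NormedSpace ℝ F]
  {B : Type*} [TopologicalSpace B] [ChartedSpace F B] [IsManifold 𝓘(ℝ, F) ∞ B]
  {ι : C^∞⟮𝓘(ℝ, F), B; 𝓘(ℝ, E), M⟯}

theorem dπAt_apply (W : AmbientBundle ι) (ζ : F × E) : dπAt W ζ = ζ.1 := by
  have h := chartDifferential_dπAt (mem_chartDomain (ι := ι) W.proj) ζ
  rwa [chartDifferential_self, coordsDifferential_self] at h

theorem hasFDerivAt_coords_comp {X : Type*} [NormedAddCommGroup X] [NormedSpace ℝ X]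
    {P : X → AmbientBundle ι} {x : X} {W₀ : AmbientBundle ι}
    (hP : MDifferentiableAt 𝓘(ℝ, X) (𝓘(ℝ, F).prod 𝓘(ℝ, E)) P x)
    (hx : (P x).proj ∈ chartDomain ι W₀.proj) :
    HasFDerivAt (fun x => coords W₀ (P x))
      ((coordsDifferential W₀ (P x)).comp
        (mfderiv 𝓘(ℝ, X) (𝓘(ℝ, F).prod 𝓘(ℝ, E)) P x : X →L[ℝ] F × E)) x :=
  ((hasMFDerivAt_chart (mem_ambient_source_iff.2 hx)).comp x hP.hasMFDerivAt).hasFDerivAt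

/-- The defining function of the unit normal bundle in the charts at `b₀` and `ι b₀`. -/
def constraint (g : Metric E M) (ι : C^∞⟮𝓘(ℝ, F), B; 𝓘(ℝ, E), M⟯) (b₀ : B) (z : F × E) :
    ℝ × (F →L[ℝ] ℝ) :=
  (chartMetric g (ι b₀) (localMap ι b₀ z.1) z.2 z.2,
    (chartMetric g (ι b₀) (localMap ι b₀ z.1) z.2).comp (fderiv ℝ (localMap ι b₀) z.1))

theorem mem_unitNormalBundle_iff_constraint (g : Metric E M) {W₀ W : AmbientBundle ι}
    (hW : W.proj ∈ chartDomain ι W₀.proj) :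
    W ∈ unitNormalBundle g ι ↔ constraint g ι W₀.proj (coords W₀ W) = (1, 0) := by
  have h1 : W ∈ unitNormalBundle g ι ↔ innerAt g (ι W.proj) (ambientVec W) (ambientVec W) = 1 ∧
      ∀ u, innerAt g (ι W.proj) (ambientVec W) (dιAt ι W.proj u) = 0 := Iff.rfl
  rw [h1, constraint, Prod.mk.injEq, coords_apply hW, localMap_apply hW,
    inner_eq_chartMetric g hW.2]
  refine and_congr Iff.rfl ⟨fun h => ?_, fun h u => ?_⟩
  · ext v
    obtain ⟨u, rfl⟩ := chartDifferential_surjective hW.1 v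
    have h2 := h u
    rw [inner_eq_chartMetric g hW.2, chartDifferential_dιAt hW] at h2
    exact h2
  · rw [inner_eq_chartMetric g hW.2, chartDifferential_dιAt hW]
    exact congrArg (fun L : F →L[ℝ] ℝ => L (chartDifferential 𝓘(ℝ, F) W₀.proj W.proj u)) h

variable (ι) in
/-- The domain of the map `ι` in the charts at `b₀` and `ι b₀`. -/
def localDomain (b₀ : B) : Set F :=
  (extChartAt 𝓘(ℝ, F) b₀).target ∩ (extChartAt 𝓘(ℝ, F) b₀).symm ⁻¹' chartDomain ι b₀

theorem mem_localDomain {b₀ b : B} (hb : b ∈ chartDomain ι b₀) :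
    extChartAt 𝓘(ℝ, F) b₀ b ∈ localDomain ι b₀ := by
  refine ⟨(extChartAt 𝓘(ℝ, F) b₀).map_source hb.1, ?_⟩
  rwa [mem_preimage, (extChartAt 𝓘(ℝ, F) b₀).left_inv hb.1]

theorem coords_fst_mem {W₀ W : AmbientBundle ι} (hW : W.proj ∈ chartDomain ι W₀.proj) :
    (coords W₀ W).1 ∈ localDomain ι W₀.proj := by
  rw [coords_apply hW]
  exact mem_localDomain hW

theorem exists_of_mem_localDomain {b₀ : B} {y : F} (hy : y ∈ localDomain ι b₀) :
    ∃ b ∈ chartDomain ι b₀, extChartAt 𝓘(ℝ, F) b₀ b = y :=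
  ⟨_, hy.2, (extChartAt 𝓘(ℝ, F) b₀).right_inv hy.1⟩

theorem isOpen_localDomain (b₀ : B) : IsOpen (localDomain ι b₀) :=
  (continuousOn_extChartAt_symm b₀).isOpen_inter_preimage (isOpen_extChartAt_target b₀)
    (isOpen_chartDomain b₀)

theorem localMap_mem_target {b₀ : B} {y : F} (hy : y ∈ localDomain ι b₀) :
    localMap ι b₀ y ∈ (extChartAt 𝓘(ℝ, E) (ι b₀)).target := by
  obtain ⟨b, hb, rfl⟩ := exists_of_mem_localDomain hy
  rw [localMap_apply hb]
  exact (extChartAt 𝓘(ℝ, E) (ι b₀)).map_source hb.2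

theorem contDiffAt_localMap_of_mem {b₀ : B} {y : F} (hy : y ∈ localDomain ι b₀) :
    ContDiffAt ℝ ∞ (localMap ι b₀) y := by
  obtain ⟨b, hb, rfl⟩ := exists_of_mem_localDomain hy
  exact contDiffAt_localMap hb

variable [FiniteDimensional ℝ E]

/-- The derivative of the defining function of the unit normal bundle. -/
theorem hasFDerivAt_constraint (g : Metric E M) {b₀ : B} {z : F × E}
    (hz : z.1 ∈ localDomain ι b₀) :
    ∃ L : F × E →L[ℝ] ℝ × (F →L[ℝ] ℝ), HasFDerivAt (constraint g ι b₀) L z ∧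
      ∀ ζ : F × E, (L ζ).1 = 2 * chartMetric g (ι b₀) (localMap ι b₀ z.1)
        (ζ.2 + christoffelSymbol (chartMetric g (ι b₀)) (localMap ι b₀ z.1)
          (fderiv ℝ (localMap ι b₀) z.1 ζ.1) z.2) z.2 ∧
        ∀ v, (L ζ).2 v = chartMetric g (ι b₀) (localMap ι b₀ z.1)
          (ζ.2 + christoffelSymbol (chartMetric g (ι b₀)) (localMap ι b₀ z.1)
            (fderiv ℝ (localMap ι b₀) z.1 ζ.1) z.2) (fderiv ℝ (localMap ι b₀) z.1 v) +
          chartMetric g (ι b₀) (localMap ι b₀ z.1)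
            (fderiv ℝ (fderiv ℝ (localMap ι b₀)) z.1 ζ.1 v +
              christoffelSymbol (chartMetric g (ι b₀)) (localMap ι b₀ z.1)
                (fderiv ℝ (localMap ι b₀) z.1 ζ.1) (fderiv ℝ (localMap ι b₀) z.1 v)) z.2 := by
  set G := chartMetric g (ι b₀) with G_def
  set c := localMap ι b₀ with c_def
  have hG : IsMetricOn G (extChartAt 𝓘(ℝ, E) (ι b₀)).target := isMetricOn_chartMetric g (ι b₀)
  have hU := localMap_mem_target hz
  have hc := contDiffAt_localMap_of_mem hz
  have h1 : HasFDerivAt (fun z : F × E => c z.1)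
      ((fderiv ℝ c z.1).comp (ContinuousLinearMap.fst ℝ F E)) z :=
    HasFDerivAt.comp (f := Prod.fst) (g := c) z (hc.differentiableAt (by simp)).hasFDerivAt
      hasFDerivAt_fst
  have h2 : HasFDerivAt (fun z : F × E => fderiv ℝ c z.1)
      ((fderiv ℝ (fderiv ℝ c) z.1).comp (ContinuousLinearMap.fst ℝ F E)) z :=
    HasFDerivAt.comp (f := Prod.fst) (g := fderiv ℝ c) z
      ((hc.fderiv_right (m := ∞) (by simp)).differentiableAt (by simp)).hasFDerivAt
      hasFDerivAt_fst
  have h3 : HasFDerivAt (fun z : F × E => G (c z.1))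
      ((fderiv ℝ G (c z.1)).comp ((fderiv ℝ c z.1).comp (ContinuousLinearMap.fst ℝ F E))) z :=
    HasFDerivAt.comp (g := G) (f := fun z : F × E => c z.1) z (hG.hasFDerivAt hU) h1
  have h4 : HasFDerivAt (fun z : F × E => G (c z.1) z.2)
      ((G (c z.1)).comp (ContinuousLinearMap.snd ℝ F E) +
        ((fderiv ℝ G (c z.1)).comp
          ((fderiv ℝ c z.1).comp (ContinuousLinearMap.fst ℝ F E))).flip z.2) z :=
    h3.clm_apply hasFDerivAt_snd
  have h5 := h4.clm_apply (hasFDerivAt_snd (p := z))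
  have h6 := h4.clm_comp h2
  refine ⟨_, h5.prodMk h6, fun ζ => ⟨?_, fun v => ?_⟩⟩
  · simp only [ContinuousLinearMap.prod_apply, add_apply, ContinuousLinearMap.comp_apply,
      ContinuousLinearMap.flip_apply, ContinuousLinearMap.coe_fst', ContinuousLinearMap.coe_snd']
    rw [hG.fderiv_apply hU, hG.symm _ hU z.2 ζ.2, hG.symm _ hU z.2 (christoffelSymbol _ _ _ _),
      map_add, add_apply]
    ring
  · simp only [ContinuousLinearMap.prod_apply, add_apply, ContinuousLinearMap.comp_apply,
      ContinuousLinearMap.flip_apply, ContinuousLinearMap.coe_fst', ContinuousLinearMap.coe_snd',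
      ContinuousLinearMap.compL_apply]
    rw [hG.fderiv_apply hU, map_add, add_apply, map_add, add_apply,
      hG.symm _ hU z.2 (christoffelSymbol _ _ _ _),
      hG.symm _ hU z.2 (fderiv ℝ (fderiv ℝ c) z.1 ζ.1 v)]
    ring

/-- Along a curve in S(νB) the defining function is constantly (1, 0), so velocities lie in the
kernel of its derivative. This inclusion suffices: neither the converse nor a manifold structure on
S(νB) is needed. -/
theorem constraint_of_mem_tangentVectors (g : Metric E M) {W₀ W : AmbientBundle ι}
    (hW : W.proj ∈ chartDomain ι W₀.proj) {ζ : F × E}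
    (hζ : ζ ∈ tangentVectors ι (unitNormalBundle g ι) W) :
    fderiv ℝ (constraint g ι W₀.proj) (coords W₀ W) (coordsDifferential W₀ W ζ) = 0 := by
  obtain ⟨γ, hγ, hN, h⟩ := hζ
  cases h
  have hd := hasFDerivAt_coords_comp (W₀ := W₀) (hγ.mdifferentiable (by simp) 0) hW
  obtain ⟨L, hL, -⟩ := hasFDerivAt_constraint g (coords_fst_mem hW)
  have h1 := HasFDerivAt.comp (f := fun t => coords W₀ (γ t)) (0 : ℝ) hL hd
  have h2 : (fun t : ℝ => ((1 : ℝ), (0 : F →L[ℝ] ℝ))) =ᶠ[𝓝 0]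
      constraint g ι W₀.proj ∘ fun t => coords W₀ (γ t) := by
    have h3 : ∀ᶠ t in 𝓝 (0 : ℝ), (γ t).proj ∈ chartDomain ι W₀.proj :=
      hγ.continuous.continuousAt.eventually (eventually_mem_chartDomain hW)
    filter_upwards [h3] with t ht
    exact ((mem_unitNormalBundle_iff_constraint g ht).1 (hN t)).symm
  have h3 := (h1.congr_of_eventuallyEq h2).unique (hasFDerivAt_const _ _)
  rw [hL.fderiv]
  exact congrArg (fun A : ℝ →L[ℝ] ℝ × (F →L[ℝ] ℝ) => A 1) h3

/-- The differential of a map to the unit normal bundle takes values in the tangent vectors. -/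
theorem mfderiv_mem_tangentVectors {X : Type*} [NormedAddCommGroup X] [NormedSpace ℝ X]
    {N : Set (AmbientBundle ι)} {O : Set X} {P : X → AmbientBundle ι} (hO : IsOpen O)
    (hP : ContMDiffOn 𝓘(ℝ, X) (𝓘(ℝ, F).prod 𝓘(ℝ, E)) ∞ P O) (hN : ∀ x ∈ O, P x ∈ N) {x : X}
    (hx : x ∈ O) (e : X) :
    (mfderiv 𝓘(ℝ, X) (𝓘(ℝ, F).prod 𝓘(ℝ, E)) P x : X →L[ℝ] F × E) e ∈ tangentVectors ι N (P x) := by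
  obtain ⟨δ, hδ, hball⟩ := Metric.isOpen_iff.1 hO x hx
  set ρ : ℝ := δ / (2 * (‖e‖ + 1)) with ρ_def
  have hρ : 0 < ρ := by positivity
  -- Tangent vectors are velocities of curves defined on all of ℝ. The sine keeps the curve within δ
  -- / 2 of x, hence in O, and makes its velocity at 0 equal to e.
  set σ : ℝ → X := fun t => x + (ρ * Real.sin (t / ρ)) • e with σ_def
  have hσ : ContDiff ℝ ∞ σ := by
    have : ContDiff ℝ ∞ (fun t : ℝ => ρ * Real.sin (t / ρ)) :=
      contDiff_const.mul (Real.contDiff_sin.comp (contDiff_id.div_const _))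
    exact contDiff_const.add (this.smul contDiff_const)
  have hσO : ∀ t, σ t ∈ O := by
    intro t
    refine hball ?_
    rw [Metric.mem_ball, dist_eq_norm, σ_def]
    simp only [add_sub_cancel_left]
    rw [norm_smul, norm_mul, Real.norm_eq_abs, Real.norm_eq_abs, abs_of_pos hρ]
    have h1 : |Real.sin (t / ρ)| ≤ 1 := Real.abs_sin_le_one _
    have h2 : ρ * |Real.sin (t / ρ)| * ‖e‖ ≤ ρ * (‖e‖ + 1) := by
      have := mul_le_mul_of_nonneg_left h1 hρ.le
      have h3 : 0 ≤ ρ * |Real.sin (t / ρ)| := by positivity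
      nlinarith [norm_nonneg e]
    have h3 : ρ * (‖e‖ + 1) = δ / 2 := by
      rw [ρ_def]; field_simp
    linarith
  have hσ0 : σ 0 = x := by simp [σ_def]
  have hσ' : HasDerivAt σ e 0 := by
    have h1 : HasDerivAt (fun t : ℝ => t / ρ) (1 / ρ) 0 := (hasDerivAt_id _).div_const _
    have h2 : HasDerivAt (fun t : ℝ => ρ * Real.sin (t / ρ))
        (ρ * (Real.cos (0 / ρ) * (1 / ρ))) 0 := (h1.sin).const_mul ρ
    have h3 := (h2.smul_const e).const_add x
    have h4 : ρ * (Real.cos (0 / ρ) * (1 / ρ)) = 1 := by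
      rw [zero_div, Real.cos_zero]; field_simp
    rwa [h4, one_smul] at h3
  have hPσ : ContMDiff 𝓘(ℝ, ℝ) (𝓘(ℝ, F).prod 𝓘(ℝ, E)) ∞ (P ∘ σ) := by
    intro t
    exact (hP.contMDiffAt (hO.mem_nhds (hσO t))).comp t hσ.contMDiff.contMDiffAt
  have hP' : HasMFDerivAt 𝓘(ℝ, X) (𝓘(ℝ, F).prod 𝓘(ℝ, E)) P (σ 0)
      (mfderiv 𝓘(ℝ, X) (𝓘(ℝ, F).prod 𝓘(ℝ, E)) P (σ 0)) := by
    rw [hσ0]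
    exact ((hP.contMDiffAt (hO.mem_nhds hx)).mdifferentiableAt (by simp)).hasMFDerivAt
  have h := (hP'.comp (0 : ℝ) hσ'.hasFDerivAt.hasMFDerivAt).mfderiv
  have key : ∀ x', x' = x → (⟨P x, (mfderiv 𝓘(ℝ, X) (𝓘(ℝ, F).prod 𝓘(ℝ, E)) P x : X →L[ℝ] F × E) e⟩ :
      TangentBundle (𝓘(ℝ, F).prod 𝓘(ℝ, E)) (AmbientBundle ι)) =
      ⟨P x', (mfderiv 𝓘(ℝ, X) (𝓘(ℝ, F).prod 𝓘(ℝ, E)) P x' : X →L[ℝ] F × E) e⟩ := by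
    rintro x' rfl; rfl
  refine ⟨P ∘ σ, hPσ, fun t => hN _ (hσO t), (key _ hσ0).trans ?_⟩
  have h6 : (mfderiv 𝓘(ℝ, ℝ) (𝓘(ℝ, F).prod 𝓘(ℝ, E)) (P ∘ σ) 0 : ℝ →L[ℝ] F × E) 1 =
      (mfderiv 𝓘(ℝ, X) (𝓘(ℝ, F).prod 𝓘(ℝ, E)) P (σ 0) : X →L[ℝ] F × E) e := by
    refine (congrArg (fun A : ℝ →L[ℝ] F × E => A 1) h).trans ?_
    change (mfderiv 𝓘(ℝ, X) (𝓘(ℝ, F).prod 𝓘(ℝ, E)) P (σ 0) : X →L[ℝ] F × E)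
      (ContinuousLinearMap.toSpanSingleton ℝ e 1) = _
    rw [ContinuousLinearMap.toSpanSingleton_apply, one_smul]
  change (⟨P (σ 0), _⟩ : TangentBundle (𝓘(ℝ, F).prod 𝓘(ℝ, E)) (AmbientBundle ι)) = ⟨P (σ 0), _⟩
  congr 1
  exact h6.symm

/-- The relations satisfied by the tangent vectors of the unit normal bundle, in a fixed chart. -/
theorem chart_relations (g : Metric E M) {W₀ W : AmbientBundle ι}
    (hW : W.proj ∈ chartDomain ι W₀.proj) {ζ : F × E}
    (hζ : ζ ∈ tangentVectors ι (unitNormalBundle g ι) W) :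
    innerAt g (ι W.proj) (covDerivAt g W ζ) (ambientVec W) = 0 ∧
    ∀ v, innerAt g (ι W.proj) (covDerivAt g W ζ) (dιAt ι W.proj v) =
      -chartMetric g (ι W₀.proj) (localMap ι W₀.proj (coords W₀ W).1)
            (fderiv ℝ (fderiv ℝ (localMap ι W₀.proj)) (coords W₀ W).1
              (coordsDifferential W₀ W ζ).1 (chartDifferential 𝓘(ℝ, F) W₀.proj W.proj v) +
              christoffelSymbol (chartMetric g (ι W₀.proj)) (localMap ι W₀.proj (coords W₀ W).1)
                (fderiv ℝ (localMap ι W₀.proj) (coords W₀ W).1 (coordsDifferential W₀ W ζ).1)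
                (fderiv ℝ (localMap ι W₀.proj) (coords W₀ W).1
                  (chartDifferential 𝓘(ℝ, F) W₀.proj W.proj v))) (coords W₀ W).2 := by
  have h0 := constraint_of_mem_tangentVectors g hW hζ
  obtain ⟨L, hL, hL'⟩ := hasFDerivAt_constraint g (coords_fst_mem hW)
  rw [hL.fderiv] at h0
  obtain ⟨h1, h2⟩ := hL' (coordsDifferential W₀ W ζ)
  rw [h0] at h1 h2
  have hy : extChartAt 𝓘(ℝ, F) W₀.proj W.proj = (coords W₀ W).1 := by rw [coords_apply hW]
  have hw : chartDifferential 𝓘(ℝ, E) (ι W₀.proj) (ι W.proj) (ambientVec W) =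
    (coords W₀ W).2 := by rw [coords_apply hW]
  have hc : extChartAt 𝓘(ℝ, E) (ι W₀.proj) (ι W.proj) =
    localMap ι W₀.proj (coords W₀ W).1 := by rw [← hy, localMap_apply hW]
  constructor
  · rw [inner_eq_chartMetric g hW.2, chartDifferential_covDerivAt g hW, hw, hc]
    have h1 : (0 : ℝ) = _ := h1
    linarith
  · intro v
    rw [inner_eq_chartMetric g hW.2, chartDifferential_covDerivAt g hW,
      chartDifferential_dιAt hW, hy, hc]
    have h3 : (0 : ℝ) = _ := h2 (chartDifferential 𝓘(ℝ, F) W₀.proj W.proj v)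
    linarith

end UnitNormalBundle

/-! ## The normal connection and the second fundamental form -/

section NormalConnection

variable {E : Type*} [NormedAddCommGroup E] [NormedSpace ℝ E]
  {M : Type*} [TopologicalSpace M] [ChartedSpace E M] [IsManifold 𝓘(ℝ, E) ∞ M]
  {F : Type*} [NormedAddCommGroup F] [NormedSpace ℝ F]
  {B : Type*} [TopologicalSpace B] [ChartedSpace F B] [IsManifold 𝓘(ℝ, F) ∞ B]
  {ι : C^∞⟮𝓘(ℝ, F), B; 𝓘(ℝ, E), M⟯}

theorem eq_zero_of_innerAt_self (g : Metric E M) (x : M) {v : E} (hv : innerAt g x v v = 0) :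
    v = 0 := by
  by_contra h
  exact (innerAt_self_pos g x h).ne' hv

theorem innerAt_self_nonneg (g : Metric E M) (x : M) (v : E) : 0 ≤ innerAt g x v v := by
  by_cases h : v = 0
  · rw [h, map_zero]
  · exact (innerAt_self_pos g x h).le

/-- The second fundamental form, as a form on the model space. -/
def secondAt (g : Metric E M) (W : AmbientBundle ι) : F →ₗ[ℝ] F →ₗ[ℝ] ℝ :=
  secondFundamentalForm g ι W

theorem secondAt_apply (g : Metric E M) (W : AmbientBundle ι) (u v : F) :
    secondAt g W u v = innerAt g (ι W.proj) (fderiv ℝ (fderiv ℝ (localMap ι W.proj))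
      (extChartAt 𝓘(ℝ, F) W.proj W.proj) u v +
      christoffel g (ι W.proj) (dιAt ι W.proj u) (dιAt ι W.proj v)) (ambientVec W) := rfl

theorem fderiv_localMap_self (b : B) (u : F) :
    fderiv ℝ (localMap ι b) (extChartAt 𝓘(ℝ, F) b b) u = dιAt ι b u := by
  have h := chartDifferential_dιAt (mem_chartDomain (ι := ι) b) u
  rw [chartDifferential_self, chartDifferential_self] at h
  exact h.symm

theorem chartMetric_self (g : Metric E M) (x : M) (u v : E) :
    chartMetric g x (extChartAt 𝓘(ℝ, E) x x) u v = innerAt g x u v := by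
  rw [inner_eq_chartMetric g (mem_extChartAt_source x), chartDifferential_self,
    chartDifferential_self]

/-- The normal projection, as a map between model spaces. -/
def normalAt (g : Metric E M) (ι : C^∞⟮𝓘(ℝ, F), B; 𝓘(ℝ, E), M⟯) (b : B) : E →ₗ[ℝ] E :=
  normalPart g ι b

/-- The covariant derivative of the normal connection, as a map between model spaces. -/
def normalCovDerivAt (g : Metric E M) (W : AmbientBundle ι) : F × E →ₗ[ℝ] E :=
  normalAt g ι W.proj ∘ₗ covDerivAt g W

/-- For an injective differential the Gram form is positive definite, so the `inverse` in the
definition of the projection is a true inverse. -/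
theorem exists_eq_normalAt_add [FiniteDimensional ℝ F] (g : Metric E M)
    {b : B} (hinj : Function.Injective (dιAt ι b)) (a : E) :
    (∃ t, a = normalAt g ι b a + dιAt ι b t) ∧
      ∀ u, innerAt g (ι b) (normalAt g ι b a) (dιAt ι b u) = 0 := by
  set G := innerAt g (ι b) with G_def
  set D := dιAt ι b with D_def
  -- The single form is treated as a constant metric on F so that `IsMetricOn.apply_inverse` can be
  -- used.
  have hgram : IsMetricOn (fun _ : F => G.bilinearComp D D) univ :=
    ⟨isOpen_univ, contDiffOn_const, fun _ _ v w => innerAt_symm g _ _ _, fun _ _ v hv =>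
      innerAt_self_pos g _ fun h => hv (hinj (h.trans (map_zero _).symm))⟩
  set t : F := (G.bilinearComp D D).inverse ((G.bilinearComp (ContinuousLinearMap.id ℝ E) D) a)
    with t_def
  have ht : ∀ u, G (D t) (D u) = G a (D u) := fun u =>
    congrArg (fun L : F →L[ℝ] ℝ => L u) (hgram.apply_inverse (mem_univ (0 : F)) _)
  have hn : normalAt g ι b a = a - D t := rfl
  refine ⟨⟨t, by rw [hn, sub_add_cancel]⟩, fun u => ?_⟩
  rw [hn, map_sub, sub_apply, ht, sub_self]

theorem normalAt_eq [FiniteDimensional ℝ F] (g : Metric E M)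
    {b : B} (hinj : Function.Injective (dιAt ι b)) {a n : E} {t : F} (h : a = n + dιAt ι b t)
    (hn : ∀ u, innerAt g (ι b) n (dιAt ι b u) = 0) : normalAt g ι b a = n := by
  obtain ⟨⟨s, hs⟩, hs'⟩ := exists_eq_normalAt_add g hinj a
  have h1 : normalAt g ι b a - n = dιAt ι b (t - s) := by
    rw [map_sub, sub_eq_sub_iff_add_eq_add, ← hs, h, add_comm]
  rw [← sub_eq_zero]
  refine eq_zero_of_innerAt_self g (ι b) ?_
  nth_rewrite 2 [h1]
  rw [map_sub, sub_apply, hs', hn, sub_self]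

theorem normalAt_self [FiniteDimensional ℝ F] (g : Metric E M)
    {b : B} (hinj : Function.Injective (dιAt ι b)) {n : E}
    (hn : ∀ u, innerAt g (ι b) n (dιAt ι b u) = 0) : normalAt g ι b n = n :=
  normalAt_eq g hinj (t := 0) (by rw [map_zero, add_zero]) hn

/-- The endomorphism scaling the vertical component, as a map between model spaces. -/
def scaleAt (g : Metric E M) (s : ℝ) (W : AmbientBundle ι) (X : ℝ × F × E) : ℝ × F × E :=
  (X.1, X.2.1, X.2.2 + (s - 1) • normalCovDerivAt g W X.2)

theorem scaleVertical_eq (g : Metric E M) (s : ℝ) (W : AmbientBundle ι) (X : ℝ × F × E) :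
    scaleVertical g ι s W X = scaleAt g s W X := by
  have h : scaleVertical g ι s W X = X + (s - 1) • ((0, 0, normalCovDerivAt g W X.2) :
    ℝ × F × E) := rfl
  rw [h, scaleAt]
  ext <;> simp

variable [FiniteDimensional ℝ E]

theorem covDerivAt_apply (g : Metric E M) (W : AmbientBundle ι) (ζ : F × E) :
    covDerivAt g W ζ = ζ.2 + christoffel g (ι W.proj) (dιAt ι W.proj ζ.1) (ambientVec W) := by
  have hW := mem_chartDomain (ι := ι) W.proj
  have h := chartDifferential_covDerivAt g hW ζ
  rw [chartDifferential_self, coordsDifferential_self, coords_self, localMap_apply hW,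
    fderiv_localMap_self] at h
  exact h

/-- The covariant derivative of an added vertical vector is that vector, and the normal projection
fixes normal vectors, so the vertical part n becomes n + (s - 1) n. -/
theorem normalCovDerivAt_scaleAt [FiniteDimensional ℝ F] (g : Metric E M) {W : AmbientBundle ι}
    (hinj : Function.Injective (dιAt ι W.proj)) (s : ℝ) (X : ℝ × F × E) :
    normalCovDerivAt g W (scaleAt g s W X).2 = s • normalCovDerivAt g W X.2 := by
  set n := normalCovDerivAt g W X.2 with n_def
  have h1 : covDerivAt g W (scaleAt g s W X).2 = covDerivAt g W X.2 + (s - 1) • n := by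
    rw [covDerivAt_apply, covDerivAt_apply, scaleAt]
    exact add_right_comm _ _ _
  have h2 : normalAt g ι W.proj n = n :=
    normalAt_self g hinj (exists_eq_normalAt_add g hinj _).2
  rw [normalCovDerivAt, LinearMap.comp_apply, h1, map_add, map_smul, h2]
  change n + (s - 1) • n = s • n
  rw [sub_smul, one_smul]; abel

/-- The model metric with correction term, after rescaling the vertical vectors. -/
theorem twist_correctedModelMetric [FiniteDimensional ℝ F] (g : Metric E M) {W : AmbientBundle ι}
    (hinj : Function.Injective (dιAt ι W.proj)) {r : ℝ} (hr : r ≠ 0) (X Y : ℝ × F × E) :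
    twist g ι (correctedModelMetric g ι) r W X Y = X.1 * Y.1 +
      innerAt g (ι W.proj) (normalCovDerivAt g W X.2) (normalCovDerivAt g W Y.2) +
      innerAt g (ι W.proj) (dιAt ι W.proj X.2.1) (dιAt ι W.proj Y.2.1) -
      2 * r * secondAt g W X.2.1 Y.2.1 := by
  have h1 : ∀ X Y : ℝ × F × E, correctedModelMetric g ι r W X Y = X.1 * Y.1 + r ^ 2 *
      innerAt g (ι W.proj) (normalCovDerivAt g W X.2) (normalCovDerivAt g W Y.2) +
      innerAt g (ι W.proj) (dιAt ι W.proj (dπAt W X.2)) (dιAt ι W.proj (dπAt W Y.2)) -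
      2 * r * secondAt g W (dπAt W X.2) (dπAt W Y.2) := fun X Y => rfl
  have h2 : twist g ι (correctedModelMetric g ι) r W X Y =
    correctedModelMetric g ι r W (scaleVertical g ι r⁻¹ W X) (scaleVertical g ι r⁻¹ W Y) := rfl
  rw [h2, scaleVertical_eq, scaleVertical_eq, h1, normalCovDerivAt_scaleAt g hinj,
    normalCovDerivAt_scaleAt g hinj, dπAt_apply, dπAt_apply, map_smul, map_smul, smul_apply,
    smul_eq_mul, smul_eq_mul, scaleAt, scaleAt]
  field_simp

theorem twist_modelMetric [FiniteDimensional ℝ F] (g : Metric E M) {W : AmbientBundle ι}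
    (hinj : Function.Injective (dιAt ι W.proj)) {r : ℝ} (hr : r ≠ 0) (X Y : ℝ × F × E) :
    twist g ι (modelMetric g ι) r W X Y = X.1 * Y.1 +
      innerAt g (ι W.proj) (normalCovDerivAt g W X.2) (normalCovDerivAt g W Y.2) +
      innerAt g (ι W.proj) (dιAt ι W.proj X.2.1) (dιAt ι W.proj Y.2.1) := by
  have h1 : ∀ X Y : ℝ × F × E, modelMetric g ι r W X Y = X.1 * Y.1 + r ^ 2 *
      innerAt g (ι W.proj) (normalCovDerivAt g W X.2) (normalCovDerivAt g W Y.2) +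
      innerAt g (ι W.proj) (dιAt ι W.proj (dπAt W X.2)) (dιAt ι W.proj (dπAt W Y.2)) :=
    fun X Y => rfl
  have h2 : twist g ι (modelMetric g ι) r W X Y =
    modelMetric g ι r W (scaleVertical g ι r⁻¹ W X) (scaleVertical g ι r⁻¹ W Y) := rfl
  rw [h2, scaleVertical_eq, scaleVertical_eq, h1, normalCovDerivAt_scaleAt g hinj,
    normalCovDerivAt_scaleAt g hinj, dπAt_apply, dπAt_apply, map_smul, map_smul, smul_apply,
    smul_eq_mul, smul_eq_mul, scaleAt, scaleAt]
  field_simp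

theorem secondAt_symm (g : Metric E M) (W : AmbientBundle ι) (u v : F) :
    secondAt g W u v = secondAt g W v u := by
  have hc : ContDiffAt ℝ ∞ (localMap ι W.proj) (extChartAt 𝓘(ℝ, F) W.proj W.proj) :=
    contDiffAt_localMap (mem_chartDomain W.proj)
  have h1 := hc.isSymmSndFDerivAt minSmoothness_two_le_infty u v
  rw [secondAt_apply, secondAt_apply, h1, christoffel_eq,
    (isMetricOn_chartMetric g (ι W.proj)).christoffelSymbol_symm (mem_extChartAt_target _)]

/-- Vectors tangent to the unit normal bundle: the part of the covariant derivative tangent to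
`B` is given by the second fundamental form. -/
theorem innerAt_covDerivAt (g : Metric E M) {W : AmbientBundle ι} {ζ : F × E}
    (hζ : ζ ∈ tangentVectors ι (unitNormalBundle g ι) W) :
    innerAt g (ι W.proj) (covDerivAt g W ζ) (ambientVec W) = 0 ∧
    ∀ v, innerAt g (ι W.proj) (covDerivAt g W ζ) (dιAt ι W.proj v) = -secondAt g W ζ.1 v := by
  have hW := mem_chartDomain (ι := ι) W.proj
  obtain ⟨h1, h2⟩ := chart_relations g hW hζ
  refine ⟨h1, fun v => ?_⟩
  rw [h2 v, coords_self, coordsDifferential_self, chartDifferential_self, localMap_apply hW,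
    fderiv_localMap_self, fderiv_localMap_self, chartMetric_self, secondAt_apply]
  rfl

theorem innerAt_of_mem (g : Metric E M) {W : AmbientBundle ι} (hW : W ∈ unitNormalBundle g ι) :
    innerAt g (ι W.proj) (ambientVec W) (ambientVec W) = 1 ∧
      ∀ u, innerAt g (ι W.proj) (ambientVec W) (dιAt ι W.proj u) = 0 := hW

theorem mem_of_tangentVectors {N : Set (AmbientBundle ι)} {W : AmbientBundle ι} {ζ : F × E}
    (hζ : ζ ∈ tangentVectors ι N W) : W ∈ N := by
  obtain ⟨γ, -, hN, h⟩ := hζ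
  cases h
  exact hN 0

end NormalConnection

/-! ## The normal exponential map in a fixed chart -/

section BlowDown

variable {E : Type*} [NormedAddCommGroup E] [NormedSpace ℝ E]
  {M : Type*} [TopologicalSpace M] [ChartedSpace E M] [IsManifold 𝓘(ℝ, E) ∞ M]
  {F : Type*} [NormedAddCommGroup F] [NormedSpace ℝ F]
  {B : Type*} [TopologicalSpace B] [ChartedSpace F B] [IsManifold 𝓘(ℝ, F) ∞ B]
  {ι : C^∞⟮𝓘(ℝ, F), B; 𝓘(ℝ, E), M⟯}

/-- In the charts of the immersion normal form ι is u ↦ (u, 0). Projecting and returning through the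
chart of B gives a smooth local left inverse of ι, and the chain rule a left inverse of its
differential. -/
theorem injective_dιAt (hι : Manifold.IsImmersion 𝓘(ℝ, F) 𝓘(ℝ, E) ∞ ι) (b : B) :
    Function.Injective (dιAt ι b) := by
  have h := hι.isImmersionAt b
  set e := h.domChart.extend 𝓘(ℝ, F) with e_def
  set e' := h.codChart.extend 𝓘(ℝ, E) with e'_def
  have hb : b ∈ e.source := by rw [e_def, OpenPartialHomeomorph.extend_source]; exact h.mem_domChart_source
  have hleft : ∀ᶠ z in 𝓝 b, e.symm (h.equiv.symm (e' (ι z))).1 = z := by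
    filter_upwards [h.domChart.open_source.mem_nhds h.mem_domChart_source] with z hz
    have hz' : z ∈ e.source := by rw [e_def, OpenPartialHomeomorph.extend_source]; exact hz
    have h1 := h.writtenInCharts (e.map_source hz')
    simp only [Function.comp_apply] at h1
    rw [e.left_inv hz'] at h1
    rw [h1, ContinuousLinearEquiv.symm_apply_apply, e.left_inv hz']
  have h1 : ContMDiffAt 𝓘(ℝ, E) 𝓘(ℝ, E) ∞ e' (ι b) :=
    contMDiffAt_of_mem_maximalAtlas h.codChart_mem_maximalAtlas h.mem_codChart_source
  have h2 : ContMDiffAt 𝓘(ℝ, E) 𝓘(ℝ, F) ∞ (fun v => (h.equiv.symm v).1) (e' (ι b)) :=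
    ((ContinuousLinearMap.fst ℝ F _).contDiff.comp h.equiv.symm.contDiff).contMDiff.contMDiffAt
  have h3 : ContMDiffAt 𝓘(ℝ, F) 𝓘(ℝ, F) ∞ e.symm (h.equiv.symm (e' (ι b))).1 := by
    have h4 := h.writtenInCharts (e.map_source hb)
    simp only [Function.comp_apply] at h4
    rw [e.left_inv hb] at h4
    rw [h4, ContinuousLinearEquiv.symm_apply_apply]
    refine (contMDiffOn_extend_symm h.domChart_mem_maximalAtlas).contMDiffAt ?_
    rw [ModelWithCorners.image_eq]
    simp only [modelWithCornersSelf_coe_symm, preimage_id, ModelWithCorners.range_eq_univ, inter_univ]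
    exact h.domChart.open_target.mem_nhds (h.domChart.map_source h.mem_domChart_source)
  have h5 := (h3.comp (ι b) (h2.comp (ι b) h1))
  have h6 := ((h5.mdifferentiableAt (by simp)).hasMFDerivAt).comp b
    (ι.contMDiff.mdifferentiable (by simp) b).hasMFDerivAt
  have h7 := hasMFDerivAt_unique h6 ((hasMFDerivAt_id b).congr_of_eventuallyEq hleft)
  refine fun u v huv => ?_
  have h8 : ∀ u : F, (mfderiv 𝓘(ℝ, E) 𝓘(ℝ, F)
    (e.symm ∘ (fun v => (h.equiv.symm v).1) ∘ e') (ι b) : E →L[ℝ] F) (dιAt ι b u) = u := fun u =>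
    congrArg (fun L : F →L[ℝ] F => L u) h7
  rw [← h8 u, huv, h8 v]

/-- The differential of the normal exponential map, as a map between model spaces. -/
def dBlowDownAt (g : Metric E M) (r : ℝ) (W : AmbientBundle ι) : ℝ × F × E →ₗ[ℝ] E :=
  dBlowDown g ι r W

/-- The coordinates on `ℝ × TM|_B`. -/
def collarCoords (W₀ : AmbientBundle ι) (q : ℝ × AmbientBundle ι) : ℝ × F × E :=
  (q.1, coords W₀ q.2)

theorem contMDiffAt_collarCoords {W₀ : AmbientBundle ι} {r : ℝ} {W : AmbientBundle ι}
    (hW : W.proj ∈ chartDomain ι W₀.proj) :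
    ContMDiffAt (𝓘(ℝ, ℝ).prod (𝓘(ℝ, F).prod 𝓘(ℝ, E))) 𝓘(ℝ, ℝ × F × E) ∞
      (collarCoords W₀) (r, W) :=
  contMDiffAt_fst.prodMk_space ((contMDiffAt_coords hW).comp (r, W) contMDiffAt_snd)

theorem hasMFDerivAt_collarCoords {W₀ : AmbientBundle ι} {r : ℝ} {W : AmbientBundle ι}
    (hW : W.proj ∈ chartDomain ι W₀.proj) :
    HasMFDerivAt (𝓘(ℝ, ℝ).prod (𝓘(ℝ, F).prod 𝓘(ℝ, E))) 𝓘(ℝ, ℝ × F × E)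
      (collarCoords W₀) (r, W) ((ContinuousLinearMap.fst ℝ ℝ (F × E)).prod
        ((coordsDifferential W₀ W).comp (ContinuousLinearMap.snd ℝ ℝ (F × E))) :
          ℝ × F × E →L[ℝ] ℝ × F × E) := by
  have h1 := hasMFDerivAt_fst (I := 𝓘(ℝ, ℝ)) (I' := 𝓘(ℝ, F).prod 𝓘(ℝ, E)) (r, W)
  have h2 := (hasMFDerivAt_chart (mem_ambient_source_iff.2 hW)).comp (r, W)
    (hasMFDerivAt_snd (I := 𝓘(ℝ, ℝ)) (I' := 𝓘(ℝ, F).prod 𝓘(ℝ, E)) (r, W))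
  exact ⟨h1.1.prodMk h2.1, h1.2.prodMk h2.2⟩

/-- The differential of the normal exponential map in terms of a local expression. -/
theorem chartDifferential_dBlowDownAt (g : Metric E M) {W₀ W : AmbientBundle ι} {r : ℝ} {x₁ : M}
    (hW : W.proj ∈ chartDomain ι W₀.proj)
    (hx₁ : blowDown g ι (r, W) ∈ (extChartAt 𝓘(ℝ, E) x₁).source)
    (hd : MDifferentiableAt (𝓘(ℝ, ℝ).prod (𝓘(ℝ, F).prod 𝓘(ℝ, E))) 𝓘(ℝ, E) (blowDown g ι) (r, W))
    {f : ℝ × F × E → E} (hf : DifferentiableAt ℝ f (r, coords W₀ W))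
    (h : ∀ᶠ q in 𝓝 (r, W), extChartAt 𝓘(ℝ, E) x₁ (blowDown g ι q) = f (collarCoords W₀ q))
    (X : ℝ × F × E) :
    chartDifferential 𝓘(ℝ, E) x₁ (blowDown g ι (r, W)) (dBlowDownAt g r W X) =
      fderiv ℝ f (r, coords W₀ W) (X.1, coordsDifferential W₀ W X.2) := by
  have h1 := (hasMFDerivAt_chart hx₁).comp (r, W) hd.hasMFDerivAt
  have h2 := HasMFDerivAt.comp (g := f) (f := collarCoords W₀) (r, W)
    hf.hasFDerivAt.hasMFDerivAt (hasMFDerivAt_collarCoords hW)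
  have h3 := hasMFDerivAt_unique h1 (h2.congr_of_eventuallyEq h)
  exact congrArg (fun L : ℝ × F × E →L[ℝ] E => L X) h3

/-- The local expression of the normal exponential map. -/
def localBlowDown (ι : C^∞⟮𝓘(ℝ, F), B; 𝓘(ℝ, E), M⟯) (b₀ : B) (Exp : E × E → E)
    (q : ℝ × F × E) : E :=
  Exp (localMap ι b₀ q.2.1, q.1 • q.2.2)

theorem contDiffAt_localBlowDown {G : E → E →L[ℝ] E →L[ℝ] ℝ} {U : Set E} {Exp : E × E → E}
    {N : Set (E × E)} (hE : IsExponential G U Exp N) {b₀ : B} {q : ℝ × F × E}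
    (hq : q.2.1 ∈ localDomain ι b₀) (hN : (localMap ι b₀ q.2.1, q.1 • q.2.2) ∈ N) :
    ContDiffAt ℝ ∞ (localBlowDown ι b₀ Exp) q := by
  have h1 : ContDiffAt ℝ ∞ (fun q : ℝ × F × E => localMap ι b₀ q.2.1) q :=
    ContDiffAt.comp (g := localMap ι b₀) (f := fun q : ℝ × F × E => q.2.1) q
      (contDiffAt_localMap_of_mem hq) (by fun_prop)
  exact ContDiffAt.comp (g := Exp) (f := fun q : ℝ × F × E => (localMap ι b₀ q.2.1, q.1 • q.2.2)) q
    (hE.contDiffAt _ hN) (h1.prodMk (by fun_prop))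

/-- The differential of the local expression of the normal exponential map. -/
theorem fderiv_localBlowDown {G : E → E →L[ℝ] E →L[ℝ] ℝ} {U : Set E} {Exp : E × E → E}
    {N : Set (E × E)} (hE : IsExponential G U Exp N) {b₀ : B} {q : ℝ × F × E}
    (hq : q.2.1 ∈ localDomain ι b₀) (hN : (localMap ι b₀ q.2.1, q.1 • q.2.2) ∈ N)
    (X : ℝ × F × E) :
    fderiv ℝ (localBlowDown ι b₀ Exp) q X = fderiv ℝ Exp (localMap ι b₀ q.2.1, q.1 • q.2.2)
      (fderiv ℝ (localMap ι b₀) q.2.1 X.2.1, X.1 • q.2.2 + q.1 • X.2.2) := by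
  have h1 : HasFDerivAt (fun q : ℝ × F × E => localMap ι b₀ q.2.1)
      ((fderiv ℝ (localMap ι b₀) q.2.1).comp ((ContinuousLinearMap.fst ℝ F E).comp
        (ContinuousLinearMap.snd ℝ ℝ (F × E)))) q :=
    HasFDerivAt.comp (g := localMap ι b₀) (f := fun q : ℝ × F × E => q.2.1) q
      ((contDiffAt_localMap_of_mem hq).differentiableAt (by simp)).hasFDerivAt
      ((ContinuousLinearMap.fst ℝ F E).comp (ContinuousLinearMap.snd ℝ ℝ (F × E))).hasFDerivAt
  have h2 : HasFDerivAt (fun q : ℝ × F × E => q.1 • q.2.2)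
      (q.1 • ((ContinuousLinearMap.snd ℝ F E).comp (ContinuousLinearMap.snd ℝ ℝ (F × E))) +
        (ContinuousLinearMap.fst ℝ ℝ (F × E)).smulRight q.2.2) q :=
    HasFDerivAt.smul hasFDerivAt_fst
      ((ContinuousLinearMap.snd ℝ F E).comp (ContinuousLinearMap.snd ℝ ℝ (F × E))).hasFDerivAt
  have h3 := HasFDerivAt.comp (g := Exp)
    (f := fun q : ℝ × F × E => (localMap ι b₀ q.2.1, q.1 • q.2.2)) q
    ((hE.contDiffAt _ hN).differentiableAt (by simp)).hasFDerivAt (h1.prodMk h2)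
  have h4 : fderiv ℝ (localBlowDown ι b₀ Exp) q = _ := h3.fderiv
  rw [h4]
  simp only [ContinuousLinearMap.comp_apply, ContinuousLinearMap.prod_apply, add_apply, smul_apply,
    ContinuousLinearMap.smulRight_apply, ContinuousLinearMap.coe_fst',
    ContinuousLinearMap.coe_snd']
  rw [add_comm]

/-- The normal exponential map near the zero section. -/
theorem exists_localBlowDown [FiniteDimensional ℝ E] [T2Space M] (g : Metric E M) (b₀ : B) :
    ∃ (Exp : E × E → E) (N : Set (E × E)),
      IsExponential (chartMetric g (ι b₀)) (extChartAt 𝓘(ℝ, E) (ι b₀)).target Exp N ∧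
      (localMap ι b₀ (extChartAt 𝓘(ℝ, F) b₀ b₀), 0) ∈ N ∧
      ∀ W₀ : AmbientBundle ι, W₀.proj = b₀ → ∀ (r : ℝ) (W : AmbientBundle ι),
        W.proj ∈ chartDomain ι b₀ →
        (localMap ι b₀ (coords W₀ W).1, r • (coords W₀ W).2) ∈ N →
        (⟨ι W.proj, r • W.2⟩ : TangentBundle 𝓘(ℝ, E) M) ∈ expDomain g ∧
        blowDown g ι (r, W) ∈ (extChartAt 𝓘(ℝ, E) (ι b₀)).source ∧
        ContMDiffAt (𝓘(ℝ, ℝ).prod (𝓘(ℝ, F).prod 𝓘(ℝ, E))) 𝓘(ℝ, E) ∞ (blowDown g ι) (r, W) ∧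
        ∀ᶠ q in 𝓝 (r, W), extChartAt 𝓘(ℝ, E) (ι b₀) (blowDown g ι q) =
          localBlowDown ι b₀ Exp (collarCoords W₀ q) := by
  obtain ⟨Exp, N, hE, h0, hexp⟩ := exists_local_exp g (ι b₀)
  refine ⟨Exp, N, hE, by rwa [localMap_apply (mem_chartDomain b₀)], ?_⟩
  rintro W₀ rfl
  have key : ∀ (r : ℝ) (W : AmbientBundle ι), W.proj ∈ chartDomain ι W₀.proj →
      (localMap ι W₀.proj (coords W₀ W).1, r • (coords W₀ W).2) ∈ N →
      (⟨ι W.proj, r • W.2⟩ : TangentBundle 𝓘(ℝ, E) M) ∈ expDomain g ∧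
      blowDown g ι (r, W) = (extChartAt 𝓘(ℝ, E) (ι W₀.proj)).symm
        (localBlowDown ι W₀.proj Exp (collarCoords W₀ (r, W))) := by
    intro r W hW hN
    have h1 : (extChartAt 𝓘(ℝ, E) (ι W₀.proj) (ι W.proj), chartDifferential 𝓘(ℝ, E) (ι W₀.proj)
        (ι W.proj) (r • ambientVec W)) =
        (localMap ι W₀.proj (coords W₀ W).1, r • (coords W₀ W).2) := by
      rw [coords_apply hW, localMap_apply hW, map_smul]
    have h2 := hexp ⟨ι W.proj, r • W.2⟩ hW.2 (by rw [← h1] at hN; exact hN)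
    refine ⟨h2.1, h2.2.trans ?_⟩
    change (extChartAt 𝓘(ℝ, E) (ι W₀.proj)).symm (Exp (extChartAt 𝓘(ℝ, E) (ι W₀.proj) (ι W.proj),
      chartDifferential 𝓘(ℝ, E) (ι W₀.proj) (ι W.proj) (r • ambientVec W))) = _
    rw [h1]
    rfl
  intro r W hW hN
  have hcd := contDiffAt_localBlowDown (ι := ι) hE (b₀ := W₀.proj) (q := collarCoords W₀ (r, W))
    (coords_fst_mem hW) hN
  have hcc := contMDiffAt_collarCoords (r := r) hW
  have hev : ∀ᶠ q : ℝ × AmbientBundle ι in 𝓝 (r, W), q.2.proj ∈ chartDomain ι W₀.proj ∧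
      (localMap ι W₀.proj (coords W₀ q.2).1, q.1 • (coords W₀ q.2).2) ∈ N := by
    refine (continuousAt_snd.eventually (eventually_mem_chartDomain hW)).and ?_
    have h1 : ContinuousAt (fun q : ℝ × AmbientBundle ι =>
        (localMap ι W₀.proj (coords W₀ q.2).1, q.1 • (coords W₀ q.2).2)) (r, W) := by
      have h2 : ContinuousAt (fun q : ℝ × AmbientBundle ι => coords W₀ q.2) (r, W) :=
        ContinuousAt.comp (f := Prod.snd) (x := (r, W)) (contMDiffAt_coords hW).continuousAt
          continuousAt_snd
      have h3 : ContinuousAt (fun q : ℝ × AmbientBundle ι => localMap ι W₀.proj (coords W₀ q.2).1)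
          (r, W) :=
        ContinuousAt.comp (g := localMap ι W₀.proj)
          (f := fun q : ℝ × AmbientBundle ι => (coords W₀ q.2).1) (x := (r, W))
          (contDiffAt_localMap_of_mem (coords_fst_mem hW)).continuousAt h2.fst
      exact h3.prodMk (continuousAt_fst.smul h2.snd)
    exact h1.eventually (hE.isOpen.mem_nhds hN)
  have htar := hE.mem _ hN
  refine ⟨(key r W hW hN).1, ?_, ?_, ?_⟩
  · rw [(key r W hW hN).2]
    exact (extChartAt 𝓘(ℝ, E) (ι W₀.proj)).map_target htar
  · have h1 := (contMDiffOn_extChartAt_symm (I := 𝓘(ℝ, E)) (n := ∞) (ι W₀.proj)).contMDiffAt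
      (extChartAt_target_mem_nhds' htar)
    have h2 : ContMDiffAt (𝓘(ℝ, ℝ).prod (𝓘(ℝ, F).prod 𝓘(ℝ, E))) 𝓘(ℝ, E) ∞
        (localBlowDown ι W₀.proj Exp ∘ collarCoords W₀) (r, W) :=
      ContMDiffAt.comp (r, W) (g := localBlowDown ι W₀.proj Exp) hcd.contMDiffAt hcc
    have h3 := ContMDiffAt.comp (g := (extChartAt 𝓘(ℝ, E) (ι W₀.proj)).symm) (r, W) h1 h2
    refine h3.congr_of_eventuallyEq ?_
    filter_upwards [hev] with q hq
    exact (key q.1 q.2 hq.1 hq.2).2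
  · filter_upwards [hev] with q hq
    rw [(key q.1 q.2 hq.1 hq.2).2]
    exact (extChartAt 𝓘(ℝ, E) (ι W₀.proj)).right_inv (hE.mem _ hq.2)

end BlowDown

/-! ## Geometric quantities in a fixed chart -/

section LocalExpressions

variable {E : Type*} [NormedAddCommGroup E] [NormedSpace ℝ E] [FiniteDimensional ℝ E]
  {M : Type*} [TopologicalSpace M] [ChartedSpace E M] [IsManifold 𝓘(ℝ, E) ∞ M]
  {F : Type*} [NormedAddCommGroup F] [NormedSpace ℝ F] [FiniteDimensional ℝ F]
  {B : Type*} [TopologicalSpace B] [ChartedSpace F B] [IsManifold 𝓘(ℝ, F) ∞ B]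
  {ι : C^∞⟮𝓘(ℝ, F), B; 𝓘(ℝ, E), M⟯}

/-- The induced metric on `B` in the chart at `b₀`. -/
def localGram (g : Metric E M) (ι : C^∞⟮𝓘(ℝ, F), B; 𝓘(ℝ, E), M⟯) (b₀ : B) (y : F) :
    F →L[ℝ] F →L[ℝ] ℝ :=
  (chartMetric g (ι b₀) (localMap ι b₀ y)).bilinearComp (fderiv ℝ (localMap ι b₀) y)
    (fderiv ℝ (localMap ι b₀) y)

/-- The normal projection in the charts at `b₀` and `ι b₀`. -/
def localNormal (g : Metric E M) (ι : C^∞⟮𝓘(ℝ, F), B; 𝓘(ℝ, E), M⟯) (b₀ : B) (y : F) (a : E) : E :=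
  a - fderiv ℝ (localMap ι b₀) y ((localGram g ι b₀ y).inverse
    ((chartMetric g (ι b₀) (localMap ι b₀ y) a).comp (fderiv ℝ (localMap ι b₀) y)))

theorem contDiffAt_fderiv_localMap {b₀ : B} {y : F} (hy : y ∈ localDomain ι b₀) :
    ContDiffAt ℝ ∞ (fderiv ℝ (localMap ι b₀)) y :=
  (contDiffAt_localMap_of_mem hy).fderiv_right (by simp)

theorem contDiffAt_chartMetric_localMap (g : Metric E M) {b₀ : B} {y : F}
    (hy : y ∈ localDomain ι b₀) :
    ContDiffAt ℝ ∞ (fun y => chartMetric g (ι b₀) (localMap ι b₀ y)) y :=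
  ((isMetricOn_chartMetric g (ι b₀)).contDiffAt (localMap_mem_target hy)).comp y
    (contDiffAt_localMap_of_mem hy)

theorem injective_fderiv_localMap (hι : ∀ b, Function.Injective (dιAt ι b)) {b₀ : B} {y : F}
    (hy : y ∈ localDomain ι b₀) : Function.Injective (fderiv ℝ (localMap ι b₀) y) := by
  obtain ⟨b, hb, rfl⟩ := exists_of_mem_localDomain hy
  intro v v' h
  obtain ⟨u, rfl⟩ := chartDifferential_surjective hb.1 v
  obtain ⟨u', rfl⟩ := chartDifferential_surjective hb.1 v'
  rw [← chartDifferential_dιAt hb, ← chartDifferential_dιAt hb] at h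
  rw [hι b (chartDifferential_injective hb.2 h)]

theorem isMetricOn_localGram (g : Metric E M) (hι : ∀ b, Function.Injective (dιAt ι b)) (b₀ : B) :
    IsMetricOn (localGram g ι b₀) (localDomain ι b₀) where
  isOpen := isOpen_localDomain b₀
  contDiffOn := by
    refine contDiffOn_clm_apply.2 fun u => contDiffOn_clm_apply.2 fun v => fun y hy => ?_
    have h := ((contDiffAt_chartMetric_localMap g hy).clm_apply
      ((contDiffAt_fderiv_localMap hy).clm_apply (contDiffAt_const (c := u)))).clm_apply
      ((contDiffAt_fderiv_localMap hy).clm_apply (contDiffAt_const (c := v)))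
    exact h.contDiffWithinAt
  symm y hy v w := (isMetricOn_chartMetric g (ι b₀)).symm _ (localMap_mem_target hy) _ _
  pos y hy v hv := (isMetricOn_chartMetric g (ι b₀)).pos _ (localMap_mem_target hy) _ fun h =>
    hv (injective_fderiv_localMap hι hy (h.trans (map_zero _).symm))

/-- The chart differential is an isometry for the chart metric and carries the image of dι to that
of Dc. Orthogonal projection is therefore given in the fixed chart by the same formula, now visibly
smooth in the base point. -/
theorem chartDifferential_normalAt (g : Metric E M) (hι : ∀ b, Function.Injective (dιAt ι b))
    {b₀ b : B} (hb : b ∈ chartDomain ι b₀) (a : E) :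
    chartDifferential 𝓘(ℝ, E) (ι b₀) (ι b) (normalAt g ι b a) =
      localNormal g ι b₀ (extChartAt 𝓘(ℝ, F) b₀ b)
        (chartDifferential 𝓘(ℝ, E) (ι b₀) (ι b) a) := by
  obtain ⟨⟨t, ht⟩, hn⟩ := exists_eq_normalAt_add g (hι b) a
  set n := normalAt g ι b a with n_def
  set y := extChartAt 𝓘(ℝ, F) b₀ b with y_def
  obtain ⟨e, he⟩ := (isMetricOn_localGram g hι b₀).exists_equiv (mem_localDomain hb)
  have h1 : (chartMetric g (ι b₀) (localMap ι b₀ y)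
      (chartDifferential 𝓘(ℝ, E) (ι b₀) (ι b) a)).comp (fderiv ℝ (localMap ι b₀) y) =
      localGram g ι b₀ y (chartDifferential 𝓘(ℝ, F) b₀ b t) := by
    ext v
    obtain ⟨u, rfl⟩ := chartDifferential_surjective hb.1 v
    have h2 : innerAt g (ι b) a (dιAt ι b u) = innerAt g (ι b) (dιAt ι b t) (dιAt ι b u) := by
      conv_lhs => rw [ht]
      rw [map_add, add_apply, hn, zero_add]
    rw [inner_eq_chartMetric g hb.2, inner_eq_chartMetric g hb.2, chartDifferential_dιAt hb,
      chartDifferential_dιAt hb, ← localMap_apply hb] at h2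
    exact h2
  rw [localNormal, h1, ← he, ContinuousLinearMap.inverse_equiv]
  have h3 : (e.symm : (F →L[ℝ] ℝ) →L[ℝ] F)
      ((e : F →L[ℝ] F →L[ℝ] ℝ) (chartDifferential 𝓘(ℝ, F) b₀ b t)) =
      chartDifferential 𝓘(ℝ, F) b₀ b t := e.symm_apply_apply _
  rw [h3, ← chartDifferential_dιAt hb, ← map_sub]
  congr 1
  conv_rhs => rw [ht]
  rw [add_sub_cancel_right]

theorem contDiffAt_localNormal {X : Type*} [NormedAddCommGroup X] [NormedSpace ℝ X] (g : Metric E M)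
    (hι : ∀ b, Function.Injective (dιAt ι b)) {b₀ : B} {y : X → F} {a : X → E} {x₀ : X}
    (hy₀ : y x₀ ∈ localDomain ι b₀) (hy : ContDiffAt ℝ ∞ y x₀) (ha : ContDiffAt ℝ ∞ a x₀) :
    ContDiffAt ℝ ∞ (fun x => localNormal g ι b₀ (y x) (a x)) x₀ := by
  have h1 : ContDiffAt ℝ ∞ (fun x => fderiv ℝ (localMap ι b₀) (y x)) x₀ :=
    (contDiffAt_fderiv_localMap hy₀).comp x₀ hy
  have h2 : ContDiffAt ℝ ∞ (fun x => chartMetric g (ι b₀) (localMap ι b₀ (y x))) x₀ :=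
    (contDiffAt_chartMetric_localMap g hy₀).comp x₀ hy
  have h3 : ContDiffAt ℝ ∞ (fun x => (localGram g ι b₀ (y x)).inverse) x₀ :=
    ((isMetricOn_localGram g hι b₀).contDiffOn_inverse.contDiffAt
      ((isOpen_localDomain b₀).mem_nhds hy₀)).comp x₀ hy
  exact ha.sub (h1.clm_apply (h3.clm_apply ((h2.clm_apply ha).clm_comp h1)))

/-- The covariant derivative in the charts at `b₀` and `ι b₀`. -/
def localCovDeriv (g : Metric E M) (ι : C^∞⟮𝓘(ℝ, F), B; 𝓘(ℝ, E), M⟯) (b₀ : B) (z ζ : F × E) : E :=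
  ζ.2 + christoffelSymbol (chartMetric g (ι b₀)) (localMap ι b₀ z.1)
    (fderiv ℝ (localMap ι b₀) z.1 ζ.1) z.2

/-- The normal covariant derivative in the charts at `b₀` and `ι b₀`. -/
def localNormalCovDeriv (g : Metric E M) (ι : C^∞⟮𝓘(ℝ, F), B; 𝓘(ℝ, E), M⟯) (b₀ : B)
    (z ζ : F × E) : E :=
  localNormal g ι b₀ z.1 (localCovDeriv g ι b₀ z ζ)

theorem coords_fst {W₀ W : AmbientBundle ι} (hW : W.proj ∈ chartDomain ι W₀.proj) :
    (coords W₀ W).1 = extChartAt 𝓘(ℝ, F) W₀.proj W.proj := by rw [coords_apply hW]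

theorem localMap_coords {W₀ W : AmbientBundle ι} (hW : W.proj ∈ chartDomain ι W₀.proj) :
    localMap ι W₀.proj (coords W₀ W).1 = extChartAt 𝓘(ℝ, E) (ι W₀.proj) (ι W.proj) := by
  rw [coords_fst hW, localMap_apply hW]

theorem coords_snd {W₀ W : AmbientBundle ι} (hW : W.proj ∈ chartDomain ι W₀.proj) :
    (coords W₀ W).2 = chartDifferential 𝓘(ℝ, E) (ι W₀.proj) (ι W.proj) (ambientVec W) := by
  rw [coords_apply hW]

theorem fderiv_localMap_coordsDifferential {W₀ W : AmbientBundle ι}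
    (hW : W.proj ∈ chartDomain ι W₀.proj) (ζ : F × E) :
    fderiv ℝ (localMap ι W₀.proj) (coords W₀ W).1 (coordsDifferential W₀ W ζ).1 =
      chartDifferential 𝓘(ℝ, E) (ι W₀.proj) (ι W.proj) (dιAt ι W.proj ζ.1) := by
  rw [chartDifferential_dιAt hW, ← chartDifferential_dπAt hW, dπAt_apply, coords_fst hW]

theorem localCovDeriv_coords (g : Metric E M) {W₀ W : AmbientBundle ι}
    (hW : W.proj ∈ chartDomain ι W₀.proj) (ζ : F × E) :
    localCovDeriv g ι W₀.proj (coords W₀ W) (coordsDifferential W₀ W ζ) =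
      chartDifferential 𝓘(ℝ, E) (ι W₀.proj) (ι W.proj) (covDerivAt g W ζ) :=
  (chartDifferential_covDerivAt g hW ζ).symm

theorem localNormalCovDeriv_coords (g : Metric E M) (hι : ∀ b, Function.Injective (dιAt ι b))
    {W₀ W : AmbientBundle ι} (hW : W.proj ∈ chartDomain ι W₀.proj) (ζ : F × E) :
    localNormalCovDeriv g ι W₀.proj (coords W₀ W) (coordsDifferential W₀ W ζ) =
      chartDifferential 𝓘(ℝ, E) (ι W₀.proj) (ι W.proj) (normalCovDerivAt g W ζ) := by
  rw [localNormalCovDeriv, localCovDeriv_coords g hW, coords_fst hW,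
    ← chartDifferential_normalAt g hι hW]
  rfl

theorem chartMetric_coords (g : Metric E M) {W₀ W : AmbientBundle ι}
    (hW : W.proj ∈ chartDomain ι W₀.proj) (u v : E) :
    chartMetric g (ι W₀.proj) (localMap ι W₀.proj (coords W₀ W).1)
      (chartDifferential 𝓘(ℝ, E) (ι W₀.proj) (ι W.proj) u)
      (chartDifferential 𝓘(ℝ, E) (ι W₀.proj) (ι W.proj) v) = innerAt g (ι W.proj) u v := by
  rw [localMap_coords hW, inner_eq_chartMetric g hW.2]

theorem coordsDifferential_vertical (g : Metric E M) {W₀ W : AmbientBundle ι}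
    (hW : W.proj ∈ chartDomain ι W₀.proj) (n : E) :
    coordsDifferential W₀ W (0, n) =
      (0, chartDifferential 𝓘(ℝ, E) (ι W₀.proj) (ι W.proj) n) := by
  have h1 : (coordsDifferential W₀ W (0, n)).1 = 0 := by
    rw [← chartDifferential_dπAt hW, dπAt_apply, map_zero]
  have h2 := chartDifferential_covDerivAt g hW (0, n)
  rw [h1, map_zero, map_zero, zero_apply, add_zero, covDerivAt_apply, map_zero, map_zero,
    zero_apply, add_zero] at h2
  exact Prod.ext h1 h2.symm

/-- The pulled-back metric, rescaled, in terms of a local expression of the normal exponential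
map. -/
theorem twist_pullbackMetric (g : Metric E M) (hι : ∀ b, Function.Injective (dιAt ι b))
    {W₀ W : AmbientBundle ι} {r : ℝ} {x₁ : M} (hW : W.proj ∈ chartDomain ι W₀.proj)
    (hx₁ : blowDown g ι (r, W) ∈ (extChartAt 𝓘(ℝ, E) x₁).source)
    (hd : MDifferentiableAt (𝓘(ℝ, ℝ).prod (𝓘(ℝ, F).prod 𝓘(ℝ, E))) 𝓘(ℝ, E) (blowDown g ι) (r, W))
    {f : ℝ × F × E → E} (hf : DifferentiableAt ℝ f (r, coords W₀ W))
    (h : ∀ᶠ q in 𝓝 (r, W), extChartAt 𝓘(ℝ, E) x₁ (blowDown g ι q) = f (collarCoords W₀ q))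
    (X Y : ℝ × F × E) :
    twist g ι (pullbackMetric g ι) r W X Y = chartMetric g x₁ (f (r, coords W₀ W))
      (fderiv ℝ f (r, coords W₀ W) (X.1, coordsDifferential W₀ W X.2 + (r⁻¹ - 1) •
        (0, localNormalCovDeriv g ι W₀.proj (coords W₀ W) (coordsDifferential W₀ W X.2))))
      (fderiv ℝ f (r, coords W₀ W) (Y.1, coordsDifferential W₀ W Y.2 + (r⁻¹ - 1) •
        (0, localNormalCovDeriv g ι W₀.proj (coords W₀ W) (coordsDifferential W₀ W Y.2)))) := by
  have h1 : twist g ι (pullbackMetric g ι) r W X Y = innerAt g (blowDown g ι (r, W))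
      (dBlowDownAt g r W (scaleVertical g ι r⁻¹ W X))
      (dBlowDownAt g r W (scaleVertical g ι r⁻¹ W Y)) := rfl
  have h2 : ∀ X : ℝ × F × E, coordsDifferential W₀ W (scaleAt g r⁻¹ W X).2 =
      coordsDifferential W₀ W X.2 + (r⁻¹ - 1) •
        (0, localNormalCovDeriv g ι W₀.proj (coords W₀ W) (coordsDifferential W₀ W X.2)) := by
    intro X
    have h3 : (scaleAt g r⁻¹ W X).2 = X.2 + (r⁻¹ - 1) • ((0, normalCovDerivAt g W X.2) : F × E) := by
      ext <;> simp [scaleAt]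
    rw [h3, map_add, map_smul, coordsDifferential_vertical g hW,
      localNormalCovDeriv_coords g hι hW]
  rw [h1, scaleVertical_eq, scaleVertical_eq, inner_eq_chartMetric g hx₁,
    chartDifferential_dBlowDownAt g hW hx₁ hd hf h, chartDifferential_dBlowDownAt g hW hx₁ hd hf h,
    h2, h2, h.self_of_nhds]
  rfl

/-- Vectors tangent to the unit normal bundle in terms of orthogonal decompositions. -/
theorem orthogonality_relations (g : Metric E M) (hι : ∀ b, Function.Injective (dιAt ι b))
    {W : AmbientBundle ι} {ζ : F × E} (hζ : ζ ∈ tangentVectors ι (unitNormalBundle g ι) W) :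
    (∃ t, covDerivAt g W ζ = normalCovDerivAt g W ζ + dιAt ι W.proj t) ∧
      (∀ u, innerAt g (ι W.proj) (dιAt ι W.proj u) (normalCovDerivAt g W ζ) = 0) ∧
      innerAt g (ι W.proj) (normalCovDerivAt g W ζ) (ambientVec W) = 0 := by
  obtain ⟨⟨t, ht⟩, hn⟩ := exists_eq_normalAt_add g (hι W.proj) (covDerivAt g W ζ)
  refine ⟨⟨t, ht⟩, fun u => by rw [innerAt_symm]; exact hn u, ?_⟩
  have h1 := (innerAt_covDerivAt g hζ).1
  have h2 := (innerAt_of_mem g (mem_of_tangentVectors hζ)).2 t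
  rw [innerAt_symm] at h2
  rw [ht, map_add, add_apply, h2, add_zero] at h1
  exact h1

end LocalExpressions

/-! ## Smooth families of tangent vectors of the collar -/

section Families

variable {E : Type*} [NormedAddCommGroup E] [NormedSpace ℝ E] [FiniteDimensional ℝ E]
  {M : Type*} [TopologicalSpace M] [ChartedSpace E M] [IsManifold 𝓘(ℝ, E) ∞ M]
  {F : Type*} [NormedAddCommGroup F] [NormedSpace ℝ F] [FiniteDimensional ℝ F]
  {B : Type*} [TopologicalSpace B] [ChartedSpace F B] [IsManifold 𝓘(ℝ, F) ∞ B]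
  {ι : C^∞⟮𝓘(ℝ, F), B; 𝓘(ℝ, E), M⟯}
  {X : Type*} [NormedAddCommGroup X] [NormedSpace ℝ X]

/-- `Z` is, near `x₀`, a smooth family of vectors tangent to `ℝ × S(νB)` at the points `W x`. -/
structure IsSmoothFamily (g : Metric E M) (W₀ : AmbientBundle ι) (x₀ : X) (W : X → AmbientBundle ι)
    (Z : X → ℝ × F × E) : Prop where
  mem : ∀ᶠ x in 𝓝 x₀, (W x).proj ∈ chartDomain ι W₀.proj
  base : ContDiffAt ℝ ∞ (fun x => coords W₀ (W x)) x₀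
  fst : ContDiffAt ℝ ∞ (fun x => (Z x).1) x₀
  snd : ContDiffAt ℝ ∞ (fun x => coordsDifferential W₀ (W x) (Z x).2) x₀
  tangent : ∀ᶠ x in 𝓝 x₀, (Z x).2 ∈ tangentVectors ι (unitNormalBundle g ι) (W x)

namespace IsSmoothFamily

variable {g : Metric E M} {W₀ : AmbientBundle ι} {x₀ : X} {W : X → AmbientBundle ι}
  {Z Z' : X → ℝ × F × E}

theorem coords_mem (h : IsSmoothFamily g W₀ x₀ W Z) :
    (coords W₀ (W x₀)).1 ∈ localDomain ι W₀.proj := coords_fst_mem h.mem.self_of_nhds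

theorem localMap (h : IsSmoothFamily g W₀ x₀ W Z) :
    ContDiffAt ℝ ∞ (fun x => localMap ι W₀.proj (coords W₀ (W x)).1) x₀ :=
  ContDiffAt.comp (g := NormalBlowUp.localMap ι W₀.proj) (f := fun x => (coords W₀ (W x)).1) x₀
    (contDiffAt_localMap_of_mem h.coords_mem) h.base.fst

theorem velocity (h : IsSmoothFamily g W₀ x₀ W Z) :
    ContDiffAt ℝ ∞ (fun x => fderiv ℝ (NormalBlowUp.localMap ι W₀.proj) (coords W₀ (W x)).1
      (coordsDifferential W₀ (W x) (Z x).2).1) x₀ :=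
  (ContDiffAt.comp (g := fderiv ℝ (NormalBlowUp.localMap ι W₀.proj))
    (f := fun x => (coords W₀ (W x)).1) x₀ (contDiffAt_fderiv_localMap h.coords_mem)
    h.base.fst).clm_apply h.snd.fst

theorem covDeriv (h : IsSmoothFamily g W₀ x₀ W Z) :
    ContDiffAt ℝ ∞ (fun x => localCovDeriv g ι W₀.proj (coords W₀ (W x))
      (coordsDifferential W₀ (W x) (Z x).2)) x₀ := by
  have h1 : ContDiffAt ℝ ∞ (fun x => christoffelSymbol (chartMetric g (ι W₀.proj))
      (NormalBlowUp.localMap ι W₀.proj (coords W₀ (W x)).1)) x₀ :=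
    ContDiffAt.comp (f := fun x => NormalBlowUp.localMap ι W₀.proj (coords W₀ (W x)).1) x₀
      ((isMetricOn_chartMetric g (ι W₀.proj)).contDiffOn_christoffelSymbol.contDiffAt
      ((isMetricOn_chartMetric g (ι W₀.proj)).isOpen.mem_nhds (localMap_mem_target h.coords_mem)))
      h.localMap
  exact h.snd.snd.add ((h1.clm_apply h.velocity).clm_apply h.base.snd)

theorem normalCovDeriv (h : IsSmoothFamily g W₀ x₀ W Z)
    (hι : ∀ b, Function.Injective (dιAt ι b)) :
    ContDiffAt ℝ ∞ (fun x => localNormalCovDeriv g ι W₀.proj (coords W₀ (W x))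
      (coordsDifferential W₀ (W x) (Z x).2)) x₀ :=
  contDiffAt_localNormal g hι h.coords_mem h.base.fst h.covDeriv

theorem metric (h : IsSmoothFamily g W₀ x₀ W Z) :
    ContDiffAt ℝ ∞ (fun x => chartMetric g (ι W₀.proj)
      (NormalBlowUp.localMap ι W₀.proj (coords W₀ (W x)).1)) x₀ :=
  ContDiffAt.comp (f := fun x => (coords W₀ (W x)).1) x₀
    (contDiffAt_chartMetric_localMap g h.coords_mem) h.base.fst

theorem inner_normalCovDeriv (h : IsSmoothFamily g W₀ x₀ W Z) (h' : IsSmoothFamily g W₀ x₀ W Z')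
    (hι : ∀ b, Function.Injective (dιAt ι b)) :
    ContDiffAt ℝ ∞ (fun x => innerAt g (ι (W x).proj) (normalCovDerivAt g (W x) (Z x).2)
      (normalCovDerivAt g (W x) (Z' x).2)) x₀ := by
  refine ((h.metric.clm_apply (h.normalCovDeriv hι)).clm_apply
    (h'.normalCovDeriv hι)).congr_of_eventuallyEq ?_
  filter_upwards [h.mem] with x hx
  rw [localNormalCovDeriv_coords g hι hx, localNormalCovDeriv_coords g hι hx,
    chartMetric_coords g hx]

theorem inner_velocity (h : IsSmoothFamily g W₀ x₀ W Z) (h' : IsSmoothFamily g W₀ x₀ W Z') :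
    ContDiffAt ℝ ∞ (fun x => innerAt g (ι (W x).proj) (dιAt ι (W x).proj (Z x).2.1)
      (dιAt ι (W x).proj (Z' x).2.1)) x₀ := by
  refine ((h.metric.clm_apply h.velocity).clm_apply h'.velocity).congr_of_eventuallyEq ?_
  filter_upwards [h.mem] with x hx
  rw [fderiv_localMap_coordsDifferential hx, fderiv_localMap_coordsDifferential hx,
    chartMetric_coords g hx]

/-- For vectors tangent to S(νB) the value of II is -g(∇W, dι v), already known to be smooth, so the
second derivatives in its definition need not be followed through chart changes. -/
theorem secondAt (h : IsSmoothFamily g W₀ x₀ W Z) (h' : IsSmoothFamily g W₀ x₀ W Z') :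
    ContDiffAt ℝ ∞ (fun x => secondAt g (W x) (Z x).2.1 (Z' x).2.1) x₀ := by
  refine ((h.metric.clm_apply h.covDeriv).clm_apply h'.velocity).neg.congr_of_eventuallyEq ?_
  filter_upwards [h.mem, h.tangent] with x hx hx'
  rw [fderiv_localMap_coordsDifferential hx, localCovDeriv_coords g hx,
    chartMetric_coords g hx, (innerAt_covDerivAt g hx').2, neg_neg]

end IsSmoothFamily

/-- The cancellation of the pole: r (ω + (r⁻¹ - 1) n) = n + r (ω - n), the factor r coming from the
derivative of w ↦ r w. -/
theorem fderiv_localBlowDown_rescaled {G : E → E →L[ℝ] E →L[ℝ] ℝ} {U : Set E} {Exp : E × E → E}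
    {N : Set (E × E)} (hE : IsExponential G U Exp N) {b₀ : B} {r : ℝ} (hr : r ≠ 0) {z : F × E}
    (hz : z.1 ∈ localDomain ι b₀) (hN : (localMap ι b₀ z.1, r • z.2) ∈ N)
    (τ : ℝ) (ζ : F × E) (n : E) :
    fderiv ℝ (localBlowDown ι b₀ Exp) (r, z) (τ, ζ + (r⁻¹ - 1) • (0, n)) =
      expDifferential Exp (localMap ι b₀ z.1) z.2 r τ (fderiv ℝ (localMap ι b₀) z.1 ζ.1) n
        (ζ.2 - n) := by
  have h := fderiv_localBlowDown (ι := ι) hE (b₀ := b₀) (q := (r, z)) hz hN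
    (τ, ζ + (r⁻¹ - 1) • (0, n))
  rw [h, expDifferential]
  have h1 : (ζ + (r⁻¹ - 1) • ((0, n) : F × E)).1 = ζ.1 := by simp
  have h2 : (ζ + (r⁻¹ - 1) • ((0, n) : F × E)).2 = ζ.2 + (r⁻¹ - 1) • n := by simp
  simp only [h1, h2]
  congr 2
  rw [smul_add, smul_smul, smul_sub, mul_sub, mul_inv_cancel₀ hr, mul_one, sub_smul, one_smul]
  abel

/-- The difference of the pulled-back metric and the corrected model metric, both rescaled, is
divisible by `r²`. -/
theorem IsSmoothFamily.exists_expansion [T2Space M] {X : Type} [NormedAddCommGroup X]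
    [NormedSpace ℝ X] {g : Metric E M} {W₀ : AmbientBundle ι} {x₀ : X} {W : X → AmbientBundle ι}
    {Z Z' : X → ℝ × F × E} (h : IsSmoothFamily g W₀ x₀ W Z) (h' : IsSmoothFamily g W₀ x₀ W Z')
    (hW₀ : (W x₀).proj = W₀.proj) (hι : ∀ b, Function.Injective (dιAt ι b)) :
    ∃ k : ℝ × X → ℝ, ContDiffAt ℝ ∞ k (0, x₀) ∧ ∀ᶠ q in 𝓝 ((0 : ℝ), x₀), q.1 ≠ 0 →
      twist g ι (pullbackMetric g ι) q.1 (W q.2) (Z q.2) (Z' q.2) =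
        twist g ι (correctedModelMetric g ι) q.1 (W q.2) (Z q.2) (Z' q.2) + q.1 ^ 2 * k q := by
  obtain ⟨Exp, N, hE, h0, hloc⟩ := exists_localBlowDown (ι := ι) g W₀.proj
  have hG := isMetricOn_chartMetric g (ι W₀.proj)
  set G := chartMetric g (ι W₀.proj) with G_def
  set b : X → E := fun x => NormalBlowUp.localMap ι W₀.proj (coords W₀ (W x)).1 with b_def
  set w : X → E := fun x => (coords W₀ (W x)).2 with w_def
  set v : (X → ℝ × F × E) → X → E := fun Z x => fderiv ℝ (NormalBlowUp.localMap ι W₀.proj)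
    (coords W₀ (W x)).1 (coordsDifferential W₀ (W x) (Z x).2).1 with v_def
  set p : (X → ℝ × F × E) → X → E := fun Z x => localNormalCovDeriv g ι W₀.proj (coords W₀ (W x))
    (coordsDifferential W₀ (W x) (Z x).2) with p_def
  set m : (X → ℝ × F × E) → X → E := fun Z x =>
    (coordsDifferential W₀ (W x) (Z x).2).2 - p Z x with m_def
  have hb₀ : (b x₀, 0) ∈ N := by
    simp only [b_def]
    rw [coords_fst h.mem.self_of_nhds, hW₀]
    exact h0
  -- Here m + Γ(v, w) is the covariant derivative minus its normal part, hence tangent to B; all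
  -- orthogonality hypotheses of the expansion follow from this.
  have htan : ∀ (Z : X → ℝ × F × E) (x : X), (W x).proj ∈ chartDomain ι W₀.proj →
      (Z x).2 ∈ tangentVectors ι (unitNormalBundle g ι) (W x) →
      ∃ t, m Z x + christoffelSymbol G (b x) (v Z x) (w x) =
        chartDifferential 𝓘(ℝ, E) (ι W₀.proj) (ι (W x).proj) (dιAt ι (W x).proj t) := by
    intro Z x hx hZ
    obtain ⟨t, ht⟩ := (orthogonality_relations g hι hZ).1
    refine ⟨t, ?_⟩
    have h1 : m Z x + christoffelSymbol G (b x) (v Z x) (w x) =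
      localCovDeriv g ι W₀.proj (coords W₀ (W x)) (coordsDifferential W₀ (W x) (Z x).2) - p Z x := by
      simp only [m_def, localCovDeriv]
      exact sub_add_eq_add_sub _ _ _
    rw [h1]
    simp only [p_def]
    rw [localCovDeriv_coords g hx, localNormalCovDeriv_coords g hι hx, ← map_sub, ht,
      add_sub_cancel_left]
  have hv : ∀ (Z : X → ℝ × F × E) (x : X), (W x).proj ∈ chartDomain ι W₀.proj →
      v Z x = chartDifferential 𝓘(ℝ, E) (ι W₀.proj) (ι (W x).proj)
        (dιAt ι (W x).proj (Z x).2.1) := fun Z x hx => fderiv_localMap_coordsDifferential hx _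
  have hp : ∀ (Z : X → ℝ × F × E) (x : X), (W x).proj ∈ chartDomain ι W₀.proj →
      p Z x = chartDifferential 𝓘(ℝ, E) (ι W₀.proj) (ι (W x).proj)
        (normalCovDerivAt g (W x) (Z x).2) := fun Z x hx => localNormalCovDeriv_coords g hι hx _
  have hw : ∀ x : X, (W x).proj ∈ chartDomain ι W₀.proj →
      w x = chartDifferential 𝓘(ℝ, E) (ι W₀.proj) (ι (W x).proj) (ambientVec (W x)) :=
    fun x hx => coords_snd hx
  obtain ⟨k, hk, hexp⟩ := NormalBlowUp.exists_expansion hG hE (b := b) (w := w) (v := v Z)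
    (p := p Z) (m := m Z) (v' := v Z') (p' := p Z') (m' := m Z') (τ := fun x => (Z x).1)
    (τ' := fun x => (Z' x).1) hb₀ h.localMap h.base.snd h.velocity (h.normalCovDeriv hι)
    (h.snd.snd.sub (h.normalCovDeriv hι)) h'.velocity (h'.normalCovDeriv hι)
    (h'.snd.snd.sub (h'.normalCovDeriv hι)) h.fst h'.fst
    (by
      filter_upwards [h.mem, h.tangent] with x hx hZ
      rw [hw x hx, chartMetric_coords g hx]
      exact (innerAt_of_mem g (mem_of_tangentVectors hZ)).1)
    (by
      filter_upwards [h.mem, h.tangent, h'.tangent] with x hx hZ hZ'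
      have hd : ∀ t, G (b x) (chartDifferential 𝓘(ℝ, E) (ι W₀.proj) (ι (W x).proj)
          (dιAt ι (W x).proj t)) (w x) = 0 := fun t => by
        rw [hw x hx, chartMetric_coords g hx, innerAt_symm]
        exact (innerAt_of_mem g (mem_of_tangentVectors hZ)).2 t
      have hn : ∀ Z : X → ℝ × F × E, (Z x).2 ∈ tangentVectors ι (unitNormalBundle g ι) (W x) →
          G (b x) (p Z x) (w x) = 0 := fun Z hZ => by
        rw [hw x hx, hp Z x hx, chartMetric_coords g hx]
        exact (orthogonality_relations g hι hZ).2.2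
      obtain ⟨t, ht⟩ := htan Z x hx hZ
      obtain ⟨t', ht'⟩ := htan Z' x hx hZ'
      rintro u (rfl | rfl | rfl | rfl | rfl | rfl)
      · rw [hv Z x hx]; exact hd _
      · rw [hv Z' x hx]; exact hd _
      · exact hn Z hZ
      · exact hn Z' hZ'
      · rw [ht]; exact hd _
      · rw [ht']; exact hd _)
    (by
      filter_upwards [h.mem, h.tangent, h'.tangent] with x hx hZ hZ'
      have hd : ∀ t, G (b x) (chartDifferential 𝓘(ℝ, E) (ι W₀.proj) (ι (W x).proj)
          (dιAt ι (W x).proj t)) (p Z x) = 0 ∧ G (b x) (chartDifferential 𝓘(ℝ, E) (ι W₀.proj)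
          (ι (W x).proj) (dιAt ι (W x).proj t)) (p Z' x) = 0 := fun t => by
        rw [hp Z x hx, hp Z' x hx, chartMetric_coords g hx, chartMetric_coords g hx]
        exact ⟨(orthogonality_relations g hι hZ).2.1 t, (orthogonality_relations g hι hZ').2.1 t⟩
      obtain ⟨t, ht⟩ := htan Z x hx hZ
      obtain ⟨t', ht'⟩ := htan Z' x hx hZ'
      rintro u (rfl | rfl | rfl | rfl)
      · rw [hv Z x hx]; exact hd _
      · rw [hv Z' x hx]; exact hd _
      · rw [ht]; exact hd _
      · rw [ht']; exact hd _)
  refine ⟨k, hk, ?_⟩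
  have hN : ∀ᶠ q : ℝ × X in 𝓝 ((0 : ℝ), x₀), (b q.2, q.1 • w q.2) ∈ N := by
    have h1 : ContinuousAt (fun q : ℝ × X => (b q.2, q.1 • w q.2)) (0, x₀) := by
      have h2 : ContinuousAt (fun q : ℝ × X => b q.2) (0, x₀) :=
        ContinuousAt.comp (g := b) (f := Prod.snd) (x := ((0 : ℝ), x₀))
          h.localMap.continuousAt continuousAt_snd
      have h3 : ContinuousAt (fun q : ℝ × X => w q.2) (0, x₀) :=
        ContinuousAt.comp (g := w) (f := Prod.snd) (x := ((0 : ℝ), x₀))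
          h.base.snd.continuousAt continuousAt_snd
      exact h2.prodMk (continuousAt_fst.smul h3)
    refine h1.eventually (hE.isOpen.mem_nhds ?_)
    simpa using hb₀
  have hsnd : ∀ {P : X → Prop}, (∀ᶠ x in 𝓝 x₀, P x) → ∀ᶠ q : ℝ × X in 𝓝 ((0 : ℝ), x₀), P q.2 :=
    fun hP => (continuousAt_snd (p := ((0 : ℝ), x₀))).eventually hP
  filter_upwards [hexp, hN, hsnd h.mem, hsnd h.tangent, hsnd h'.tangent] with q hq hqN hx hZ hZ' hr
  obtain ⟨r, x⟩ := q
  simp only at hq hqN hx hZ hZ' hr ⊢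
  obtain ⟨-, hsrc, hsm, hev⟩ := hloc W₀ rfl r (W x) hx hqN
  have hdf := (contDiffAt_localBlowDown hE (b₀ := W₀.proj) (q := (r, coords W₀ (W x)))
    (coords_fst_mem hx) hqN).differentiableAt (by simp)
  have hterm : ∀ Z : X → ℝ × F × E, fderiv ℝ (localBlowDown ι W₀.proj Exp) (r, coords W₀ (W x))
      ((Z x).1, coordsDifferential W₀ (W x) (Z x).2 + (r⁻¹ - 1) • (0, p Z x)) =
      expDifferential Exp (b x) (w x) r (Z x).1 (v Z x) (p Z x) (m Z x) := by
    intro Z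
    exact fderiv_localBlowDown_rescaled hE hr (coords_fst_mem hx) hqN _ _ _
  rw [twist_pullbackMetric g hι hx hsrc (hsm.mdifferentiableAt (by simp)) hdf hev,
    twist_correctedModelMetric g (hι _) hr]
  have e1 := hterm Z
  have e2 := hterm Z'
  simp only [p_def] at e1 e2
  rw [e1, e2]
  refine Eq.trans hq ?_
  -- The normal part pairs to zero with v', so the pairing is that of ∇W with v', which is -II.
  -- Adding the term with Z and Z' exchanged gives the coefficient -2.
  have hsec : ∀ Z Z' : X → ℝ × F × E, (Z x).2 ∈ tangentVectors ι (unitNormalBundle g ι) (W x) →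
      (Z' x).2 ∈ tangentVectors ι (unitNormalBundle g ι) (W x) →
      G (b x) (m Z x + christoffelSymbol G (b x) (v Z x) (w x)) (v Z' x) =
      -NormalBlowUp.secondAt g (W x) (Z x).2.1 (Z' x).2.1 := by
    intro Z Z' hZ hZ'
    obtain ⟨t, ht⟩ := (orthogonality_relations g hι hZ).1
    have h1 : m Z x + christoffelSymbol G (b x) (v Z x) (w x) =
      localCovDeriv g ι W₀.proj (coords W₀ (W x)) (coordsDifferential W₀ (W x) (Z x).2) - p Z x := by
      simp only [m_def, localCovDeriv]
      exact sub_add_eq_add_sub _ _ _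
    rw [h1, localCovDeriv_coords g hx, hp Z x hx, hv Z' x hx, ← map_sub, chartMetric_coords g hx,
      map_sub, sub_apply, (innerAt_covDerivAt g hZ).2, innerAt_symm g _ (normalCovDerivAt _ _ _),
      (orthogonality_relations g hι hZ).2.1, sub_zero]
  rw [hsec Z Z' hZ hZ', hsec Z' Z hZ' hZ, hp Z x hx, hp Z' x hx, hv Z x hx, hv Z' x hx,
    chartMetric_coords g hx, chartMetric_coords g hx, secondAt_symm g (W x) (Z' x).2.1]
  ring

end Families

/-! ## The expansion of the pulled-back metric -/

/-- A family of bilinear forms which converges on a set of vectors converges there to a bilinear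
form. -/
theorem exists_bilinForm_tendsto {ι V : Type*} [AddCommGroup V] [Module ℝ V] {l : Filter ι}
    [l.NeBot] (b : ι → LinearMap.BilinForm ℝ V) (T : Set V)
    (h : ∀ X ∈ T, ∀ Y ∈ T, ∃ c, Filter.Tendsto (fun i => b i X Y) l (𝓝 c)) :
    ∃ β : LinearMap.BilinForm ℝ V, ∀ X ∈ T, ∀ Y ∈ T,
      Filter.Tendsto (fun i => b i X Y) l (𝓝 (β X Y)) := by
  -- A set of velocities of curves is not known to be a subspace, so limits are first extended
  -- bilinearly to its span; a linear projection onto the span then yields a form on all of V.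
  set S := Submodule.span ℝ T with S_def
  have h1 : ∀ X ∈ T, ∀ Y ∈ S, ∃ c, Filter.Tendsto (fun i => b i X Y) l (𝓝 c) := by
    intro X hX Y hY
    induction hY using Submodule.span_induction with
    | mem Y hY => exact h X hX Y hY
    | zero => exact ⟨0, by simp only [map_zero]; exact tendsto_const_nhds⟩
    | add Y Y' _ _ h h' =>
      obtain ⟨c, hc⟩ := h
      obtain ⟨c', hc'⟩ := h'
      exact ⟨c + c', by simp only [map_add]; exact hc.add hc'⟩
    | smul a Y _ h =>
      obtain ⟨c, hc⟩ := h
      exact ⟨a * c, by simp only [map_smul, smul_eq_mul]; exact hc.const_mul a⟩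
  have h2 : ∀ X ∈ S, ∀ Y ∈ S, ∃ c, Filter.Tendsto (fun i => b i X Y) l (𝓝 c) := by
    intro X hX Y hY
    induction hX using Submodule.span_induction with
    | mem X hX => exact h1 X hX Y hY
    | zero => exact ⟨0, by simp only [map_zero, LinearMap.zero_apply]; exact tendsto_const_nhds⟩
    | add X X' _ _ h h' =>
      obtain ⟨c, hc⟩ := h
      obtain ⟨c', hc'⟩ := h'
      exact ⟨c + c', by simp only [map_add, LinearMap.add_apply]; exact hc.add hc'⟩
    | smul a X _ h =>
      obtain ⟨c, hc⟩ := h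
      exact ⟨a * c, by
        simp only [map_smul, smul_eq_mul, LinearMap.smul_apply]; exact hc.const_mul a⟩
  obtain ⟨p, hp⟩ := S.subtype.exists_leftInverse_of_injective
    (LinearMap.ker_eq_bot.2 S.injective_subtype)
  have hp' : ∀ X (hX : X ∈ S), (p X : V) = X := fun X hX =>
    congrArg Subtype.val (congrArg (fun f : S →ₗ[ℝ] S => f ⟨X, hX⟩) hp)
  choose c hc using fun X Y : S => h2 X X.2 Y Y.2
  refine ⟨LinearMap.mk₂ ℝ (fun X Y => c (p X) (p Y)) ?_ ?_ ?_ ?_, fun X hX Y hY => ?_⟩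
  · intro X X' Y
    refine tendsto_nhds_unique (hc _ _) ?_
    simp only [map_add, Submodule.coe_add, LinearMap.add_apply]
    exact (hc _ _).add (hc _ _)
  · intro a X Y
    refine tendsto_nhds_unique (hc _ _) ?_
    simp only [map_smul, Submodule.coe_smul, LinearMap.smul_apply]
    exact (hc _ _).const_smul a
  · intro X Y Y'
    refine tendsto_nhds_unique (hc _ _) ?_
    simp only [map_add, Submodule.coe_add]
    exact (hc _ _).add (hc _ _)
  · intro a X Y
    refine tendsto_nhds_unique (hc _ _) ?_
    simp only [map_smul, Submodule.coe_smul]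
    exact (hc _ _).const_smul a
  · have h3 := hc (p X) (p Y)
    rw [hp' X (Submodule.subset_span hX), hp' Y (Submodule.subset_span hY)] at h3
    exact h3

section PullbackExpansion

variable {E : Type*} [NormedAddCommGroup E] [NormedSpace ℝ E] [FiniteDimensional ℝ E]
  {M : Type*} [TopologicalSpace M] [ChartedSpace E M] [IsManifold 𝓘(ℝ, E) ∞ M]
  {F : Type*} [NormedAddCommGroup F] [NormedSpace ℝ F] [FiniteDimensional ℝ F]
  {B : Type*} [TopologicalSpace B] [ChartedSpace F B] [IsManifold 𝓘(ℝ, F) ∞ B]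
  {ι : C^∞⟮𝓘(ℝ, F), B; 𝓘(ℝ, E), M⟯}

/-- The vectors `τ ∂_r + dP e` form a smooth family, for each parametrization `P`. -/
theorem isSmoothFamily_mfderiv (g : Metric E M) {X : Type*} [NormedAddCommGroup X] [NormedSpace ℝ X]
    {O : Set X} {P : X → AmbientBundle ι} (hO : IsOpen O)
    (hP : ContMDiffOn 𝓘(ℝ, X) (𝓘(ℝ, F).prod 𝓘(ℝ, E)) ∞ P O)
    (hN : ∀ x ∈ O, P x ∈ unitNormalBundle g ι) {x₀ : X} (hx₀ : x₀ ∈ O) (τ : ℝ) (e : X) :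
    IsSmoothFamily g (P x₀) x₀ P
      (fun x => (τ, (mfderiv 𝓘(ℝ, X) (𝓘(ℝ, F).prod 𝓘(ℝ, E)) P x : X →L[ℝ] F × E) e)) := by
  have hP₀ := hP.contMDiffAt (hO.mem_nhds hx₀)
  have hmem : ∀ᶠ x in 𝓝 x₀, (P x).proj ∈ chartDomain ι (P x₀).proj :=
    hP₀.continuousAt.eventually (eventually_mem_chartDomain (mem_chartDomain _))
  have hbase : ContDiffAt ℝ ∞ (fun x => coords (P x₀) (P x)) x₀ :=
    ((contMDiffAt_coords (mem_chartDomain _)).comp x₀ hP₀).contDiffAt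
  refine ⟨hmem, hbase, contDiffAt_const, ?_, ?_⟩
  · have h0 : ContDiffAt ℝ ∞ (fderiv ℝ (fun x => coords (P x₀) (P x))) x₀ :=
      hbase.fderiv_right (by simp)
    have h1 : ContDiffAt ℝ ∞ (fun x => fderiv ℝ (fun x => coords (P x₀) (P x)) x e) x₀ :=
      h0.clm_apply (contDiffAt_const (c := e))
    refine h1.congr_of_eventuallyEq ?_
    filter_upwards [hmem, hO.mem_nhds hx₀] with x hx hxO
    have h2 : HasFDerivAt (fun x => coords (P x₀) (P x)) ((coordsDifferential (P x₀) (P x)).comp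
        (mfderiv 𝓘(ℝ, X) (𝓘(ℝ, F).prod 𝓘(ℝ, E)) P x : X →L[ℝ] F × E) : X →L[ℝ] F × E) x :=
      hasFDerivAt_coords_comp (W₀ := P x₀)
        ((hP.contMDiffAt (hO.mem_nhds hxO)).mdifferentiableAt (by simp)) hx
    exact (congrArg (fun A : X →L[ℝ] F × E => A e) h2.fderiv).symm
  · filter_upwards [hO.mem_nhds hx₀] with x hxO
    exact mfderiv_mem_tangentVectors hO hP hN hxO e

/-- With a dummy parameter in ℝ, the expansion for families gives the limit as r → 0 at a single
tangent vector. -/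
theorem isSmoothFamily_const (g : Metric E M) {W : AmbientBundle ι} {Z : ℝ × F × E}
    (hZ : Z.2 ∈ tangentVectors ι (unitNormalBundle g ι) W) :
    IsSmoothFamily g W (0 : ℝ) (fun _ => W) (fun _ => Z) :=
  ⟨Filter.Eventually.of_forall fun _ => mem_chartDomain _, contDiffAt_const, contDiffAt_const,
    contDiffAt_const, Filter.Eventually.of_forall fun _ => hZ⟩

/-- The rescaled model metric depends smoothly on the parameters of a smooth family. -/
theorem IsSmoothFamily.contDiffAt_correctedModelMetric {X : Type*} [NormedAddCommGroup X]
    [NormedSpace ℝ X] {g : Metric E M} {W₀ : AmbientBundle ι} {x₀ : X} {W : X → AmbientBundle ι}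
    {Z Z' : X → ℝ × F × E} (h : IsSmoothFamily g W₀ x₀ W Z) (h' : IsSmoothFamily g W₀ x₀ W Z')
    (hι : ∀ b, Function.Injective (dιAt ι b)) {r₀ : ℝ} (hr₀ : r₀ ≠ 0) :
    ContDiffAt ℝ ∞ (fun q : ℝ × X =>
      twist g ι (correctedModelMetric g ι) q.1 (W q.2) (Z q.2) (Z' q.2)) (r₀, x₀) := by
  have h1 : ContDiffAt ℝ ∞ (fun q : ℝ × X => 2 * q.1 * NormalBlowUp.secondAt g (W q.2)
      (Z q.2).2.1 (Z' q.2).2.1) (r₀, x₀) :=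
    (contDiffAt_const.mul contDiffAt_fst).mul (h.secondAt h').snd'
  refine ((((h.fst.mul h'.fst).snd'.add (h.inner_normalCovDeriv h' hι).snd').add
    (h.inner_velocity h').snd').sub h1).congr_of_eventuallyEq ?_
  filter_upwards [continuousAt_fst.eventually (isOpen_ne.mem_nhds hr₀)] with q hq
  exact twist_correctedModelMetric g (hι _) hq _ _

/-- The rescaled pulled-back metric depends smoothly on the parameters of a smooth family. -/
theorem IsSmoothFamily.contDiffAt_pullbackMetric {X : Type*} [NormedAddCommGroup X]
    [NormedSpace ℝ X] {g : Metric E M} {W₀ : AmbientBundle ι} {x₀ : X} {W : X → AmbientBundle ι}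
    {Z Z' : X → ℝ × F × E} (h : IsSmoothFamily g W₀ x₀ W Z) (h' : IsSmoothFamily g W₀ x₀ W Z')
    (hW : ContinuousAt W x₀) (hι : ∀ b, Function.Injective (dιAt ι b)) {r₀ : ℝ} (hr₀ : r₀ ≠ 0)
    (hsm : ContMDiffAt (𝓘(ℝ, ℝ).prod (𝓘(ℝ, F).prod 𝓘(ℝ, E))) 𝓘(ℝ, E) ∞ (blowDown g ι)
      (r₀, W x₀)) :
    ContDiffAt ℝ ∞ (fun q : ℝ × X =>
      twist g ι (pullbackMetric g ι) q.1 (W q.2) (Z q.2) (Z' q.2)) (r₀, x₀) := by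
  set Ψ := extChartAt (𝓘(ℝ, F).prod 𝓘(ℝ, E)) W₀ with Ψ_def
  set x₁ := blowDown g ι (r₀, W x₀) with x₁_def
  set φ := extChartAt 𝓘(ℝ, E) x₁ with φ_def
  -- Away from r = 0 the image may leave the chart at ι b₀ where Exp was built. So ℰ is read in a
  -- chart at its own value, and only its assumed smoothness is used.
  set f : ℝ × F × E → E := fun q => φ (blowDown g ι (q.1, Ψ.symm q.2)) with f_def
  have hsrc : ∀ {V : AmbientBundle ι}, V.proj ∈ chartDomain ι W₀.proj → V ∈ Ψ.source := fun hV =>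
    mem_ambient_source_iff.2 hV
  have hW₀ : Ψ.symm (coords W₀ (W x₀)) = W x₀ := Ψ.left_inv (hsrc h.mem.self_of_nhds)
  have hf : ContDiffAt ℝ ∞ f (r₀, coords W₀ (W x₀)) := by
    rw [← contMDiffAt_iff_contDiffAt]
    have h1 : ContMDiffAt 𝓘(ℝ, F × E) (𝓘(ℝ, F).prod 𝓘(ℝ, E)) ∞ Ψ.symm (coords W₀ (W x₀)) :=
      (contMDiffOn_extChartAt_symm (I := 𝓘(ℝ, F).prod 𝓘(ℝ, E)) (n := ∞) W₀).contMDiffAt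
        (extChartAt_target_mem_nhds' (Ψ.map_source (hsrc h.mem.self_of_nhds)))
    have h2 : ContMDiffAt 𝓘(ℝ, ℝ × F × E) (𝓘(ℝ, F).prod 𝓘(ℝ, E)) ∞
        (fun q : ℝ × F × E => Ψ.symm q.2) (r₀, coords W₀ (W x₀)) :=
      ContMDiffAt.comp (g := Ψ.symm) (f := Prod.snd) (r₀, coords W₀ (W x₀)) h1
        contDiff_snd.contMDiff.contMDiffAt
    have h3 : ContMDiffAt 𝓘(ℝ, ℝ × F × E) (𝓘(ℝ, ℝ).prod (𝓘(ℝ, F).prod 𝓘(ℝ, E))) ∞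
        (fun q : ℝ × F × E => (q.1, Ψ.symm q.2)) (r₀, coords W₀ (W x₀)) :=
      ContMDiffAt.prodMk (contDiff_fst.contMDiff.contMDiffAt) h2
    have h4 : ContMDiffAt (𝓘(ℝ, ℝ).prod (𝓘(ℝ, F).prod 𝓘(ℝ, E))) 𝓘(ℝ, E) ∞
        (fun q => φ (blowDown g ι q)) (r₀, W x₀) :=
      ContMDiffAt.comp (g := φ) (r₀, W x₀) contMDiffAt_extChartAt hsm
    exact ContMDiffAt.comp_of_eq (g := fun q => φ (blowDown g ι q))
      (f := fun q : ℝ × F × E => (q.1, Ψ.symm q.2)) h4 h3 (by rw [hW₀])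
  have hloc : ∀ {r : ℝ} {V : AmbientBundle ι}, V.proj ∈ chartDomain ι W₀.proj →
      ∀ᶠ q in 𝓝 (r, V), φ (blowDown g ι q) = f (collarCoords W₀ q) := by
    intro r V hV
    filter_upwards [continuousAt_snd.eventually (eventually_mem_chartDomain hV)] with q hq
    simp only [f_def, collarCoords]
    have h5 : Ψ.symm (coords W₀ q.2) = q.2 := Ψ.left_inv (hsrc hq)
    rw [h5]
  have hcont : ContinuousAt (fun q : ℝ × X => (q.1, W q.2)) (r₀, x₀) :=
    continuousAt_fst.prodMk (ContinuousAt.comp (g := W) (f := Prod.snd) (x := (r₀, x₀)) hW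
      continuousAt_snd)
  have hev1 : ∀ᶠ q : ℝ × X in 𝓝 (r₀, x₀), blowDown g ι (q.1, W q.2) ∈ φ.source ∧
      MDifferentiableAt (𝓘(ℝ, ℝ).prod (𝓘(ℝ, F).prod 𝓘(ℝ, E))) 𝓘(ℝ, E) (blowDown g ι)
        (q.1, W q.2) := by
    refine (ContinuousAt.comp (g := blowDown g ι) (f := fun q : ℝ × X => (q.1, W q.2))
      hsm.continuousAt hcont |>.eventually ((isOpen_extChartAt_source x₁).mem_nhds
        (mem_extChartAt_source x₁))).and ?_
    have h1 : ∀ᶠ q in 𝓝 (r₀, W x₀), ContMDiffAt (𝓘(ℝ, ℝ).prod (𝓘(ℝ, F).prod 𝓘(ℝ, E))) 𝓘(ℝ, E) 1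
        (blowDown g ι) q := by
      have h2 : ContMDiffAt (𝓘(ℝ, ℝ).prod (𝓘(ℝ, F).prod 𝓘(ℝ, E))) 𝓘(ℝ, E) 1 (blowDown g ι)
        (r₀, W x₀) := hsm.of_le (by simp)
      exact (contMDiffAt_iff_contMDiffAt_nhds (by simp)).1 h2
    exact (hcont.eventually h1).mono fun q hq => hq.mdifferentiableAt (by simp)
  have hz : ContDiffAt ℝ ∞ (fun q : ℝ × X => (q.1, coords W₀ (W q.2))) (r₀, x₀) :=
    contDiffAt_fst.prodMk h.base.snd'
  have hev2 : ∀ᶠ q : ℝ × X in 𝓝 (r₀, x₀), DifferentiableAt ℝ f (q.1, coords W₀ (W q.2)) := by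
    have h1 : ∀ᶠ q in 𝓝 (r₀, coords W₀ (W x₀)), ContDiffAt ℝ 1 f q :=
      (hf.of_le (by simp)).eventually (by simp)
    exact (hz.continuousAt.eventually h1).mono fun q hq => hq.differentiableAt (by simp)
  have hG : ContDiffAt ℝ ∞ (fun q : ℝ × X => chartMetric g x₁ (f (q.1, coords W₀ (W q.2))))
      (r₀, x₀) := by
    refine ContDiffAt.comp (g := chartMetric g x₁)
      (f := fun q : ℝ × X => f (q.1, coords W₀ (W q.2))) (r₀, x₀)
      ((isMetricOn_chartMetric g x₁).contDiffAt ?_)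
      (ContDiffAt.comp (g := f) (f := fun q : ℝ × X => (q.1, coords W₀ (W q.2))) (r₀, x₀) hf hz)
    simp only [f_def]
    rw [hW₀]
    exact mem_extChartAt_target x₁
  have hD : ContDiffAt ℝ ∞ (fun q : ℝ × X => fderiv ℝ f (q.1, coords W₀ (W q.2))) (r₀, x₀) :=
    ContDiffAt.comp (g := fderiv ℝ f) (f := fun q : ℝ × X => (q.1, coords W₀ (W q.2))) (r₀, x₀)
      (hf.fderiv_right (m := ∞) (by simp)) hz
  have hinv : ContDiffAt ℝ ∞ (fun q : ℝ × X => q.1⁻¹ - 1) (r₀, x₀) :=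
    (contDiffAt_fst.inv hr₀).sub contDiffAt_const
  have harg : ∀ {Z : X → ℝ × F × E}, IsSmoothFamily g W₀ x₀ W Z →
      ContDiffAt ℝ ∞ (fun q : ℝ × X => ((Z q.2).1, coordsDifferential W₀ (W q.2) (Z q.2).2 +
        (q.1⁻¹ - 1) • ((0 : F), localNormalCovDeriv g ι W₀.proj (coords W₀ (W q.2))
          (coordsDifferential W₀ (W q.2) (Z q.2).2)))) (r₀, x₀) := by
    intro Z h
    have h1 : ContDiffAt ℝ ∞ (fun q : ℝ × X => ((0 : F), localNormalCovDeriv g ι W₀.proj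
        (coords W₀ (W q.2)) (coordsDifferential W₀ (W q.2) (Z q.2).2))) (r₀, x₀) :=
      contDiffAt_const.prodMk (h.normalCovDeriv hι).snd'
    exact h.fst.snd'.prodMk (h.snd.snd'.add (hinv.smul h1))
  refine ((hG.clm_apply (hD.clm_apply (harg h))).clm_apply
    (hD.clm_apply (harg h'))).congr_of_eventuallyEq ?_
  filter_upwards [hev1, hev2, (continuousAt_snd (p := (r₀, x₀))).eventually h.mem] with q h1 h2 h3
  exact twist_pullbackMetric g hι h3 h1.1 h1.2 h2 (hloc h3) _ _

end PullbackExpansion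

/-! ### The second-order remainder and its extension to r = 0. -/

section SecondOrder

variable {E : Type*} [NormedAddCommGroup E] [NormedSpace ℝ E] [FiniteDimensional ℝ E]
  {M : Type*} [TopologicalSpace M] [ChartedSpace E M] [IsManifold 𝓘(ℝ, E) ∞ M]
  {F : Type*} [NormedAddCommGroup F] [NormedSpace ℝ F] [FiniteDimensional ℝ F]
  {B : Type*} [TopologicalSpace B] [ChartedSpace F B] [IsManifold 𝓘(ℝ, F) ∞ B]
  {ι : C^∞⟮𝓘(ℝ, F), B; 𝓘(ℝ, E), M⟯}

/-- The difference quotient `r⁻² (g₁^φ - ĥ₁^φ)`. -/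
def differenceForm (g : Metric E M) (ι : C^∞⟮𝓘(ℝ, F), B; 𝓘(ℝ, E), M⟯) : CollarForm ι :=
  fun r W => (r ^ 2)⁻¹ • (twist g ι (pullbackMetric g ι) r W -
    twist g ι (correctedModelMetric g ι) r W)

theorem differenceForm_apply (g : Metric E M) (r : ℝ) (W : AmbientBundle ι) (X Y : ℝ × F × E) :
    differenceForm g ι r W X Y = (r ^ 2)⁻¹ * (twist g ι (pullbackMetric g ι) r W X Y -
      twist g ι (correctedModelMetric g ι) r W X Y) := rfl

theorem IsSmoothFamily.exists_differenceForm_eq [T2Space M] {X : Type} [NormedAddCommGroup X]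
    [NormedSpace ℝ X] {g : Metric E M} {W₀ : AmbientBundle ι} {x₀ : X} {W : X → AmbientBundle ι}
    {Z Z' : X → ℝ × F × E} (h : IsSmoothFamily g W₀ x₀ W Z) (h' : IsSmoothFamily g W₀ x₀ W Z')
    (hW₀ : (W x₀).proj = W₀.proj) (hι : ∀ b, Function.Injective (dιAt ι b)) :
    ∃ k : ℝ × X → ℝ, ContDiffAt ℝ ∞ k (0, x₀) ∧ ∀ᶠ q in 𝓝 ((0 : ℝ), x₀), q.1 ≠ 0 →
      differenceForm g ι q.1 (W q.2) (Z q.2) (Z' q.2) = k q := by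
  obtain ⟨k, hk, hev⟩ := h.exists_expansion h' hW₀ hι
  refine ⟨k, hk, hev.mono fun q hq hr => ?_⟩
  rw [differenceForm_apply, hq hr]
  field_simp
  ring

/-- The boundary value has to be a bilinear form on the whole fibre, whereas the expansion provides
limits only for pairs of tangent vectors; `exists_bilinForm_tendsto` fills the gap. -/
theorem tendsto_differenceForm [T2Space M] (g : Metric E M)
    (hι : ∀ b, Function.Injective (dιAt ι b)) (W : AmbientBundle ι) :
    ∃ β : LinearMap.BilinForm ℝ (CollarTangent ι W),
      ∀ X ∈ collarTangentVectors ι (unitNormalBundle g ι) W,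
      ∀ Y ∈ collarTangentVectors ι (unitNormalBundle g ι) W,
        Filter.Tendsto (fun r => differenceForm g ι r W X Y) (𝓝[>] 0) (𝓝 (β X Y)) := by
  refine exists_bilinForm_tendsto (fun r => differenceForm g ι r W) _ fun X hX Y hY => ?_
  obtain ⟨k, hk, hev⟩ := (isSmoothFamily_const g hX).exists_differenceForm_eq
    (isSmoothFamily_const g hY) rfl hι
  refine ⟨k (0, 0), ?_⟩
  have h1 : Filter.Tendsto (fun r : ℝ => (r, (0 : ℝ))) (𝓝[>] 0) (𝓝 (0, 0)) :=
    ((continuous_id.prodMk continuous_const).tendsto' _ _ rfl).mono_left nhdsWithin_le_nhds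
  refine (hk.continuousAt.tendsto.comp h1).congr' ?_
  filter_upwards [h1.eventually hev, self_mem_nhdsWithin] with r hr hr0
  exact (hr (ne_of_gt hr0)).symm

open Classical in
/-- The difference quotient `r⁻² (g₁^φ - ĥ₁^φ)`, extended to `r = 0` by its limit. -/
def extendedDifferenceForm [T2Space M] (g : Metric E M) (hι : ∀ b, Function.Injective (dιAt ι b)) :
    CollarForm ι :=
  fun r W => if r = 0 then (tendsto_differenceForm g hι W).choose else differenceForm g ι r W

theorem extendedDifferenceForm_of_ne [T2Space M] (g : Metric E M)
    (hι : ∀ b, Function.Injective (dιAt ι b)) {r : ℝ} (hr : r ≠ 0) (W : AmbientBundle ι) :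
    extendedDifferenceForm g hι r W = differenceForm g ι r W := if_neg hr

theorem tendsto_extendedDifferenceForm [T2Space M] (g : Metric E M)
    (hι : ∀ b, Function.Injective (dιAt ι b)) {W : AmbientBundle ι} {X Y : ℝ × F × E}
    (hX : X ∈ collarTangentVectors ι (unitNormalBundle g ι) W)
    (hY : Y ∈ collarTangentVectors ι (unitNormalBundle g ι) W) :
    Filter.Tendsto (fun r => differenceForm g ι r W X Y) (𝓝[>] 0)
      (𝓝 (extendedDifferenceForm g hι 0 W X Y)) := by
  have h : extendedDifferenceForm g hι 0 W = (tendsto_differenceForm g hι W).choose := if_pos rfl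
  rw [h]
  exact (tendsto_differenceForm g hι W).choose_spec X hX Y hY

theorem differenceForm_symm (g : Metric E M) (hι : ∀ b, Function.Injective (dιAt ι b)) {r : ℝ}
    (hr : r ≠ 0) (W : AmbientBundle ι) (X Y : ℝ × F × E) :
    differenceForm g ι r W X Y = differenceForm g ι r W Y X := by
  have h : ∀ X Y : ℝ × F × E, twist g ι (pullbackMetric g ι) r W X Y =
    innerAt g (blowDown g ι (r, W)) (dBlowDownAt g r W (scaleVertical g ι r⁻¹ W X))
      (dBlowDownAt g r W (scaleVertical g ι r⁻¹ W Y)) := fun X Y => rfl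
  rw [differenceForm_apply, differenceForm_apply, h X Y, h Y X,
    innerAt_symm g _ (dBlowDownAt g r W (scaleVertical g ι r⁻¹ W X)),
    twist_correctedModelMetric g (hι _) hr, twist_correctedModelMetric g (hι _) hr,
    innerAt_symm g _ (normalCovDerivAt g W X.2), innerAt_symm g _ (dιAt ι W.proj X.2.1),
    secondAt_symm, mul_comm X.1]

theorem extendedDifferenceForm_symm [T2Space M] (g : Metric E M)
    (hι : ∀ b, Function.Injective (dιAt ι b)) (r : ℝ) {W : AmbientBundle ι} {X Y : ℝ × F × E}
    (hX : X ∈ collarTangentVectors ι (unitNormalBundle g ι) W)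
    (hY : Y ∈ collarTangentVectors ι (unitNormalBundle g ι) W) :
    extendedDifferenceForm g hι r W X Y = extendedDifferenceForm g hι r W Y X := by
  by_cases hr : r = 0
  · rw [hr]
    refine tendsto_nhds_unique (tendsto_extendedDifferenceForm g hι hX hY)
      ((tendsto_extendedDifferenceForm g hι hY hX).congr' ?_)
    filter_upwards [self_mem_nhdsWithin] with s hs
    exact differenceForm_symm g hι (ne_of_gt hs) W Y X
  · rw [extendedDifferenceForm_of_ne g hι hr]
    exact differenceForm_symm g hι hr W X Y

/-- The extended difference quotient is smooth near `r = 0` along smooth families. -/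
theorem IsSmoothFamily.contDiffWithinAt_extendedDifferenceForm [T2Space M] {X : Type}
    [NormedAddCommGroup X] [NormedSpace ℝ X] {g : Metric E M} {W₀ : AmbientBundle ι} {x₀ : X}
    {W : X → AmbientBundle ι} {Z Z' : X → ℝ × F × E} (h : IsSmoothFamily g W₀ x₀ W Z)
    (h' : IsSmoothFamily g W₀ x₀ W Z') (hW₀ : (W x₀).proj = W₀.proj)
    (hι : ∀ b, Function.Injective (dιAt ι b)) {S : Set (ℝ × X)} :
    ContDiffWithinAt ℝ ∞ (fun q : ℝ × X =>
      extendedDifferenceForm g hι q.1 (W q.2) (Z q.2) (Z' q.2)) S (0, x₀) := by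
  obtain ⟨k, hk, hev⟩ := h.exists_differenceForm_eq h' hW₀ hι
  refine (hk.congr_of_eventuallyEq ?_).contDiffWithinAt
  have hk1 : ∀ᶠ q in 𝓝 ((0 : ℝ), x₀), ContDiffAt ℝ 1 k q :=
    (hk.of_le (by simp)).eventually (by simp)
  have hsnd : ∀ {P : X → Prop}, (∀ᶠ x in 𝓝 x₀, P x) → ∀ᶠ q : ℝ × X in 𝓝 ((0 : ℝ), x₀), P q.2 :=
    fun hP => (continuousAt_snd (p := ((0 : ℝ), x₀))).eventually hP
  -- At a boundary point (0, x) near (0, x₀) the extended value is a limit from r > 0. Comparing it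
  -- with k requires the identity in a neighbourhood of that point, and continuity of k there.
  filter_upwards [hev.eventually_nhds, hk1, hsnd h.tangent, hsnd h'.tangent] with q hq hkq hZ hZ'
  obtain ⟨r, x⟩ := q
  by_cases hr : r = 0
  · subst hr
    have h1 : Filter.Tendsto (fun r : ℝ => (r, x)) (𝓝[>] 0) (𝓝 (0, x)) :=
      ((continuous_id.prodMk continuous_const).tendsto' _ _ rfl).mono_left nhdsWithin_le_nhds
    refine tendsto_nhds_unique (tendsto_extendedDifferenceForm g hι hZ hZ')
      ((hkq.continuousAt.tendsto.comp h1).congr' ?_)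
    filter_upwards [h1.eventually hq, self_mem_nhdsWithin] with s hs hs0
    exact (hs (ne_of_gt hs0)).symm
  · exact (congrArg (fun b : LinearMap.BilinForm ℝ (CollarTangent ι (W x)) => b (Z x) (Z' x))
      (extendedDifferenceForm_of_ne g hι hr (W x))).trans (hq.self_of_nhds hr)

theorem isSmoothForm_extendedDifferenceForm [T2Space M] (g : Metric E M)
    (hι : ∀ b, Function.Injective (dιAt ι b)) {ε : ℝ} (hε : IsCollarWidth g ι ε) :
    IsSmoothForm ι (unitNormalBundle g ι) ε (extendedDifferenceForm g hι) := by
  intro n O P hO hP hN τ τ' e e' q₀ hq₀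
  obtain ⟨r₀, x₀⟩ := q₀
  obtain ⟨hr₀, hx₀⟩ := hq₀
  have hZ := isSmoothFamily_mfderiv g hO hP hN hx₀ τ e
  have hZ' := isSmoothFamily_mfderiv g hO hP hN hx₀ τ' e'
  by_cases hr : r₀ = 0
  · subst hr
    exact hZ.contDiffWithinAt_extendedDifferenceForm hZ' rfl hι
  · have h1 := hZ.contDiffAt_correctedModelMetric hZ' hι hr
    have h2 := hZ.contDiffAt_pullbackMetric hZ' (hP.continuousOn.continuousAt (hO.mem_nhds hx₀)) hι
      hr (hε.smooth r₀ hr₀ _ (hN _ hx₀))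
    have h3 : ContDiffAt ℝ ∞ (fun q : ℝ × EuclideanSpace ℝ (Fin n) => (q.1 ^ 2)⁻¹) (r₀, x₀) :=
      (contDiffAt_fst.pow 2).inv (pow_ne_zero 2 hr)
    refine ContDiffAt.contDiffWithinAt ((h3.mul (h2.sub h1)).congr_of_eventuallyEq ?_)
    filter_upwards [continuousAt_fst.eventually (isOpen_ne.mem_nhds hr)] with q hq
    exact congrArg (fun b : LinearMap.BilinForm ℝ (CollarTangent ι (P q.2)) => b _ _)
      (extendedDifferenceForm_of_ne g hι hq (P q.2))

/-- The pulled-back metric is a second-order perturbation of the corrected model metric. -/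
theorem isPerturbation_pullbackMetric [T2Space M] (g : Metric E M)
    (hι : ∀ b, Function.Injective (dιAt ι b)) {ε : ℝ} (hε : IsCollarWidth g ι ε) :
    IsPerturbation g ι 2 ε (correctedModelMetric g ι) (pullbackMetric g ι) where
  symm r _ W _ X _ Y _ := innerAt_symm g (blowDown g ι (r, W)) (dBlowDownAt g r W X)
    (dBlowDownAt g r W Y)
  pos r hr W hW X hX hX0 := innerAt_self_pos g (blowDown g ι (r, W))
    (v := dBlowDownAt g r W X) fun h => hX0 (hε.immersive r hr W hW X hX h)
  expansion := by
    refine ⟨extendedDifferenceForm g hι, isSmoothForm_extendedDifferenceForm g hι hε,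
      fun r _ W _ X hX Y hY => extendedDifferenceForm_symm g hι r hX hY,
      fun r hr W _ X _ Y _ => ?_⟩
    have hr0 : r ≠ 0 := hr.1.ne'
    rw [extendedDifferenceForm_of_ne g hι hr0]
    refine (eq_add_of_sub_eq' ?_)
    refine Eq.trans ?_ (congrArg (r ^ 2 * ·) (differenceForm_apply g r W X Y).symm)
    exact (mul_inv_cancel_left₀ (pow_ne_zero 2 hr0) _).symm

end SecondOrder

/-! ## Compactness of the unit normal bundle -/

/-- A positive definite bilinear form has a positive lower bound, locally uniformly in the form. -/
theorem exists_eventually_mul_sq_norm_le {V : Type*} [NormedAddCommGroup V] [NormedSpace ℝ V]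
    [FiniteDimensional ℝ V] {b₀ : V →L[ℝ] V →L[ℝ] ℝ} (hb₀ : ∀ v, v ≠ 0 → 0 < b₀ v v) :
    ∃ δ : ℝ, 0 < δ ∧ ∀ᶠ b in 𝓝 b₀, ∀ v, δ * ‖v‖ ^ 2 ≤ b v v := by
  have := FiniteDimensional.proper ℝ V
  obtain ⟨m, hm, hle⟩ := (isCompact_sphere (0 : V) 1).exists_forall_le' (f := fun v => b₀ v v)
    (a := 0) (by fun_prop) fun v hv => hb₀ v (ne_zero_of_mem_unit_sphere ⟨v, hv⟩)
  refine ⟨m / 2, half_pos hm, ?_⟩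
  have hlow : ∀ v, m * ‖v‖ ^ 2 ≤ b₀ v v := by
    intro v
    by_cases hv : v = 0
    · simp [hv]
    have hv' : ‖v‖ ≠ 0 := norm_ne_zero_iff.2 hv
    have h1 := hle (‖v‖⁻¹ • v) (by simp [norm_smul, hv'])
    simp only [map_smul, smul_apply, smul_eq_mul] at h1
    calc m * ‖v‖ ^ 2 ≤ (‖v‖⁻¹ * (‖v‖⁻¹ * b₀ v v)) * ‖v‖ ^ 2 := by gcongr
      _ = b₀ v v := by field_simp
  filter_upwards [Metric.ball_mem_nhds b₀ (half_pos hm)] with b hb v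
  have h1 : |(b - b₀) v v| ≤ m / 2 * ‖v‖ ^ 2 := by
    refine ((b - b₀).le_opNorm₂ v v).trans ?_
    rw [mul_assoc, ← sq]
    gcongr
    rw [← dist_eq_norm]
    exact hb.le
  rw [sub_apply, sub_apply] at h1
  linarith [neg_le_of_abs_le h1, hlow v]

section Compactness

variable {E : Type*} [NormedAddCommGroup E] [NormedSpace ℝ E] [FiniteDimensional ℝ E]
  {M : Type*} [TopologicalSpace M] [ChartedSpace E M] [IsManifold 𝓘(ℝ, E) ∞ M]
  {F : Type*} [NormedAddCommGroup F] [NormedSpace ℝ F] [FiniteDimensional ℝ F]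
  {B : Type*} [TopologicalSpace B] [ChartedSpace F B] [IsManifold 𝓘(ℝ, F) ∞ B]
  {ι : C^∞⟮𝓘(ℝ, F), B; 𝓘(ℝ, E), M⟯}

theorem contDiffAt_constraint (g : Metric E M) {b₀ : B} {z : F × E}
    (hz : z.1 ∈ localDomain ι b₀) : ContDiffAt ℝ ∞ (constraint g ι b₀) z := by
  obtain ⟨y, w⟩ := z
  have h1 : ContDiffAt ℝ ∞ (fun z : F × E => chartMetric g (ι b₀) (localMap ι b₀ z.1)) (y, w) :=
    (contDiffAt_chartMetric_localMap g hz).fst'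
  have h2 : ContDiffAt ℝ ∞ (fun z : F × E => fderiv ℝ (localMap ι b₀) z.1) (y, w) :=
    (contDiffAt_fderiv_localMap hz).fst'
  have h3 := h1.clm_apply (contDiffAt_snd (p := (y, w)))
  exact (h3.clm_apply contDiffAt_snd).prodMk (h3.clm_comp h2)

/-- Convergence in `TM|_B` can be checked in a chart. -/
theorem tendsto_ambient_of_coords {α : Type*} {l : Filter α} {W : α → AmbientBundle ι}
    {W₀ W₁ : AmbientBundle ι} (hW : ∀ᶠ a in l, (W a).proj ∈ chartDomain ι W₀.proj)
    (hW₁ : W₁.proj ∈ chartDomain ι W₀.proj)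
    (h : Filter.Tendsto (fun a => coords W₀ (W a)) l (𝓝 (coords W₀ W₁))) :
    Filter.Tendsto W l (𝓝 W₁) := by
  have h1 := (continuousAt_extChartAt_symm' (I := 𝓘(ℝ, F).prod 𝓘(ℝ, E))
    (mem_ambient_source_iff.2 hW₁)).tendsto
  rw [(extChartAt (𝓘(ℝ, F).prod 𝓘(ℝ, E)) W₀).left_inv (mem_ambient_source_iff.2 hW₁)] at h1
  refine (h1.comp h).congr' ?_
  filter_upwards [hW] with a ha
  exact (extChartAt (𝓘(ℝ, F).prod 𝓘(ℝ, E)) W₀).left_inv (mem_ambient_source_iff.2 ha)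

/-- The unit normal bundle of a compact manifold is compact. -/
theorem isCompact_unitNormalBundle [CompactSpace B] (g : Metric E M) :
    IsCompact (unitNormalBundle g ι) := by
  have := FiniteDimensional.proper ℝ E
  rw [isCompact_iff_ultrafilter_le_nhds]
  intro f hf
  have hfN : ∀ᶠ W in (f : Filter (AmbientBundle ι)), W ∈ unitNormalBundle g ι :=
    Filter.le_principal_iff.1 hf
  obtain ⟨b₀, -, hb₀⟩ := isCompact_iff_ultrafilter_le_nhds.1 (isCompact_univ (X := B))
    (f.map fun W => W.proj) (by simp)
  have hproj : Filter.Tendsto (fun W : AmbientBundle ι => W.proj) f (𝓝 b₀) := hb₀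
  set W₀ : AmbientBundle ι := ⟨b₀, (0 : E)⟩ with W₀_def
  have hdom : ∀ᶠ W in (f : Filter (AmbientBundle ι)), W.proj ∈ chartDomain ι W₀.proj :=
    hproj.eventually ((isOpen_chartDomain b₀).mem_nhds (mem_chartDomain b₀))
  have hy₀ : extChartAt 𝓘(ℝ, F) b₀ b₀ ∈ localDomain ι b₀ := mem_localDomain (mem_chartDomain b₀)
  have hfst : Filter.Tendsto (fun W => (coords W₀ W).1) f (𝓝 (extChartAt 𝓘(ℝ, F) b₀ b₀)) := by
    refine ((continuousAt_extChartAt (I := 𝓘(ℝ, F)) b₀).tendsto.comp hproj).congr' ?_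
    filter_upwards [hdom] with W hW
    exact (coords_fst hW).symm
  obtain ⟨δ, hδ, hlow⟩ := exists_eventually_mul_sq_norm_le
    ((isMetricOn_chartMetric g (ι b₀)).pos _ (localMap_mem_target hy₀))
  -- The base points converge since B is compact. Near the limit δ‖w‖² ≤ G(w, w) = 1, so ‖w‖² ≤ δ⁻¹
  -- and thus ‖w‖ ≤ δ⁻¹ + 1; the fibre coordinates then converge along the ultrafilter too.
  have hball : ∀ᶠ W in (f : Filter (AmbientBundle ι)),
      (coords W₀ W).2 ∈ Metric.closedBall (0 : E) (δ⁻¹ + 1) := by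
    filter_upwards [hfN, hdom, ((contDiffAt_chartMetric_localMap g hy₀).continuousAt.tendsto.comp
      hfst).eventually hlow] with W hWN hW hle
    have h1 := congrArg Prod.fst ((mem_unitNormalBundle_iff_constraint g hW).1 hWN)
    have h2 := (hle (coords W₀ W).2).trans_eq h1
    rw [mem_closedBall_zero_iff]
    have h3 : ‖(coords W₀ W).2‖ ^ 2 ≤ δ⁻¹ := by
      rw [← one_div, le_div_iff₀' hδ]
      exact h2
    nlinarith [norm_nonneg (coords W₀ W).2, inv_pos.2 hδ]
  obtain ⟨w, -, hw⟩ := isCompact_iff_ultrafilter_le_nhds.1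
    (isCompact_closedBall (0 : E) (δ⁻¹ + 1)) (f.map fun W => (coords W₀ W).2)
    (Filter.le_principal_iff.2 hball)
  have hsnd : Filter.Tendsto (fun W => (coords W₀ W).2) f (𝓝 w) := hw
  set W₁ : AmbientBundle ι := ⟨b₀, w⟩ with W₁_def
  have hW₁ : W₁.proj ∈ chartDomain ι W₀.proj := mem_chartDomain b₀
  have hc₁ : coords W₀ W₁ = (extChartAt 𝓘(ℝ, F) b₀ b₀, w) := by
    rw [coords_apply hW₁]
    exact Prod.ext rfl (chartDifferential_self _ _)
  have hlim : Filter.Tendsto (fun W => coords W₀ W) f (𝓝 (coords W₀ W₁)) := by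
    rw [hc₁]
    exact hfst.prodMk_nhds hsnd
  refine ⟨W₁, ?_, tendsto_ambient_of_coords hdom hW₁ hlim⟩
  rw [mem_unitNormalBundle_iff_constraint g hW₁]
  refine tendsto_nhds_unique
    ((contDiffAt_constraint g (coords_fst_mem hW₁)).continuousAt.tendsto.comp hlim) ?_
  refine tendsto_const_nhds.congr' ?_
  filter_upwards [hdom, hfN] with W hW hWN
  exact ((mem_unitNormalBundle_iff_constraint g hW).1 hWN).symm

/-- A property of the points of `ℝ × S(νB)` which holds near each point of `0 × S(νB)` holds for all
small `r`. -/
theorem eventually_forall_unitNormalBundle [CompactSpace B] (g : Metric E M)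
    {p : ℝ → AmbientBundle ι → Prop}
    (hp : ∀ W₀ ∈ unitNormalBundle g ι, ∀ᶠ q : ℝ × AmbientBundle ι in 𝓝 (0, W₀), p q.1 q.2) :
    ∃ ε > 0, ∀ r, |r| < ε → ∀ W ∈ unitNormalBundle g ι, p r W := by
  have h := (isCompact_unitNormalBundle (ι := ι) g).eventually_forall_of_forall_eventually
    (x₀ := (0 : ℝ)) (P := p) hp
  obtain ⟨ε, hε, h⟩ := Metric.eventually_nhds_iff.1 h
  exact ⟨ε, hε, fun r hr => h (by simpa using hr)⟩

end Compactness

/-! ## Existence of a collar -/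

section Collar

variable {E : Type*} [NormedAddCommGroup E] [NormedSpace ℝ E] [FiniteDimensional ℝ E]
  {M : Type*} [TopologicalSpace M] [ChartedSpace E M] [IsManifold 𝓘(ℝ, E) ∞ M]
  {F : Type*} [NormedAddCommGroup F] [NormedSpace ℝ F] [FiniteDimensional ℝ F]
  {B : Type*} [TopologicalSpace B] [ChartedSpace F B] [IsManifold 𝓘(ℝ, F) ∞ B]
  {ι : C^∞⟮𝓘(ℝ, F), B; 𝓘(ℝ, E), M⟯}

theorem continuousAt_collarCoords (r : ℝ) (W₀ : AmbientBundle ι) :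
    ContinuousAt (collarCoords W₀) (r, W₀) :=
  (contMDiffAt_collarCoords (mem_chartDomain _)).continuousAt

theorem eventually_snd_mem_chartDomain (r : ℝ) (W₀ : AmbientBundle ι) :
    ∀ᶠ q : ℝ × AmbientBundle ι in 𝓝 (r, W₀), q.2.proj ∈ chartDomain ι W₀.proj := by
  have h : Filter.Tendsto Prod.snd (𝓝 (r, W₀)) (𝓝 W₀) := continuousAt_snd
  exact h.eventually (eventually_mem_chartDomain (mem_chartDomain (ι := ι) W₀.proj))

theorem coordsDifferential_injective {W₀ W : AmbientBundle ι}
    (hW : W.proj ∈ chartDomain ι W₀.proj) : Function.Injective (coordsDifferential W₀ W) :=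
  chartDifferential_injective (mem_ambient_source_iff.2 hW)

/-- Near the zero section, the exponential map of the ambient manifold is defined along normal
vectors. -/
theorem eventually_localBlowDown_mem {Exp : E × E → E} {N : Set (E × E)} {G : E → E →L[ℝ] E →L[ℝ] ℝ}
    {U : Set E} (hE : IsExponential G U Exp N) (W₀ : AmbientBundle ι)
    (h0 : (localMap ι W₀.proj (extChartAt 𝓘(ℝ, F) W₀.proj W₀.proj), 0) ∈ N) :
    ∀ᶠ q : ℝ × F × E in 𝓝 (0, coords W₀ W₀), q.2.1 ∈ localDomain ι W₀.proj ∧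
      (localMap ι W₀.proj q.2.1, q.1 • q.2.2) ∈ N := by
  have hy : (coords W₀ W₀).1 ∈ localDomain ι W₀.proj := coords_fst_mem (mem_chartDomain _)
  have h1 : ContinuousAt (fun q : ℝ × F × E => q.2.1) (0, coords W₀ W₀) := by fun_prop
  have h2 : ContinuousAt (fun q : ℝ × F × E => localMap ι W₀.proj q.2.1) (0, coords W₀ W₀) :=
    ContinuousAt.comp (g := localMap ι W₀.proj) (f := fun q : ℝ × F × E => q.2.1)
      (x := (0, coords W₀ W₀)) (contDiffAt_localMap_of_mem hy).continuousAt h1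
  have h3 : ContinuousAt (fun q : ℝ × F × E => (localMap ι W₀.proj q.2.1, q.1 • q.2.2))
      (0, coords W₀ W₀) := h2.prodMk (by fun_prop)
  refine (h1.eventually ((isOpen_localDomain _).mem_nhds hy)).and
    (h3.eventually (hE.isOpen.mem_nhds ?_))
  simp only [zero_smul]
  rw [coords_fst (mem_chartDomain _)]
  exact h0

/-- Auxiliary linear map, injective on a neighbourhood of the zero section, which restricts to the
differential of the normal exponential map on the vectors `(τ, u, p)` with `p` a multiple of the
derivative of the normal vector. -/
def collarOperator (g : Metric E M) (ι : C^∞⟮𝓘(ℝ, F), B; 𝓘(ℝ, E), M⟯) (b₀ : B) (Exp : E × E → E)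
    (q : ℝ × F × E) : ℝ × F × E →L[ℝ] E × ℝ × (F →L[ℝ] ℝ) :=
  ((fderiv ℝ Exp (localMap ι b₀ q.2.1, q.1 • q.2.2)).comp
    (((fderiv ℝ (localMap ι b₀) q.2.1).comp
      ((ContinuousLinearMap.fst ℝ F E).comp (ContinuousLinearMap.snd ℝ ℝ (F × E)))).prod
      ((ContinuousLinearMap.fst ℝ ℝ (F × E)).smulRight q.2.2 +
        (ContinuousLinearMap.snd ℝ F E).comp (ContinuousLinearMap.snd ℝ ℝ (F × E))))).prod
  ((fderiv ℝ (constraint g ι b₀) q.2).comp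
    ((q.1 • (ContinuousLinearMap.fst ℝ F E).comp (ContinuousLinearMap.snd ℝ ℝ (F × E))).prod
      ((ContinuousLinearMap.snd ℝ F E).comp (ContinuousLinearMap.snd ℝ ℝ (F × E)))))

theorem collarOperator_apply (g : Metric E M) (b₀ : B) (Exp : E × E → E) (q X : ℝ × F × E) :
    collarOperator g ι b₀ Exp q X = (fderiv ℝ Exp (localMap ι b₀ q.2.1, q.1 • q.2.2)
      (fderiv ℝ (localMap ι b₀) q.2.1 X.2.1, X.1 • q.2.2 + X.2.2),
      fderiv ℝ (constraint g ι b₀) q.2 (q.1 • X.2.1, X.2.2)) := rfl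

theorem continuousAt_collarOperator (g : Metric E M) {Exp : E × E → E} {N : Set (E × E)}
    {G : E → E →L[ℝ] E →L[ℝ] ℝ} {U : Set E} (hE : IsExponential G U Exp N) {b₀ : B}
    {q : ℝ × F × E} (hq : q.2.1 ∈ localDomain ι b₀)
    (hN : (localMap ι b₀ q.2.1, q.1 • q.2.2) ∈ N) :
    ContinuousAt (collarOperator g ι b₀ Exp) q := by
  rw [continuousAt_clm_apply]
  intro X
  have h1 : ContinuousAt (fun q : ℝ × F × E => q.2.1) q := by fun_prop
  have h2 : ContinuousAt (fun q : ℝ × F × E => localMap ι b₀ q.2.1) q :=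
    ContinuousAt.comp (g := localMap ι b₀) (f := fun q : ℝ × F × E => q.2.1)
      (x := q) (contDiffAt_localMap_of_mem hq).continuousAt h1
  have h3 : ContinuousAt (fun q : ℝ × F × E => (localMap ι b₀ q.2.1, q.1 • q.2.2)) q :=
    h2.prodMk (by fun_prop)
  have h4 : ContinuousAt (fun q : ℝ × F × E => fderiv ℝ (localMap ι b₀) q.2.1) q :=
    ContinuousAt.comp (g := fderiv ℝ (localMap ι b₀)) (f := fun q : ℝ × F × E => q.2.1)
      (x := q) (contDiffAt_fderiv_localMap hq).continuousAt h1
  have h5 : ContinuousAt (fderiv ℝ Exp) (localMap ι b₀ q.2.1, q.1 • q.2.2) :=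
    ((hE.contDiffAt _ hN).fderiv_right (m := 0) (by simp)).continuousAt
  have h6 : ContinuousAt (fun q : ℝ × F × E => fderiv ℝ Exp
      (localMap ι b₀ q.2.1, q.1 • q.2.2)) q :=
    ContinuousAt.comp (g := fderiv ℝ Exp)
      (f := fun q : ℝ × F × E => (localMap ι b₀ q.2.1, q.1 • q.2.2)) (x := q) h5 h3
  have h7 : ContinuousAt (fderiv ℝ (constraint g ι b₀)) q.2 :=
    ((contDiffAt_constraint g hq).fderiv_right (m := 0) (by simp)).continuousAt
  have h8 : ContinuousAt (fun q : ℝ × F × E => fderiv ℝ (constraint g ι b₀) q.2) q :=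
    ContinuousAt.comp (g := fderiv ℝ (constraint g ι b₀)) (f := Prod.snd) (x := q) h7
      continuousAt_snd
  have h9 : ContinuousAt (fun q : ℝ × F × E => (fderiv ℝ (localMap ι b₀) q.2.1 X.2.1,
      X.1 • q.2.2 + X.2.2)) q :=
    (h4.clm_apply continuousAt_const).prodMk (by fun_prop)
  have h10 : ContinuousAt (fun q : ℝ × F × E => (q.1 • X.2.1, X.2.2)) q := by fun_prop
  exact (h6.clm_apply h9).prodMk (h8.clm_apply h10)

/-- At r = 0 the second block says that p is orthogonal to w and to the image of Dc. The first block
is then Dc u + τ w + p = 0 with three mutually orthogonal terms, so each vanishes. -/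
theorem injective_collarOperator (g : Metric E M) (hι : ∀ b, Function.Injective (dιAt ι b))
    {Exp : E × E → E} {N : Set (E × E)} {W₀ : AmbientBundle ι}
    (hE : IsExponential (chartMetric g (ι W₀.proj)) (extChartAt 𝓘(ℝ, E) (ι W₀.proj)).target Exp N)
    (h0 : (localMap ι W₀.proj (extChartAt 𝓘(ℝ, F) W₀.proj W₀.proj), 0) ∈ N)
    (hW₀ : W₀ ∈ unitNormalBundle g ι) :
    Function.Injective (collarOperator g ι W₀.proj Exp (0, coords W₀ W₀)) := by
  have hm := mem_chartDomain (ι := ι) W₀.proj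
  have hy : (coords W₀ W₀).1 ∈ localDomain ι W₀.proj := coords_fst_mem hm
  have hG := isMetricOn_chartMetric g (ι W₀.proj)
  have hU := localMap_mem_target hy
  rw [← coords_fst hm] at h0
  have hcon := (mem_unitNormalBundle_iff_constraint g hm).1 hW₀
  obtain ⟨L, hL, hL'⟩ := hasFDerivAt_constraint g (z := coords W₀ W₀) hy
  set z := coords W₀ W₀ with z_def
  set G := chartMetric g (ι W₀.proj) (localMap ι W₀.proj z.1) with G_def
  set D := fderiv ℝ (localMap ι W₀.proj) z.1 with D_def
  have hw : G z.2 z.2 = 1 := congrArg Prod.fst hcon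
  have hwD : ∀ v, G z.2 (D v) = 0 := fun v =>
    congrArg (fun l : ℝ × (F →L[ℝ] ℝ) => l.2 v) hcon
  have hs : ∀ u v, G u v = G v u := hG.symm _ hU
  rw [injective_iff_map_eq_zero]
  rintro ⟨τ, u, p⟩ hX
  rw [collarOperator_apply, hL.fderiv, Prod.mk_eq_zero] at hX
  obtain ⟨h1, h2⟩ := hX
  simp only [zero_smul] at h1 h2
  replace h1 : D u + (τ • z.2 + p) = 0 := (hE.fderiv_zero _ h0 _ _).symm.trans h1
  obtain ⟨h3, h4⟩ := hL' (0, p)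
  rw [h2] at h3 h4
  simp only [map_zero, zero_apply, add_zero] at h3 h4
  have hpw : G p z.2 = 0 := by linarith [show (0 : ℝ) = 2 * G p z.2 from h3]
  have hpD : ∀ v, G p (D v) = 0 := fun v => (h4 v).symm
  have hpair : ∀ a, G a (D u) + (τ * G a z.2 + G a p) = 0 := fun a => by
    rw [← smul_eq_mul, ← map_smul, ← map_add, ← map_add, h1, map_zero]
  have hτ : τ = 0 := by
    have h5 := hpair z.2
    rw [hwD, hw, hs z.2 p, hpw] at h5
    linarith
  have hp : p = 0 := by
    refine hG.eq_zero_of_apply_self hU ?_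
    have h5 := hpair p
    rwa [hpD, hpw, mul_zero, zero_add, zero_add] at h5
  have hu : u = 0 := by
    refine injective_fderiv_localMap hι hy ?_
    rw [hτ, hp] at h1
    simpa using h1
  rw [hτ, hu, hp]
  rfl

/-- The normal exponential map is defined, smooth and immersive near the zero section. -/
theorem eventually_collar [T2Space M] (g : Metric E M) (hι : ∀ b, Function.Injective (dιAt ι b))
    {W₀ : AmbientBundle ι} (hW₀ : W₀ ∈ unitNormalBundle g ι) :
    ∀ᶠ q : ℝ × AmbientBundle ι in 𝓝 (0, W₀),
      (⟨ι q.2.proj, q.1 • q.2.2⟩ : TangentBundle 𝓘(ℝ, E) M) ∈ expDomain g ∧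
      ContMDiffAt (𝓘(ℝ, ℝ).prod (𝓘(ℝ, F).prod 𝓘(ℝ, E))) 𝓘(ℝ, E) ∞ (blowDown g ι) q ∧
      (q.1 ≠ 0 → ∀ X ∈ collarTangentVectors ι (unitNormalBundle g ι) q.2,
        dBlowDown g ι q.1 q.2 X = 0 → X = 0) := by
  obtain ⟨Exp, N, hE, h0, hloc⟩ := exists_localBlowDown (ι := ι) g W₀.proj
  have hN := eventually_localBlowDown_mem hE W₀ h0
  -- Although dℰ degenerates at r = 0, the auxiliary operator does not; injectivity is an open
  -- condition on operators and persists for small r.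
  have hinj : ∀ᶠ q : ℝ × F × E in 𝓝 (0, coords W₀ W₀),
      Function.Injective (collarOperator g ι W₀.proj Exp q) :=
    (continuousAt_collarOperator g hE hN.self_of_nhds.1 hN.self_of_nhds.2).eventually
      (ContinuousLinearMap.isOpen_injective.mem_nhds (injective_collarOperator g hι hE h0 hW₀))
  filter_upwards [eventually_snd_mem_chartDomain 0 W₀,
    (continuousAt_collarCoords 0 W₀).eventually (hN.and hinj)] with q hW hq
  obtain ⟨r, W⟩ := q
  obtain ⟨⟨hy, hqN⟩, hinj⟩ := hq
  obtain ⟨hdom, hsrc, hsm, hev⟩ := hloc W₀ rfl r W hW hqN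
  refine ⟨hdom, hsm, fun hr X hX hX0 => ?_⟩
  have hdf := (contDiffAt_localBlowDown hE (b₀ := W₀.proj) (q := (r, coords W₀ W)) hy
    hqN).differentiableAt (by simp)
  have h1 := chartDifferential_dBlowDownAt g hW hsrc (hsm.mdifferentiableAt (by simp)) hdf hev X
  have h2 : dBlowDownAt g r W X = 0 := hX0
  rw [h2, map_zero, fderiv_localBlowDown (ι := ι) hE (b₀ := W₀.proj) (q := (r, coords W₀ W)) hy
    hqN] at h1
  have h3 := constraint_of_mem_tangentVectors g hW hX
  set ζ := coordsDifferential W₀ W X.2 with ζ_def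
  -- With p = r ω the first block is dℰ(X), while the second is r times the derivative of the
  -- constraint on a tangent vector, hence 0. The factor r on u in the second block is there for
  -- this.
  have h4 : collarOperator g ι W₀.proj Exp (r, coords W₀ W) (X.1, ζ.1, r • ζ.2) = 0 := by
    rw [collarOperator_apply, Prod.mk_eq_zero]
    refine ⟨h1.symm, ?_⟩
    have h5 : ((r • ζ.1, r • ζ.2) : F × E) = r • ζ := rfl
    simp only
    rw [h5, map_smul, h3, smul_zero]
  have h5 : ((X.1, ζ.1, r • ζ.2) : ℝ × F × E) = 0 := hinj (h4.trans (map_zero _).symm)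
  simp only [Prod.mk_eq_zero, smul_eq_zero, hr, false_or] at h5
  have h6 : coordsDifferential W₀ W X.2 = 0 := Prod.ext h5.2.1 h5.2.2
  exact Prod.ext h5.1 (coordsDifferential_injective hW (h6.trans (map_zero _).symm))

end Collar

/-! ### Positivity of the corrected model metric and the first-order perturbation. -/

section FirstOrder

variable {E : Type*} [NormedAddCommGroup E] [NormedSpace ℝ E] [FiniteDimensional ℝ E]
  {M : Type*} [TopologicalSpace M] [ChartedSpace E M] [IsManifold 𝓘(ℝ, E) ∞ M]
  {F : Type*} [NormedAddCommGroup F] [NormedSpace ℝ F] [FiniteDimensional ℝ F]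
  {B : Type*} [TopologicalSpace B] [ChartedSpace F B] [IsManifold 𝓘(ℝ, F) ∞ B]
  {ι : C^∞⟮𝓘(ℝ, F), B; 𝓘(ℝ, E), M⟯}

/-- The form `g^B - 2 r II` in the charts at `b₀` and `ι b₀`. -/
def localBaseForm (g : Metric E M) (ι : C^∞⟮𝓘(ℝ, F), B; 𝓘(ℝ, E), M⟯) (b₀ : B) (q : ℝ × F × E) :
    F →L[ℝ] F →L[ℝ] ℝ :=
  localGram g ι b₀ q.2.1 - (2 * q.1) •
    (ContinuousLinearMap.compL ℝ F E ℝ (chartMetric g (ι b₀) (localMap ι b₀ q.2.1) q.2.2)).comp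
      (fderiv ℝ (fderiv ℝ (localMap ι b₀)) q.2.1 +
        (christoffelSymbol (chartMetric g (ι b₀)) (localMap ι b₀ q.2.1)).bilinearComp
          (fderiv ℝ (localMap ι b₀) q.2.1) (fderiv ℝ (localMap ι b₀) q.2.1))

theorem localBaseForm_apply (g : Metric E M) (b₀ : B) (q : ℝ × F × E) (u v : F) :
    localBaseForm g ι b₀ q u v = chartMetric g (ι b₀) (localMap ι b₀ q.2.1)
        (fderiv ℝ (localMap ι b₀) q.2.1 u) (fderiv ℝ (localMap ι b₀) q.2.1 v) -
      2 * q.1 * chartMetric g (ι b₀) (localMap ι b₀ q.2.1) q.2.2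
        (fderiv ℝ (fderiv ℝ (localMap ι b₀)) q.2.1 u v +
          christoffelSymbol (chartMetric g (ι b₀)) (localMap ι b₀ q.2.1)
            (fderiv ℝ (localMap ι b₀) q.2.1 u) (fderiv ℝ (localMap ι b₀) q.2.1 v)) := rfl

theorem continuousAt_localBaseForm (g : Metric E M) {b₀ : B} {q : ℝ × F × E}
    (hq : q.2.1 ∈ localDomain ι b₀) : ContinuousAt (localBaseForm g ι b₀) q := by
  rw [continuousAt_clm_apply]
  intro u
  rw [continuousAt_clm_apply]
  intro v
  have h1 : ContinuousAt (fun q : ℝ × F × E => q.2.1) q := by fun_prop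
  have hD : ContinuousAt (fun q : ℝ × F × E => fderiv ℝ (localMap ι b₀) q.2.1) q :=
    ContinuousAt.comp (g := fderiv ℝ (localMap ι b₀)) (f := fun q : ℝ × F × E => q.2.1)
      (x := q) (contDiffAt_fderiv_localMap hq).continuousAt h1
  have hD2 : ContinuousAt (fun q : ℝ × F × E => fderiv ℝ (fderiv ℝ (localMap ι b₀)) q.2.1) q :=
    ContinuousAt.comp (g := fderiv ℝ (fderiv ℝ (localMap ι b₀))) (f := fun q : ℝ × F × E => q.2.1)
      (x := q) ((contDiffAt_fderiv_localMap hq).fderiv_right (m := 0) (by simp)).continuousAt h1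
  have hG : ContinuousAt (fun q : ℝ × F × E =>
      chartMetric g (ι b₀) (localMap ι b₀ q.2.1)) q :=
    ContinuousAt.comp (g := fun y => chartMetric g (ι b₀) (localMap ι b₀ y))
      (f := fun q : ℝ × F × E => q.2.1)
      (x := q) (contDiffAt_chartMetric_localMap g hq).continuousAt h1
  have hc : ContinuousAt (fun q : ℝ × F × E => localMap ι b₀ q.2.1) q :=
    ContinuousAt.comp (g := localMap ι b₀) (f := fun q : ℝ × F × E => q.2.1)
      (x := q) (contDiffAt_localMap_of_mem hq).continuousAt h1
  have hΓ : ContinuousAt (fun q : ℝ × F × E =>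
      christoffelSymbol (chartMetric g (ι b₀)) (localMap ι b₀ q.2.1)) q :=
    ContinuousAt.comp (g := christoffelSymbol (chartMetric g (ι b₀)))
      (f := fun q : ℝ × F × E => localMap ι b₀ q.2.1) (x := q)
      ((isMetricOn_chartMetric g (ι b₀)).contDiffOn_christoffelSymbol.continuousOn.continuousAt
        ((isMetricOn_chartMetric g (ι b₀)).isOpen.mem_nhds (localMap_mem_target hq))) hc
  have hu := hD.clm_apply (continuousAt_const (y := u))
  have hv := hD.clm_apply (continuousAt_const (y := v))
  have hw : ContinuousAt (fun q : ℝ × F × E => q.2.2) q := by fun_prop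
  have hr : ContinuousAt (fun q : ℝ × F × E => 2 * q.1) q := by fun_prop
  have huv := (hD2.clm_apply (continuousAt_const (y := u))).clm_apply (continuousAt_const (y := v))
  exact ((hG.clm_apply hu).clm_apply hv).sub
    (hr.mul ((hG.clm_apply hw).clm_apply (huv.add ((hΓ.clm_apply hu).clm_apply hv))))

theorem coordsDifferential_fst {W₀ W : AmbientBundle ι} (hW : W.proj ∈ chartDomain ι W₀.proj)
    (ζ : F × E) :
    (coordsDifferential W₀ W ζ).1 = chartDifferential 𝓘(ℝ, F) W₀.proj W.proj ζ.1 := by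
  rw [← chartDifferential_dπAt hW, dπAt_apply]

/-- The form `g^B - 2 r II` in a fixed chart, on vectors tangent to the unit normal bundle. -/
theorem localBaseForm_coords (g : Metric E M) {W₀ W : AmbientBundle ι}
    (hW : W.proj ∈ chartDomain ι W₀.proj) {ζ : F × E}
    (hζ : ζ ∈ tangentVectors ι (unitNormalBundle g ι) W) (r : ℝ) :
    localBaseForm g ι W₀.proj (collarCoords W₀ (r, W)) (coordsDifferential W₀ W ζ).1
        (coordsDifferential W₀ W ζ).1 =
      innerAt g (ι W.proj) (dιAt ι W.proj ζ.1) (dιAt ι W.proj ζ.1) -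
        2 * r * secondAt g W ζ.1 ζ.1 := by
  have h1 := ((innerAt_covDerivAt g hζ).2 ζ.1).symm.trans ((chart_relations g hW hζ).2 ζ.1)
  rw [neg_inj, ← coordsDifferential_fst hW, (isMetricOn_chartMetric g (ι W₀.proj)).symm _
    (localMap_mem_target (coords_fst_mem hW))] at h1
  rw [h1, localBaseForm_apply, ← chartMetric_coords g hW, ← fderiv_localMap_coordsDifferential hW]
  rfl

theorem correctedModelMetric_apply (g : Metric E M) (r : ℝ) (W : AmbientBundle ι)
    (X Y : ℝ × F × E) :
    correctedModelMetric g ι r W X Y = X.1 * Y.1 + r ^ 2 *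
      innerAt g (ι W.proj) (normalCovDerivAt g W X.2) (normalCovDerivAt g W Y.2) +
      innerAt g (ι W.proj) (dιAt ι W.proj X.2.1) (dιAt ι W.proj Y.2.1) -
      2 * r * secondAt g W X.2.1 Y.2.1 := by
  rw [← dπAt_apply W X.2, ← dπAt_apply W Y.2]
  rfl

theorem correctedModelMetric_symm (g : Metric E M) (r : ℝ) (W : AmbientBundle ι)
    (X Y : ℝ × F × E) :
    correctedModelMetric g ι r W X Y = correctedModelMetric g ι r W Y X := by
  rw [correctedModelMetric_apply, correctedModelMetric_apply,
    innerAt_symm g _ (normalCovDerivAt g W X.2), innerAt_symm g _ (dιAt ι W.proj X.2.1),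
    secondAt_symm, mul_comm X.1]

/-- A vector tangent to the unit normal bundle with vanishing horizontal and vertical parts
vanishes. -/
theorem eq_zero_of_mem_tangentVectors (g : Metric E M) (hι : ∀ b, Function.Injective (dιAt ι b))
    {W : AmbientBundle ι} {ζ : F × E} (hζ : ζ ∈ tangentVectors ι (unitNormalBundle g ι) W)
    (h1 : ζ.1 = 0) (h2 : normalCovDerivAt g W ζ = 0) : ζ = 0 := by
  obtain ⟨⟨t, ht⟩, -, -⟩ := orthogonality_relations g hι hζ
  rw [h2, zero_add] at ht
  have h3 := (innerAt_covDerivAt g hζ).2 t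
  rw [h1, map_zero, LinearMap.zero_apply, neg_zero, ht] at h3
  have h4 := eq_zero_of_innerAt_self g _ h3
  rw [h4, covDerivAt_apply, h1, map_zero, map_zero, zero_apply, add_zero] at ht
  exact Prod.ext h1 ht

/-- The corrected model metric is positive definite near the zero section. -/
theorem eventually_correctedModelMetric_pos (g : Metric E M)
    (hι : ∀ b, Function.Injective (dιAt ι b)) (W₀ : AmbientBundle ι) :
    ∀ᶠ q : ℝ × AmbientBundle ι in 𝓝 (0, W₀), q.1 ≠ 0 →
      ∀ X ∈ collarTangentVectors ι (unitNormalBundle g ι) q.2, X ≠ 0 →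
        0 < correctedModelMetric g ι q.1 q.2 X X := by
  have hy : (coords W₀ W₀).1 ∈ localDomain ι W₀.proj := coords_fst_mem (mem_chartDomain _)
  have hpos : ∀ v : F, v ≠ 0 → 0 < localBaseForm g ι W₀.proj (0, coords W₀ W₀) v v := by
    intro v hv
    rw [localBaseForm_apply]
    simp only [mul_zero, zero_mul, sub_zero]
    exact (isMetricOn_localGram g hι W₀.proj).pos _ hy v hv
  -- At r = 0 the form g^B - 2r II is g^B, so it keeps a positive lower bound nearby. The full
  -- metric is then a sum of nonnegative terms, and if it vanishes all components of X do.
  obtain ⟨δ, hδ, hlow⟩ := exists_eventually_mul_sq_norm_le hpos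
  have hcont : ContinuousAt (localBaseForm g ι W₀.proj) (collarCoords W₀ (0, W₀)) :=
    continuousAt_localBaseForm g hy
  filter_upwards [eventually_snd_mem_chartDomain 0 W₀,
    (hcont.tendsto.comp (continuousAt_collarCoords 0 W₀).tendsto).eventually hlow]
    with q hW hle hr X hX hX0
  obtain ⟨r, W⟩ := q
  have h1 := hle (coordsDifferential W₀ W X.2).1
  simp only [Function.comp_apply] at h1
  rw [localBaseForm_coords g hW hX] at h1
  refine lt_of_lt_of_eq ?_ (correctedModelMetric_apply g r W X X).symm
  have hn := innerAt_self_nonneg g (ι W.proj) (normalCovDerivAt g W X.2)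
  have hr2 : 0 < r ^ 2 := by positivity
  have h2 := mul_nonneg hr2.le hn
  have h3 := mul_self_nonneg X.1
  have h4 := coordsDifferential_fst hW X.2
  by_contra! hle0
  have h5 : 0 ≤ δ * ‖(coordsDifferential W₀ W X.2).1‖ ^ 2 := by positivity
  have h6 : δ * ‖(coordsDifferential W₀ W X.2).1‖ ^ 2 = 0 := by linarith
  have h7 : (coordsDifferential W₀ W X.2).1 = 0 := by simpa [hδ.ne'] using h6
  have h8 : X.2.1 = 0 := chartDifferential_injective hW.1
    (h4.symm.trans (h7.trans (map_zero _).symm))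
  have h9 : X.1 = 0 := mul_self_eq_zero.1 (by linarith)
  have h10 : innerAt g (ι W.proj) (normalCovDerivAt g W X.2) (normalCovDerivAt g W X.2) = 0 :=
    (mul_eq_zero.1 (show r ^ 2 * _ = 0 by linarith)).resolve_left hr2.ne'
  exact hX0 (Prod.ext h9 (eq_zero_of_mem_tangentVectors g hι hX h8
    (eq_zero_of_innerAt_self g _ h10)))

/-- The form `-2 II`. -/
def correctionForm (g : Metric E M) (ι : C^∞⟮𝓘(ℝ, F), B; 𝓘(ℝ, E), M⟯) : CollarForm ι :=
  fun _ W => (-2 : ℝ) • (secondFundamentalForm g ι W).compl₁₂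
    ((dπ ι W).toLinearMap ∘ₗ LinearMap.snd ℝ ℝ (AmbientTangent ι W))
    ((dπ ι W).toLinearMap ∘ₗ LinearMap.snd ℝ ℝ (AmbientTangent ι W))

theorem correctionForm_apply (g : Metric E M) (r : ℝ) (W : AmbientBundle ι) (X Y : ℝ × F × E) :
    correctionForm g ι r W X Y = -2 * secondAt g W X.2.1 Y.2.1 := by
  rw [← dπAt_apply W X.2, ← dπAt_apply W Y.2]
  rfl

theorem IsSmoothFamily.contDiffAt_correctionForm {X : Type*} [NormedAddCommGroup X]
    [NormedSpace ℝ X] {g : Metric E M} {W₀ : AmbientBundle ι} {x₀ : X} {W : X → AmbientBundle ι}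
    {Z Z' : X → ℝ × F × E} (h : IsSmoothFamily g W₀ x₀ W Z) (h' : IsSmoothFamily g W₀ x₀ W Z')
    (r₀ : ℝ) : ContDiffAt ℝ ∞ (fun q : ℝ × X =>
      correctionForm g ι q.1 (W q.2) (Z q.2) (Z' q.2)) (r₀, x₀) := by
  have h1 : ContDiffAt ℝ ∞ (fun q : ℝ × X => -2 * NormalBlowUp.secondAt g (W q.2)
      (Z q.2).2.1 (Z' q.2).2.1) (r₀, x₀) := contDiffAt_const.mul (h.secondAt h').snd'
  exact h1.congr_of_eventuallyEq
    (Filter.Eventually.of_forall fun q => correctionForm_apply g q.1 (W q.2) (Z q.2) (Z' q.2))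

theorem isSmoothForm_correctionForm (g : Metric E M) (ε : ℝ) :
    IsSmoothForm ι (unitNormalBundle g ι) ε (correctionForm g ι) := by
  intro n O P hO hP hN τ τ' e e' q₀ hq₀
  have hZ := isSmoothFamily_mfderiv g hO hP hN hq₀.2 τ e
  have hZ' := isSmoothFamily_mfderiv g hO hP hN hq₀.2 τ' e'
  exact (hZ.contDiffAt_correctionForm hZ' q₀.1).contDiffWithinAt

/-- Existence of a collar on which the corrected model metric is a first-order perturbation of the
model metric. -/
theorem exists_isCollarWidth [T2Space M] [CompactSpace B] (g : Metric E M)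
    (hι : ∀ b, Function.Injective (dιAt ι b)) :
    ∃ ε : ℝ, IsCollarWidth g ι ε ∧
      IsPerturbation g ι 1 ε (modelMetric g ι) (correctedModelMetric g ι) := by
  -- Compactness yields one ε serving both the collar conditions and positivity.
  obtain ⟨ε, hε, h⟩ := eventually_forall_unitNormalBundle g
    (p := fun r W => ((⟨ι W.proj, r • W.2⟩ : TangentBundle 𝓘(ℝ, E) M) ∈ expDomain g ∧
      ContMDiffAt (𝓘(ℝ, ℝ).prod (𝓘(ℝ, F).prod 𝓘(ℝ, E))) 𝓘(ℝ, E) ∞ (blowDown g ι) (r, W) ∧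
      (r ≠ 0 → ∀ X ∈ collarTangentVectors ι (unitNormalBundle g ι) W,
        dBlowDown g ι r W X = 0 → X = 0)) ∧
      (r ≠ 0 → ∀ X ∈ collarTangentVectors ι (unitNormalBundle g ι) W, X ≠ 0 →
        0 < correctedModelMetric g ι r W X X))
    fun W₀ hW₀ => (eventually_collar g hι hW₀).and (eventually_correctedModelMetric_pos g hι W₀)
  have hIco : ∀ r ∈ Ico 0 ε, |r| < ε := fun r hr => by rw [abs_of_nonneg hr.1]; exact hr.2
  have hIoo : ∀ r ∈ Ioo 0 ε, |r| < ε := fun r hr => hIco r ⟨hr.1.le, hr.2⟩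
  refine ⟨ε, ⟨hε, fun r hr W hW => (h r (hIco r hr) W hW).1.1,
    fun r hr W hW => (h r (hIco r hr) W hW).1.2.1,
    fun r hr W hW => (h r (hIoo r hr) W hW).1.2.2 hr.1.ne'⟩,
    ⟨fun r _ W _ X _ Y _ => correctedModelMetric_symm g r W X Y,
    fun r hr W hW => (h r (hIoo r hr) W hW).2 hr.1.ne',
    ⟨correctionForm g ι, isSmoothForm_correctionForm g ε, fun r _ W _ X _ Y _ => ?_,
      fun r hr W _ X _ Y _ => ?_⟩⟩⟩
  · exact (correctionForm_apply g r W X Y).trans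
      ((congrArg (-2 * ·) (secondAt_symm g W _ _)).trans (correctionForm_apply g r W Y X).symm)
  · refine (twist_correctedModelMetric g (hι _) hr.1.ne' X Y).trans ?_
    refine Eq.trans ?_ (congrArg₂ (fun a b => a + r ^ 1 * b)
      (twist_modelMetric g (hι _) hr.1.ne' X Y) (correctionForm_apply g r W X Y)).symm
    ring

end FirstOrder

end NormalBlowUp

end

theorem mainTheorem9
    {E : Type*} [NormedAddCommGroup E] [NormedSpace ℝ E] [FiniteDimensional ℝ E]
    {M : Type*} [TopologicalSpace M] [T2Space M] [ChartedSpace E M] [IsManifold 𝓘(ℝ, E) ∞ M]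
    {F : Type*} [NormedAddCommGroup F] [NormedSpace ℝ F] [FiniteDimensional ℝ F]
    {B : Type*} [TopologicalSpace B] [CompactSpace B] [ChartedSpace F B]
    [IsManifold 𝓘(ℝ, F) ∞ B]
    (g : NormalBlowUp.Metric E M) (ι : C^∞⟮𝓘(ℝ, F), B; 𝓘(ℝ, E), M⟯)
    (hι : Manifold.IsSmoothEmbedding 𝓘(ℝ, F) 𝓘(ℝ, E) ∞ ι) :
    (∃ ε : ℝ, NormalBlowUp.IsCollarWidth g ι ε ∧
      NormalBlowUp.IsPerturbation g ι 1 ε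
        (NormalBlowUp.modelMetric g ι) (NormalBlowUp.correctedModelMetric g ι)) ∧
    ∀ ε : ℝ, NormalBlowUp.IsCollarWidth g ι ε →
      NormalBlowUp.IsPerturbation g ι 2 ε
        (NormalBlowUp.correctedModelMetric g ι) (NormalBlowUp.pullbackMetric g ι) := by
  -- The embedding enters through the injectivity of its differentials, which makes the induced
  -- metric nondegenerate.
  have hinj : ∀ b, Function.Injective (NormalBlowUp.dιAt ι b) :=
    NormalBlowUp.injective_dιAt hι.isImmersion
  exact ⟨NormalBlowUp.exists_isCollarWidth g hinj,
    fun _ hε => NormalBlowUp.isPerturbation_pullbackMetric g hinj hε⟩
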